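/- **Setting.** Let $(M,g)$ and $(\bar M,\bar g)$ be closed (compact, without boundary) smooth Riemannian manifolds of dimension $n$, and let $c:M\times\bar M\to\mathbf R\cup\{+\infty\}$. Let $\mathrm{sing}(c)$ be the set of points of $M\times\bar M$ that have no neighbourhood on which $c$ is finite and $C^\infty$. Unbarred indices denote derivatives of $c$ in $x\in M$, barred ones derivatives in $\bar x\in\bar M$, in local coordinates; $c^{\bar s m}$ is the inverse matrix of $c_{m\bar s}$. Assume that, off $\mathrm{sing}(c)$, $\det c_{i\bar j}\neq0$ and, for each $x$, the map $\bar x\mapsto D_xc(x,\bar x)$ is injective. A map $T:M\to\bar M$ has *potential* $u:M\to\mathbf R$ if for all $x\in M$ one has $(x,T(x))\notin\mathrm{sing}(c)$ and $-D_xc(x,T(x))=D_xu(x)$. Put $w_{ij}(x)=u_{ij}(x)+c_{ij}(x,T(x))$ (a symmetric $2$-tensor on $M$) and $w_{zz}=w_{ij}z^iz^j$; $u$ is *locally strictly $c$-convex* if $w$ is positive definite at every point. Assume: (i) $\mathsf{MTW}(\delta)$ for some $\delta>0$: off $\mathrm{sing}(c)$, for all $V\in T_xM$, $\eta\in T_x^*M$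 with $\eta(V)=0$, $$\left(-c_{ij\bar r\bar p}+c_{ij\bar s}c^{\bar sm}c_{m\bar p\bar r}\right)V^iV^jc^{\bar pk}c^{\bar rl}\eta_k\eta_l\ \ge\ \delta\,\|V\|_g^2\,\|\eta\|_g^2 .$$ (ii) The stay-away-from-singularity property: for all $\lambda_1,\lambda_2>0$ there is $\epsilon>0$ such that every differentiable $T$ that has a $C^2$ locally strictly $c$-convex potential and satisfies $\lambda_1\le|\det DT|\le\lambda_2$ on $M$ satisfies $\mathrm{dist}(\mathrm{graph}(T),\mathrm{sing}(c))\ge\epsilon$ (determinant with respect to $g,\bar g$, distance with respect to $g\oplus\bar g$). Let $\rho,\bar\rho$ be smooth positive densities on $M,\bar M$, and write $\rho(x),\bar\rho(\bar x)$ for their expressions in local coordinates. A *smooth solution of the flow on $M\times[0,l)$*, $0<l\le\infty$, is a smooth $u:M\times[0,l)\to\mathbf R$ such that each $u(\cdot,t)$ is the potential of a map $T=T(\cdot,t)$, $u(\cdot,0)$ is locally strictly $c$-convex, $\det w_{ij}>0$ on $M\times[0,l)$, and $$u_t=\theta:=\ln\det w_{ij}-\ln\rho(x)+\ln\bar\rho(T(x))-\ln\left|\det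 c_{i\bar s}(x,T(x))\right| .$$ **Theorem 3.5.** Let $M,\bar M,g,\bar g,c,\rho,\bar\rho,\delta$ be as above. For every $\Theta\in\mathbf R$ there is a constant $C$, depending only on these data and on $\Theta$ (in particular not on $t$, $l$ or $u$), such that for every smooth solution $u$ of the flow on $M\times[0,l)$ with $|\theta|\le\Theta$ at $t=0$: 1. If $t\in[0,l)$ and $v\in T_xM$, $|v|_g=1$, satisfies $w_{vv}(x,t)=\max\{w_{zz}(y,t): y\in M,\ z\in T_yM,\ |z|_g=1\}$ and $w_{vv}(x,t)\ge C$, then the time derivative $w_{vvt}(x,t)$ (with $x$ and $v$ fixed; one-sided at $t=0$) exists and $w_{vvt}(x,t)\le0$. 2. In particular the values $w_{zz}(y,0)$, $|z|_g=1$, are bounded above, and for all $(x,t)\in M\times[0,l)$ and $z\in T_xM$ with $|z|_g=1$, $$w_{zz}(x,t)\ \le\ \max\Big\{C,\ \sup_{y\in M,\ z'\in T_yM,\ |z'|_g=1}w_{z'z'}(y,0)\Big\},$$ a bound that is uniform in time. -/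

import Mathlib

open Set Bundle
open scoped Manifold ContDiff

noncomputable section

namespace TransportFlow

/-! ### Calculus of a cost function in local coordinates

`M` is the source manifold, `N` the target manifold, both of dimension `n`.  The tangent space of
a manifold at a point `x` is, in Mathlib, the model space `EuclideanSpace ℝ (Fin n)`: a tangent
vector at `x` is identified with its coordinates in the preferred chart at `x`.  Every coordinate
expression below is computed in the preferred charts at the two points concerned. -/

/-- The `i`-th coordinate vector. -/
def coordVec {n : ℕ} (i : Fin n) : EuclideanSpace ℝ (Fin n) := EuclideanSpace.single i 1

/-- Derivative of `F (a, b)` in the first variable, in the direction `V`. -/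
def pd1 {n : ℕ} (V : EuclideanSpace ℝ (Fin n))
    (F : EuclideanSpace ℝ (Fin n) → EuclideanSpace ℝ (Fin n) → ℝ) :
    EuclideanSpace ℝ (Fin n) → EuclideanSpace ℝ (Fin n) → ℝ :=
  fun a b => fderiv ℝ (fun a' => F a' b) a V

/-- Derivative of `F (a, b)` in the second variable, in the direction `W`. -/
def pd2 {n : ℕ} (W : EuclideanSpace ℝ (Fin n))
    (F : EuclideanSpace ℝ (Fin n) → EuclideanSpace ℝ (Fin n) → ℝ) :
    EuclideanSpace ℝ (Fin n) → EuclideanSpace ℝ (Fin n) → ℝ :=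
  fun a b => fderiv ℝ (fun b' => F a b') b W

section Cost

variable {n : ℕ} {M N : Type*}
  [TopologicalSpace M] [ChartedSpace (EuclideanSpace ℝ (Fin n)) M]
  [TopologicalSpace N] [ChartedSpace (EuclideanSpace ℝ (Fin n)) N]

/-- The `i`-th coordinate vector of the preferred chart at `x`, as a tangent vector at `x`. -/
def tanVec (x : M) (i : Fin n) : TangentSpace (𝓡 n) x := coordVec i

/-- The real value of a cost with values in `ℝ ∪ {+∞}` (junk value `0` where the cost is `+∞`; it
is only used near points where the cost is finite and smooth). -/
def realCost (c : M × N → WithTop ℝ) (x : M) (y : N) : ℝ := (c (x, y)).untopD 0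

variable (n) in
/-- `sing(c)`: the points that have no open neighbourhood on which `c` is finite and smooth. -/
def singSet (c : M × N → WithTop ℝ) : Set (M × N) :=
  {p | ¬ ∃ U : Set (M × N), IsOpen U ∧ p ∈ U ∧ (∀ q ∈ U, c q ≠ ⊤) ∧
    ContMDiffOn ((𝓡 n).prod (𝓡 n)) 𝓘(ℝ, ℝ) ∞ (fun q : M × N => realCost c q.1 q.2) U}

/-- The differential of a real function, as a covector. -/
def covector (f : M → ℝ) (x : M) : TangentSpace (𝓡 n) x →L[ℝ] ℝ :=
  mfderiv (𝓡 n) 𝓘(ℝ, ℝ) f x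

/-- `D_x c(x, y)`, a covector at `x`. -/
def DxCost (c : M × N → WithTop ℝ) (x : M) (y : N) : TangentSpace (𝓡 n) x →L[ℝ] ℝ :=
  covector (fun x' => realCost c x' y) x

/-- The cost written in the preferred charts at `x` and `y`. -/
def costLoc (c : M × N → WithTop ℝ) (x : M) (y : N) :
    EuclideanSpace ℝ (Fin n) → EuclideanSpace ℝ (Fin n) → ℝ :=
  fun a b => realCost c ((extChartAt (𝓡 n) x).symm a) ((extChartAt (𝓡 n) y).symm b)

/-- Evaluation at the coordinates of `(x, y)`. -/
def atPt (x : M) (y : N)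
    (F : EuclideanSpace ℝ (Fin n) → EuclideanSpace ℝ (Fin n) → ℝ) : ℝ :=
  F (extChartAt (𝓡 n) x x) (extChartAt (𝓡 n) y y)

/-- The matrix `c_{i s̄}(x, y)`, with row index `i` (in `M`) and column index `s̄` (in `N`). -/
def mixedHess (c : M × N → WithTop ℝ) (x : M) (y : N) : Matrix (Fin n) (Fin n) ℝ :=
  Matrix.of fun i s => atPt x y (pd2 (coordVec s) (pd1 (coordVec i) (costLoc c x y)))

/-- Raising an index: `η_k ↦ c^{p̄ k} η_k`, where `c^{p̄ k}` is the inverse of `c_{k p̄}`. -/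
def sharp (c : M × N → WithTop ℝ) (x : M) (y : N) (η : TangentSpace (𝓡 n) x →L[ℝ] ℝ) :
    EuclideanSpace ℝ (Fin n) :=
  ∑ p, ∑ k, ((mixedHess (n := n) c x y)⁻¹ p k * η (tanVec x k)) • coordVec p

/-- The Ma-Trudinger-Wang tensor in its `(2,2)` form, evaluated at `(V, η, V, η)`:
`(- c_{ij r̄ p̄} + c_{ij s̄} c^{s̄ m} c_{m p̄ r̄}) V^i V^j c^{p̄ k} c^{r̄ l} η_k η_l`. -/
def mtw (c : M × N → WithTop ℝ) (x : M) (y : N) (V : TangentSpace (𝓡 n) x)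
    (η : TangentSpace (𝓡 n) x →L[ℝ] ℝ) : ℝ :=
  let F := costLoc (n := n) c x y
  let W := sharp c x y η
  (∑ s, ∑ m, atPt x y (pd2 (coordVec s) (pd1 V (pd1 V F))) *
      (mixedHess (n := n) c x y)⁻¹ s m * atPt x y (pd2 W (pd2 W (pd1 (coordVec m) F)))) -
    atPt x y (pd2 W (pd2 W (pd1 V (pd1 V F))))

variable (n) in
/-- Standing assumption on the cost: for each `x` the map `y ↦ D_x c(x, y)` is injective on the
points `y` with `(x, y) ∉ sing(c)`. -/
def IsTwisted (c : M × N → WithTop ℝ) : Prop :=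
  ∀ x : M, InjOn (fun y : N => DxCost (n := n) c x y) {y | (x, y) ∉ singSet n c}

variable (n) in
/-- Standing assumption on the cost: `det c_{i s̄} ≠ 0` off `sing(c)`. -/
def IsNondegenerate (c : M × N → WithTop ℝ) : Prop :=
  ∀ (x : M) (y : N), (x, y) ∉ singSet n c → (mixedHess (n := n) c x y).det ≠ 0

variable (n) in
/-- `T` is the map with potential `u`: `- D_x c(x, T(x)) = D u(x)`, the derivative being taken at
points off `sing(c)`. -/
def IsPotentialMap (c : M × N → WithTop ℝ) (u : M → ℝ) (T : M → N) : Prop :=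
  ∀ x : M, (x, T x) ∉ singSet n c ∧ -DxCost (n := n) c x (T x) = covector u x

/-- The Hessian of `f` at `x` in the preferred chart at `x`.  (At a critical point of `f` it does
not depend on the coordinates.) -/
def hessAt (f : M → ℝ) (x : M) (V W : TangentSpace (𝓡 n) x) : ℝ :=
  fderiv ℝ (fun a => fderiv ℝ (fun a' => f ((extChartAt (𝓡 n) x).symm a')) a V)
    (extChartAt (𝓡 n) x x) W

/-- `w(V, W) = (u_{ij}(x) + c_{ij}(x, T(x))) V^i W^j`: the Hessian at `x` of
`x' ↦ u(x') + c(x', T(x))`, which has a critical point at `x` when `T` has potential `u`. -/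
def wForm (c : M × N → WithTop ℝ) (u : M → ℝ) (T : M → N) (x : M)
    (V W : TangentSpace (𝓡 n) x) : ℝ :=
  hessAt (fun x' => u x' + realCost c x' (T x)) x V W

variable (n) in
/-- Local strict `c`-convexity: `u_{ij}(x) + c_{ij}(x, T(x))` is positive definite for each `x`. -/
def IsLocallyStrictlyCConvex (c : M × N → WithTop ℝ) (u : M → ℝ) (T : M → N) : Prop :=
  ∀ (x : M) (V : TangentSpace (𝓡 n) x), V ≠ 0 → 0 < wForm c u T x V V

variable (n) in
/-- `det w_{ij}` in the preferred chart at `x`. -/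
def detW (c : M × N → WithTop ℝ) (u : M → ℝ) (T : M → N) (x : M) : ℝ :=
  (Matrix.of fun i j : Fin n =>
    wForm c u T x (tanVec x i) (tanVec x j)).det

end Cost

/-! ### Quantities that involve the Riemannian metrics -/

section Metric

variable {n : ℕ} {M N : Type*}
  [EMetricSpace M] [ChartedSpace (EuclideanSpace ℝ (Fin n)) M]
  [RiemannianBundle (fun x : M => TangentSpace (𝓡 n) x)]
  [EMetricSpace N] [ChartedSpace (EuclideanSpace ℝ (Fin n)) N]
  [RiemannianBundle (fun y : N => TangentSpace (𝓡 n) y)]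

variable (n) in
/-- `√(det g_{ij}(x))` in the preferred chart at `x`: the density of the Riemannian volume. -/
def volDensity (x : M) : ℝ :=
  Real.sqrt (Matrix.of fun i j : Fin n =>
    inner ℝ (tanVec x i) (tanVec x j)).det

/-- Condition `MTW(δ)` with respect to the metric of `M`:
`MTW(V, η, V, η) ≥ δ ‖V‖² ‖η‖²` off `sing(c)` whenever `η(V) = 0`. -/
def MTWCondition (c : M × N → WithTop ℝ) (δ : ℝ) : Prop :=
  ∀ (x : M) (y : N), (x, y) ∉ singSet n c →
    ∀ (V : TangentSpace (𝓡 n) x) (η : TangentSpace (𝓡 n) x →L[ℝ] ℝ), η V = 0 →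
      δ * ‖V‖ ^ 2 * ‖η‖ ^ 2 ≤ mtw c x y V η

variable (n) in
/-- `|det DT|` at `x`, computed with respect to the two Riemannian metrics. -/
def absDet (T : M → N) (x : M) : ℝ :=
  |(Matrix.of fun s i : Fin n =>
      (show EuclideanSpace ℝ (Fin n) from mfderiv (𝓡 n) (𝓡 n) T x (tanVec x i)) s).det| *
    volDensity n (T x) / volDensity n x

variable (n) in
/-- The stay-away-from-singularity property.  The distance of the graph of `T` to `sing(c)` is the
one of the product metric, whose square is the sum of the squares of the two distances; it is
`≥ ε` by convention if `sing(c)` is empty. -/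
def StayAway (c : M × N → WithTop ℝ) : Prop :=
  ∀ lam₁ lam₂ : ℝ, 0 < lam₁ → 0 < lam₂ → ∃ ε : ℝ, 0 < ε ∧
    ∀ (u : M → ℝ) (T : M → N), ContMDiff (𝓡 n) 𝓘(ℝ, ℝ) 2 u → MDifferentiable (𝓡 n) (𝓡 n) T →
      IsPotentialMap n c u T → IsLocallyStrictlyCConvex n c u T →
      (∀ x, lam₁ ≤ absDet n T x ∧ absDet n T x ≤ lam₂) →
      ∀ (x : M), ∀ p ∈ singSet n c,
        ENNReal.ofReal ε ^ 2 ≤ edist x p.1 ^ 2 + edist (T x) p.2 ^ 2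

variable (n) in
/-- `θ = ln det w_{ij} - ln ρ(x) + ln ρ̄(T(x)) - ln |det c_{i s̄}(x, T(x))|`.  The measures are
given by their densities `ρ`, `ρ'` with respect to the Riemannian volumes, so that their
densities in local coordinates are `ρ √(det g)` and `ρ' √(det ḡ)`. -/
def theta (c : M × N → WithTop ℝ) (ρ : M → ℝ) (ρ' : N → ℝ) (u : M → ℝ) (T : M → N) (x : M) : ℝ :=
  Real.log (detW n c u T x) - Real.log (ρ x * volDensity n x) +
    Real.log (ρ' (T x) * volDensity n (T x)) - Real.log |(mixedHess (n := n) c x (T x)).det|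

/-- The interval `[0, l)`, where `l` may be `+∞`. -/
def timeInterval (l : EReal) : Set ℝ := {t | 0 ≤ t ∧ (t : EReal) < l}

variable (n) in
/-- `u` is a smooth solution on `M × [0, l)` of the flow `u_t = θ`, and `T t` is the map with
potential `u t`.  The solution starts from a locally strictly `c`-convex function, and
`det w_{ij}` is positive, so that the logarithm in `θ` makes sense. -/
structure IsFlowSolution (c : M × N → WithTop ℝ) (ρ : M → ℝ) (ρ' : N → ℝ) (l : EReal)
    (u : ℝ → M → ℝ) (T : ℝ → M → N) : Prop where
  smooth : ContMDiffOn ((𝓡 n).prod 𝓘(ℝ, ℝ)) 𝓘(ℝ, ℝ) ∞ (fun p : M × ℝ => u p.2 p.1)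
    (univ ×ˢ timeInterval l)
  potential : ∀ t ∈ timeInterval l, IsPotentialMap n c (u t) (T t)
  initial_convex : IsLocallyStrictlyCConvex n c (u 0) (T 0)
  det_pos : ∀ t ∈ timeInterval l, ∀ x, 0 < detW n c (u t) (T t) x
  equation : ∀ t ∈ timeInterval l, ∀ x,
    HasDerivWithinAt (fun s => u s x) (theta n c ρ ρ' (u t) (T t) x) (timeInterval l) t

variable (n) in
/-- The set of all values `w_{zz}`, `z` a unit tangent vector of `M`. -/
def unitValues (c : M × N → WithTop ℝ) (u : M → ℝ) (T : M → N) : Set ℝ :=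
  {r | ∃ (x : M) (z : TangentSpace (𝓡 n) x), ‖z‖ = 1 ∧ wForm c u T x z z = r}

end Metric

end TransportFlow

end

/-! The twist condition makes `T x` a function of the 1-jet of the potential: near a regular pair
the map (a, b) ↦ (a, -D_a c(a, b)) is a local diffeomorphism, since its derivative is block
triangular with the mixed Hessian as essential block (`exists_legendreChart`). In fixed charts this
gives w = D²u - A(x, Du) and θ = ln det w - B(x, Du), with A(x, p) = -D_x²c at the point b
determined by p. The Ma-Trudinger-Wang tensor is then the second derivative of A in p
(`mtw_eq_fderiv_fderiv`), so `MTWCondition` says D_p²A(η, η)(V, V) ≥ δ|V|²|η|² whenever η(V) = 0.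

Uniformity of the constant. At a spatial critical point, θ_t is a trace of second derivatives of θ,
so the maximum principle keeps |θ| ≤ Θ (`IsFlowSolution.abs_theta_le`). Differentiating -D_x c(x, T
x) = Du gives |det DT| = e^θ ρ / ρ' (`IsFlowSolution.absDet_eq`), which is therefore pinched between
constants. A continuity argument preserves convexity (`IsFlowSolution.convex`). The stay-away
property then confines every graph to one compact set off sing(c) (`exists_isCompact_graph`), on
which A, B, the metric g and their derivatives up to order two are bounded locally by a constant k.
As ln det w = θ + B, the determinant of w is bounded too.

The estimate. At the maximum Λ of w_vv / g_vv, w_vvt equals θ_vv - D_pA(Dθ)(v, v). Concavity of ln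
det is used in the form ln det w ≤ const + Σ w(f_i, f_i), with equality at the base point when the
f_i are orthonormal for w there; likewise w_vv ≤ Λ g_vv touches at the maximum. Comparing
derivatives of touching functions, exchanging fourth derivatives of u, and eliminating third
derivatives through a vector κ dual to p ↦ D_pA(p)(v, v) leaves only second derivatives of u
(`evolution_le`). Because v is an eigenvector, w(v, ·) = Λ g(v, ·), and the term -Σ D²A(Jv, Jv)(f_i,
f_i) is, up to lower order, at most -δ Λ² S with S = Σ g(f_i, f_i) the trace of the inverse of w.
The remaining terms are O(Λ S + Λ²). A large Λ with det w bounded forces S to be large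
(`exists_large_of_det`), so the good term wins (`evolution_terms_nonpos`).

The bound on w is a maximum principle for the largest eigenvalue, which is only upper semicontinuous
here but is touched from below by the smooth barriers s ↦ w_vv(x, s) with v fixed
(`maximum_principle`, `IsFlowSolution.wForm_le_max`). -/

noncomputable section

open Filter Topology

namespace TransportFlow

/-- The model space. -/
abbrev Eu (n : ℕ) := EuclideanSpace ℝ (Fin n)

section Instances

/-! Shortcut instances: without them the search for instances on spaces of multilinear forms is
exponential in the number of arguments. -/

variable {X : Type*} [NormedAddCommGroup X] [NormedSpace ℝ X]

instance instNormedAddCommGroupDual : NormedAddCommGroup (X →L[ℝ] ℝ) :=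
  ContinuousLinearMap.toNormedAddCommGroup
instance instSeminormedAddCommGroupDual : SeminormedAddCommGroup (X →L[ℝ] ℝ) :=
  ContinuousLinearMap.toSeminormedAddCommGroup
instance instAddCommGroupDual : AddCommGroup (X →L[ℝ] ℝ) := ContinuousLinearMap.addCommGroup
instance instAddCommMonoidDual : AddCommMonoid (X →L[ℝ] ℝ) := ContinuousLinearMap.addCommMonoid
instance instTopologicalSpaceDual : TopologicalSpace (X →L[ℝ] ℝ) :=
  ContinuousLinearMap.topologicalSpace
instance instNormedSpaceDual : NormedSpace ℝ (X →L[ℝ] ℝ) := ContinuousLinearMap.toNormedSpace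
instance instModuleDual : Module ℝ (X →L[ℝ] ℝ) := ContinuousLinearMap.module
instance instNormedAddCommGroupJet : NormedAddCommGroup (X × (X →L[ℝ] ℝ)) := Prod.normedAddCommGroup
instance instNormedSpaceJet : NormedSpace ℝ (X × (X →L[ℝ] ℝ)) := Prod.normedSpace
instance instNormedAddCommGroupBilin : NormedAddCommGroup (X →L[ℝ] X →L[ℝ] ℝ) :=
  ContinuousLinearMap.toNormedAddCommGroup
instance instSeminormedAddCommGroupBilin : SeminormedAddCommGroup (X →L[ℝ] X →L[ℝ] ℝ) :=
  ContinuousLinearMap.toSeminormedAddCommGroup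
instance instAddCommGroupBilin : AddCommGroup (X →L[ℝ] X →L[ℝ] ℝ) :=
  ContinuousLinearMap.addCommGroup
instance instAddCommMonoidBilin : AddCommMonoid (X →L[ℝ] X →L[ℝ] ℝ) :=
  ContinuousLinearMap.addCommMonoid
instance instTopologicalSpaceBilin : TopologicalSpace (X →L[ℝ] X →L[ℝ] ℝ) :=
  ContinuousLinearMap.topologicalSpace
instance instNormedSpaceBilin : NormedSpace ℝ (X →L[ℝ] X →L[ℝ] ℝ) :=
  ContinuousLinearMap.toNormedSpace
instance instModuleBilin : Module ℝ (X →L[ℝ] X →L[ℝ] ℝ) := ContinuousLinearMap.module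
instance instNormedAddCommGroupTrilin : NormedAddCommGroup (X →L[ℝ] X →L[ℝ] X →L[ℝ] ℝ) :=
  ContinuousLinearMap.toNormedAddCommGroup
instance instSeminormedAddCommGroupTrilin : SeminormedAddCommGroup (X →L[ℝ] X →L[ℝ] X →L[ℝ] ℝ) :=
  ContinuousLinearMap.toSeminormedAddCommGroup
instance instAddCommGroupTrilin : AddCommGroup (X →L[ℝ] X →L[ℝ] X →L[ℝ] ℝ) :=
  ContinuousLinearMap.addCommGroup
instance instAddCommMonoidTrilin : AddCommMonoid (X →L[ℝ] X →L[ℝ] X →L[ℝ] ℝ) :=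
  ContinuousLinearMap.addCommMonoid
instance instTopologicalSpaceTrilin : TopologicalSpace (X →L[ℝ] X →L[ℝ] X →L[ℝ] ℝ) :=
  ContinuousLinearMap.topologicalSpace
instance instNormedSpaceTrilin : NormedSpace ℝ (X →L[ℝ] X →L[ℝ] X →L[ℝ] ℝ) :=
  ContinuousLinearMap.toNormedSpace
instance instModuleTrilin : Module ℝ (X →L[ℝ] X →L[ℝ] X →L[ℝ] ℝ) := ContinuousLinearMap.module
instance instSeminormedAddCommGroupJetDual : SeminormedAddCommGroup (X × (X →L[ℝ] ℝ) →L[ℝ] ℝ) :=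
  ContinuousLinearMap.toSeminormedAddCommGroup
instance instAddCommGroupJetDual : AddCommGroup (X × (X →L[ℝ] ℝ) →L[ℝ] ℝ) :=
  ContinuousLinearMap.addCommGroup
instance instAddCommMonoidJetDual : AddCommMonoid (X × (X →L[ℝ] ℝ) →L[ℝ] ℝ) :=
  ContinuousLinearMap.addCommMonoid
instance instTopologicalSpaceJetDual : TopologicalSpace (X × (X →L[ℝ] ℝ) →L[ℝ] ℝ) :=
  ContinuousLinearMap.topologicalSpace
instance instNormedSpaceJetDual : NormedSpace ℝ (X × (X →L[ℝ] ℝ) →L[ℝ] ℝ) :=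
  ContinuousLinearMap.toNormedSpace
instance instModuleJetDual : Module ℝ (X × (X →L[ℝ] ℝ) →L[ℝ] ℝ) := ContinuousLinearMap.module
instance instSeminormedAddCommGroupJetBilin : SeminormedAddCommGroup (X × (X →L[ℝ] ℝ) →L[ℝ] X →L[ℝ] X →L[ℝ] ℝ) :=
  ContinuousLinearMap.toSeminormedAddCommGroup
instance instAddCommGroupJetBilin : AddCommGroup (X × (X →L[ℝ] ℝ) →L[ℝ] X →L[ℝ] X →L[ℝ] ℝ) :=
  ContinuousLinearMap.addCommGroup
instance instAddCommMonoidJetBilin : AddCommMonoid (X × (X →L[ℝ] ℝ) →L[ℝ] X →L[ℝ] X →L[ℝ] ℝ) :=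
  ContinuousLinearMap.addCommMonoid
instance instTopologicalSpaceJetBilin : TopologicalSpace (X × (X →L[ℝ] ℝ) →L[ℝ] X →L[ℝ] X →L[ℝ] ℝ) :=
  ContinuousLinearMap.topologicalSpace
instance instNormedSpaceJetBilin : NormedSpace ℝ (X × (X →L[ℝ] ℝ) →L[ℝ] X →L[ℝ] X →L[ℝ] ℝ) :=
  ContinuousLinearMap.toNormedSpace
instance instModuleJetBilin : Module ℝ (X × (X →L[ℝ] ℝ) →L[ℝ] X →L[ℝ] X →L[ℝ] ℝ) :=
  ContinuousLinearMap.module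

end Instances

/-! ### Second-order calculus: compositions, touching functions, symmetry of higher derivatives. -/

section Calculus

variable {X Y Z : Type*} [NormedAddCommGroup X] [NormedSpace ℝ X]
  [NormedAddCommGroup Y] [NormedSpace ℝ Y] [NormedAddCommGroup Z] [NormedSpace ℝ Z]

/-- Second derivative of a composition. -/
theorem fderiv_fderiv_comp {f : Y → Z} {g : X → Y} {a : X} (hf : ContDiffAt ℝ 2 f (g a))
    (hg : ContDiffAt ℝ 2 g a) (v w : X) :
    fderiv ℝ (fderiv ℝ (fun x => f (g x))) a v w =
      fderiv ℝ (fderiv ℝ f) (g a) (fderiv ℝ g a v) (fderiv ℝ g a w) +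
        fderiv ℝ f (g a) (fderiv ℝ (fderiv ℝ g) a v w) := by
  have hf1 : ∀ᶠ x in 𝓝 a, DifferentiableAt ℝ f (g x) :=
    (hg.continuousAt.eventually (hf.eventually (by simp))).mono
      fun x hx => hx.differentiableAt (by simp)
  have hg1 : ∀ᶠ x in 𝓝 a, DifferentiableAt ℝ g x :=
    (hg.eventually (by simp)).mono fun x hx => hx.differentiableAt (by simp)
  have h1 : fderiv ℝ (fun x => f (g x)) =ᶠ[𝓝 a]
      fun x => (fderiv ℝ f (g x)).comp (fderiv ℝ g x) := by
    filter_upwards [hf1, hg1] with x hx hx'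
    exact fderiv_comp x hx hx'
  have hf2 : DifferentiableAt ℝ (fderiv ℝ f) (g a) :=
    (hf.fderiv_right (m := 1) (by norm_num)).differentiableAt (by simp)
  have hg2 : DifferentiableAt ℝ (fderiv ℝ g) a :=
    (hg.fderiv_right (m := 1) (by norm_num)).differentiableAt (by simp)
  have hg0 : DifferentiableAt ℝ g a := hg.differentiableAt (by simp)
  have hc : HasFDerivAt (fun x => fderiv ℝ f (g x))
      ((fderiv ℝ (fderiv ℝ f) (g a)).comp (fderiv ℝ g a)) a :=
    hf2.hasFDerivAt.comp a hg0.hasFDerivAt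
  rw [h1.fderiv_eq, (hc.clm_comp hg2.hasFDerivAt).fderiv]
  simp [add_comm]

theorem fderiv_clm_apply_const {f : X → Y →L[ℝ] Z} {a : X} (hf : DifferentiableAt ℝ f a)
    (v : X) (w : Y) : fderiv ℝ (fun x => f x w) a v = fderiv ℝ f a v w := by
  rw [(hf.hasFDerivAt.clm_apply (hasFDerivAt_const w a)).fderiv]
  simp

/-- The second derivative commutes with a continuous linear map. -/
theorem fderiv_fderiv_clm_comp (L : Y →L[ℝ] Z) {g : X → Y} {a : X} (hg : ContDiffAt ℝ 2 g a)
    (v w : X) : fderiv ℝ (fderiv ℝ (fun x => L (g x))) a v w = L (fderiv ℝ (fderiv ℝ g) a v w) := by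
  rw [fderiv_fderiv_comp (f := fun y => L y) L.contDiff.contDiffAt hg]
  have : fderiv ℝ (fun y => L y) = fun _ => L := by
    ext1 y; exact L.fderiv
  simp [this]

/-- Second derivative along the line through `a` in the direction `v`. -/
theorem deriv_deriv_line {f : X → Z} {a : X} (hf : ContDiffAt ℝ 2 f a) (v : X) :
    deriv (deriv (fun r : ℝ => f (a + r • v))) 0 = fderiv ℝ (fderiv ℝ f) a v v := by
  have hl : ∀ r : ℝ, HasDerivAt (fun r : ℝ => a + r • v) v r := fun r => by
    simpa using ((hasDerivAt_id r).smul_const v).const_add a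
  have hev : ∀ᶠ r : ℝ in 𝓝 0, ContDiffAt ℝ 2 f (a + r • v) := by
    have : ContinuousAt (fun r : ℝ => a + r • v) 0 := (hl 0).continuousAt
    refine this.eventually ?_
    simpa using hf.eventually (by simp)
  have h1 : deriv (fun r : ℝ => f (a + r • v)) =ᶠ[𝓝 0] fun r => fderiv ℝ f (a + r • v) v := by
    filter_upwards [hev] with r hr
    exact ((hr.differentiableAt (by simp)).hasFDerivAt.comp_hasDerivAt r (hl r)).deriv
  rw [h1.deriv_eq]
  have h2 : DifferentiableAt ℝ (fderiv ℝ f) (a + (0 : ℝ) • v) := by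
    simpa using (hf.fderiv_right (m := 1) (by norm_num)).differentiableAt (by simp)
  have h3 : HasDerivAt (fun r : ℝ => fderiv ℝ f (a + r • v))
      (fderiv ℝ (fderiv ℝ f) (a + (0 : ℝ) • v) v) 0 :=
    h2.hasFDerivAt.comp_hasDerivAt (0 : ℝ) (hl 0)
  have h4 := (ContinuousLinearMap.apply ℝ Z v).hasFDerivAt.comp_hasDerivAt (0 : ℝ) h3
  have h5 := h4.deriv
  rw [zero_smul, add_zero] at h5
  exact h5

theorem contDiffAt_line {f : X → Z} {a : X} {k : ℕ∞ω} (hf : ContDiffAt ℝ k f a) (v : X) :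
    ContDiffAt ℝ k (fun r : ℝ => f (a + r • v)) 0 := by
  refine ContDiffAt.comp (0 : ℝ) (g := f) (by simpa using hf) ?_
  fun_prop

/-- The second derivative is nonnegative at a local minimum. -/
theorem deriv_deriv_nonneg_of_isLocalMin {h : ℝ → ℝ} (hh : ContDiffAt ℝ 2 h 0)
    (hm : IsLocalMin h 0) : 0 ≤ deriv (deriv h) 0 := by
  by_contra hneg
  push Not at hneg
  have hmax : IsLocalMax h 0 :=
    isLocalMax_of_deriv_deriv_neg hneg hm.deriv_eq_zero hh.continuousAt
  -- A negative second derivative makes the minimum a strict-type maximum as well, so `h` is locally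
  -- constant and its second derivative is zero after all.
  have hconst : h =ᶠ[𝓝 0] fun _ => h 0 := by
    filter_upwards [hm, hmax] with x h1 h2 using le_antisymm h2 h1
  have : deriv h =ᶠ[𝓝 0] fun _ => 0 := by
    have := hconst.deriv
    simpa using this
  rw [this.deriv_eq] at hneg
  simp at hneg

/-- `g - f` has a local minimum at `a`. Together with its second-order companion this is the only
way inequalities enter the evolution estimate: nonlinear quantities are replaced by simpler ones
that touch them. -/
theorem fderiv_eq_of_eventually_le {f g : X → ℝ} {a : X} (hf : DifferentiableAt ℝ f a)
    (hg : DifferentiableAt ℝ g a) (hle : ∀ᶠ x in 𝓝 a, f x ≤ g x) (heq : f a = g a) :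
    fderiv ℝ f a = fderiv ℝ g a := by
  have hm : IsLocalMin (fun x => g x - f x) a := by
    filter_upwards [hle] with x hx
    rw [heq]; linarith
  have := hm.fderiv_eq_zero
  rw [fderiv_fun_sub hg hf, sub_eq_zero] at this
  exact this.symm

theorem fderiv_fderiv_le_of_eventually_le {f g : X → ℝ} {a : X} (hf : ContDiffAt ℝ 2 f a)
    (hg : ContDiffAt ℝ 2 g a) (hle : ∀ᶠ x in 𝓝 a, f x ≤ g x) (heq : f a = g a) (v : X) :
    fderiv ℝ (fderiv ℝ f) a v v ≤ fderiv ℝ (fderiv ℝ g) a v v := by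
  have hh : ContDiffAt ℝ 2 (fun x => g x - f x) a := hg.sub hf
  have hm : IsLocalMin (fun r : ℝ => g (a + r • v) - f (a + r • v)) 0 := by
    have hc : Tendsto (fun r : ℝ => a + r • v) (𝓝 0) (𝓝 a) := by
      have : ContinuousAt (fun r : ℝ => a + r • v) 0 := by fun_prop
      simpa [ContinuousAt] using this
    filter_upwards [hc.eventually hle] with r hr
    simp only [zero_smul, add_zero, heq, sub_self]
    linarith
  have h0 := deriv_deriv_nonneg_of_isLocalMin (contDiffAt_line hh v) hm
  rw [deriv_deriv_line hh v] at h0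
  have hev : fderiv ℝ (fun x => g x - f x) =ᶠ[𝓝 a] fun x => fderiv ℝ g x - fderiv ℝ f x := by
    filter_upwards [hf.eventually (by simp), hg.eventually (by simp)] with x h1 h2
    exact fderiv_fun_sub (h2.differentiableAt (by simp)) (h1.differentiableAt (by simp))
  rw [hev.fderiv_eq, fderiv_fun_sub
    ((hg.fderiv_right (m := 1) (by norm_num)).differentiableAt (by simp))
    ((hf.fderiv_right (m := 1) (by norm_num)).differentiableAt (by simp))] at h0
  simpa using h0

theorem fderiv_fderiv_symm {f : X → Z} {a : X} (hf : ContDiffAt ℝ 2 f a) (v w : X) :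
    fderiv ℝ (fderiv ℝ f) a v w = fderiv ℝ (fderiv ℝ f) a w v :=
  (hf.isSymmSndFDerivAt (by simp)) v w

/-- The third derivative is symmetric in its first and last slots. -/
theorem fderiv3_symm {u : X → Z} {a : X} (hu : ContDiffAt ℝ 3 u a) (v ξ : X) :
    fderiv ℝ (fderiv ℝ (fderiv ℝ u)) a v v ξ = fderiv ℝ (fderiv ℝ (fderiv ℝ u)) a ξ v v := by
  have h1 : ContDiffAt ℝ 2 (fderiv ℝ u) a := hu.fderiv_right (by norm_num)
  have h2 : ContDiffAt ℝ 1 (fderiv ℝ (fderiv ℝ u)) a := h1.fderiv_right (by norm_num)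
  have hd := h2.differentiableAt (by simp)
  have key : (fun x => fderiv ℝ (fderiv ℝ u) x v ξ) =ᶠ[𝓝 a]
      fun x => fderiv ℝ (fderiv ℝ u) x ξ v := by
    filter_upwards [hu.eventually (by simp)] with x hx
    exact fderiv_fderiv_symm (hx.of_le (by norm_num)) v ξ
  have e : ∀ p q r : X, fderiv ℝ (fun x => fderiv ℝ (fderiv ℝ u) x p q) a r =
      fderiv ℝ (fderiv ℝ (fderiv ℝ u)) a r p q := by
    intro p q r
    rw [(((hd.hasFDerivAt.clm_apply (hasFDerivAt_const p a))).clm_apply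
      (hasFDerivAt_const q a)).fderiv]
    simp
  rw [← e v ξ v, key.fderiv_eq, e, ← fderiv_fderiv_symm h1 v ξ]

/-- Derivative in the direction `v`. -/
def dirDeriv (v : X) (f : X → Z) : X → Z := fun x => fderiv ℝ f x v

theorem contDiffAt_dirDeriv {f : X → Z} {a : X} {k m : ℕ∞ω} (hf : ContDiffAt ℝ k f a)
    (h : m + 1 ≤ k) (v : X) : ContDiffAt ℝ m (dirDeriv v f) a :=
  (hf.fderiv_right h).clm_apply contDiffAt_const

theorem dirDeriv_dirDeriv {f : X → Z} {a : X} (hf : ContDiffAt ℝ 2 f a) (v w : X) :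
    dirDeriv v (dirDeriv w f) a = fderiv ℝ (fderiv ℝ f) a v w :=
  fderiv_clm_apply_const ((hf.fderiv_right (m := 1) (by norm_num)).differentiableAt (by simp)) v w

theorem dirDeriv_comm {f : X → Z} {a : X} (hf : ContDiffAt ℝ 2 f a) (v w : X) :
    dirDeriv v (dirDeriv w f) =ᶠ[𝓝 a] dirDeriv w (dirDeriv v f) := by
  filter_upwards [hf.eventually (by simp)] with x hx
  rw [dirDeriv_dirDeriv hx, dirDeriv_dirDeriv hx, fderiv_fderiv_symm hx]

theorem dirDeriv_congr {f g : X → Z} {a : X} (h : f =ᶠ[𝓝 a] g) (v : X) :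
    dirDeriv v f =ᶠ[𝓝 a] dirDeriv v g := by
  filter_upwards [h.fderiv (𝕜 := ℝ)] with x hx
  simp only [dirDeriv, hx]

/-- `∂_v² u_{zz} = ∂_z² u_{vv}`. -/
theorem fderiv4_symm {u : X → Z} {a : X} (hu : ContDiffAt ℝ 4 u a) (v z : X) :
    fderiv ℝ (fderiv ℝ (fun x => fderiv ℝ (fderiv ℝ u) x z z)) a v v =
      fderiv ℝ (fderiv ℝ (fun x => fderiv ℝ (fderiv ℝ u) x v v)) a z z := by
  have hev : ∀ p : X, (fun x => fderiv ℝ (fderiv ℝ u) x p p) =ᶠ[𝓝 a] dirDeriv p (dirDeriv p u) := by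
    intro p
    filter_upwards [hu.eventually (by simp)] with x hx
    rw [dirDeriv_dirDeriv (hx.of_le (by norm_num))]
  have h1 : ∀ p, ContDiffAt ℝ 3 (dirDeriv p u) a := fun p => contDiffAt_dirDeriv hu (by norm_num) p
  have h2 : ∀ p q, ContDiffAt ℝ 2 (dirDeriv q (dirDeriv p u)) a :=
    fun p q => contDiffAt_dirDeriv (h1 p) (by norm_num) q
  rw [(hev z).fderiv.fderiv_eq, (hev v).fderiv.fderiv_eq, ← dirDeriv_dirDeriv (h2 z z),
    ← dirDeriv_dirDeriv (h2 v v)]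
  -- The word v v z z is brought to z z v v by four adjacent transpositions, each an exchange of two
  -- derivatives.
  have e1 : dirDeriv v (dirDeriv v (dirDeriv z (dirDeriv z u))) =ᶠ[𝓝 a]
      dirDeriv v (dirDeriv z (dirDeriv v (dirDeriv z u))) :=
    dirDeriv_congr (dirDeriv_comm ((h1 z).of_le (by norm_num)) v z) v
  have e2 : dirDeriv v (dirDeriv z (dirDeriv v (dirDeriv z u))) =ᶠ[𝓝 a]
      dirDeriv z (dirDeriv v (dirDeriv v (dirDeriv z u))) := dirDeriv_comm (h2 z v) v z
  have e3 : dirDeriv z (dirDeriv v (dirDeriv v (dirDeriv z u))) =ᶠ[𝓝 a]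
      dirDeriv z (dirDeriv v (dirDeriv z (dirDeriv v u))) :=
    dirDeriv_congr (dirDeriv_congr (dirDeriv_comm (hu.of_le (by norm_num)) v z) v) z
  have e4 : dirDeriv z (dirDeriv v (dirDeriv z (dirDeriv v u))) =ᶠ[𝓝 a]
      dirDeriv z (dirDeriv z (dirDeriv v (dirDeriv v u))) :=
    dirDeriv_congr (dirDeriv_comm ((h1 v).of_le (by norm_num)) v z) z
  exact (((e1.trans e2).trans e3).trans e4).self_of_nhds

end Calculus

/-! ### Linear algebra of pairs of quadratic forms. -/

section LinearAlgebra

/-- `ln det A ≤ tr A - n` for a positive definite matrix. -/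
theorem log_det_le_trace {n : ℕ} {A : Matrix (Fin n) (Fin n) ℝ} (hA : A.PosDef) :
    Real.log A.det ≤ A.trace - n := by
  have h1 := hA.isHermitian.det_eq_prod_eigenvalues
  have h2 := hA.isHermitian.trace_eq_sum_eigenvalues
  simp only [RCLike.ofReal_real_eq_id, id_eq] at h1 h2
  rw [h1, h2, Real.log_prod (fun i _ => (hA.eigenvalues_pos i).ne')]
  have : ∑ i, hA.isHermitian.eigenvalues i - (n : ℝ) =
      ∑ i, (hA.isHermitian.eigenvalues i - 1) := by simp
  rw [this]
  exact Finset.sum_le_sum fun i _ => Real.log_le_sub_one_of_pos (hA.eigenvalues_pos i)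

/-- Simultaneous diagonalization of a positive definite form `W` and a symmetric form `G`. -/
theorem exists_simultaneous_basis {V : Type*} [AddCommGroup V] [Module ℝ V] [FiniteDimensional ℝ V]
    {n : ℕ} (hn : Module.finrank ℝ V = n) (W G : V →ₗ[ℝ] V →ₗ[ℝ] ℝ)
    (hWs : ∀ x y, W x y = W y x) (hW : ∀ x, x ≠ 0 → 0 < W x x) (hGs : ∀ x y, G x y = G y x) :
    ∃ (f : Module.Basis (Fin n) ℝ V) (μ : Fin n → ℝ),
      (∀ i j, W (f i) (f j) = if i = j then 1 else 0) ∧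
      (∀ i j, G (f i) (f j) = if i = j then μ i else 0) := by
  -- `W` itself serves as the inner product; `G` is then represented by a symmetric operator, and
  -- its orthonormal eigenbasis is the basis sought.
  let core : InnerProductSpace.Core ℝ V :=
    { inner := fun x y => W x y
      conj_inner_symm := fun x y => by simp [hWs x y]
      re_inner_nonneg := fun x => by
        by_cases hx : x = 0
        · simp [hx]
        · simpa using (hW x hx).le
      add_left := fun x y z => by simp
      smul_left := fun x y r => by simp
      definite := fun x hx => by
        by_contra hne
        exact (hW x hne).ne' hx }
  let _ : NormedAddCommGroup V := core.toNormedAddCommGroup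
  let _ : InnerProductSpace ℝ V := InnerProductSpace.ofCore core.toCore
  have hin : ∀ x y : V, inner ℝ x y = W x y := fun x y => rfl
  let T : V →ₗ[ℝ] V :=
    { toFun := fun x => (InnerProductSpace.toDual ℝ V).symm (LinearMap.toContinuousLinearMap (G x))
      map_add' := fun x y => by simp
      map_smul' := fun r x => by simp }
  have hT : ∀ x y, inner ℝ (T x) y = G x y := fun x y => by
    change inner ℝ ((InnerProductSpace.toDual ℝ V).symm _) y = _
    rw [InnerProductSpace.toDual_symm_apply]
    rfl
  have hTs : T.IsSymmetric := fun x y => by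
    rw [hT, real_inner_comm, hT, hGs]
  refine ⟨(hTs.eigenvectorBasis hn).toBasis, hTs.eigenvalues hn, fun i j => ?_, fun i j => ?_⟩
  · rw [← hin]
    simp only [OrthonormalBasis.coe_toBasis]
    exact orthonormal_iff_ite.1 (hTs.eigenvectorBasis hn).orthonormal i j
  · rw [← hT]
    simp only [OrthonormalBasis.coe_toBasis]
    rw [hTs.apply_eigenvectorBasis, real_inner_smul_left,
      orthonormal_iff_ite.1 (hTs.eigenvectorBasis hn).orthonormal i j]
    by_cases hij : i = j <;> simp [hij]

variable {n : ℕ}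

/-- The Gram matrix of a bilinear form in the standard coordinates. -/
def gram (W : Eu n →L[ℝ] Eu n →L[ℝ] ℝ) : Matrix (Fin n) (Fin n) ℝ :=
  Matrix.of fun i j => W (coordVec i) (coordVec j)

/-- The Gram matrix of a bilinear form along a family of vectors. -/
def gramOn (f : Fin n → Eu n) (W : Eu n →L[ℝ] Eu n →L[ℝ] ℝ) : Matrix (Fin n) (Fin n) ℝ :=
  Matrix.of fun i j => W (f i) (f j)

theorem sum_coordVec (v : Eu n) : ∑ i, v i • coordVec i = v := by
  have := (EuclideanSpace.basisFun (Fin n) ℝ).sum_repr v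
  simpa [coordVec] using this

theorem bilin_sum_sum {ι : Type*} [Fintype ι] (W : Eu n →L[ℝ] Eu n →L[ℝ] ℝ) (x y : ι → ℝ) (f g : ι → Eu n) :
    W (∑ i, x i • f i) (∑ j, y j • g j) = ∑ i, ∑ j, x i * y j * W (f i) (g j) := by
  rw [map_sum W, _root_.sum_apply]
  simp only [map_smul, _root_.smul_apply, map_sum, smul_eq_mul]
  refine Finset.sum_congr rfl fun i _ => Finset.sum_congr rfl fun j _ => by ring

/-- Change of the Gram matrix under a family of vectors. -/
theorem gramOn_eq (f : Fin n → Eu n) (W : Eu n →L[ℝ] Eu n →L[ℝ] ℝ) :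
    gramOn f W = (Matrix.of fun i k => f i k) * gram W * (Matrix.of fun i k => f i k).transpose := by
  ext i j
  simp only [gramOn, gram, Matrix.of_apply, Matrix.mul_apply, Matrix.transpose_apply]
  conv_lhs => rw [← sum_coordVec (f i), ← sum_coordVec (f j)]
  rw [bilin_sum_sum]
  simp only [Finset.sum_mul]
  rw [Finset.sum_comm]
  refine Finset.sum_congr rfl fun x _ => Finset.sum_congr rfl fun y _ => by ring

theorem det_gramOn (f : Fin n → Eu n) (W : Eu n →L[ℝ] Eu n →L[ℝ] ℝ) :
    (gramOn f W).det = (Matrix.of fun i k => f i k).det ^ 2 * (gram W).det := by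
  rw [gramOn_eq, Matrix.det_mul, Matrix.det_mul, Matrix.det_transpose]
  ring

theorem posDef_gram {W : Eu n →L[ℝ] Eu n →L[ℝ] ℝ} (hs : ∀ x y, W x y = W y x)
    (h : ∀ x, x ≠ 0 → 0 < W x x) (f : Module.Basis (Fin n) ℝ (Eu n)) : (gramOn f W).PosDef := by
  refine Matrix.PosDef.of_dotProduct_mulVec_pos ?_ ?_
  · ext i j
    simp [gramOn, Matrix.conjTranspose, hs (f i) (f j)]
  · intro x hx
    have hne : ∑ i, x i • f i ≠ 0 := by
      intro h0
      apply hx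
      ext i
      have := congrArg (fun v => f.repr v i) h0
      simpa [Finsupp.single_apply] using this
    have := h _ hne
    rw [bilin_sum_sum] at this
    refine this.trans_eq ?_
    simp only [dotProduct, Matrix.mulVec, gramOn, Matrix.of_apply, star_trivial, Finset.mul_sum]
    exact Finset.sum_congr rfl fun x _ => Finset.sum_congr rfl fun y _ => by ring

/-- `ln det W ≤ ln det W₀ + ∑ (W (f i) (f i) - 1)` if `f` is orthonormal for `W₀`. -/
theorem log_det_gram_le {W₀ W : Eu n →L[ℝ] Eu n →L[ℝ] ℝ} (f : Module.Basis (Fin n) ℝ (Eu n))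
    (hf : ∀ i j, W₀ (f i) (f j) = if i = j then 1 else 0)
    (hs : ∀ x y, W x y = W y x) (h : ∀ x, x ≠ 0 → 0 < W x x) :
    Real.log (gram W).det ≤ Real.log (gram W₀).det + ((∑ i, W (f i) (f i)) - n) := by
  have h0 : (gramOn f W₀).det = 1 := by
    have : gramOn f W₀ = 1 := by
      ext i j; simp [gramOn, hf, Matrix.one_apply]
    rw [this, Matrix.det_one]
  have hpd := posDef_gram hs h f
  have h1 := log_det_le_trace hpd
  have h2 := det_gramOn f W
  have h3 := det_gramOn f W₀
  rw [h0] at h3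
  -- Passing to the basis `f` multiplies both determinants by P², and P² det W₀ = 1; taking
  -- logarithms converts the estimate for `gramOn f W` back to `gram W`.
  set P := (Matrix.of fun i k => f i k).det
  have hP : P ^ 2 ≠ 0 := fun h => by rw [h, zero_mul] at h3; exact one_ne_zero h3
  have hW0 : (gram W₀).det ≠ 0 := fun h => by rw [h, mul_zero] at h3; exact one_ne_zero h3
  have hWd : (gram W).det ≠ 0 := fun h => by
    rw [h, mul_zero] at h2; exact hpd.det_pos.ne' h2
  rw [h2, Real.log_mul hP hWd] at h1
  have h4 : Real.log (P ^ 2) + Real.log (gram W₀).det = 0 := by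
    rw [← Real.log_mul hP hW0, ← h3, Real.log_one]
  have : (gramOn f W).trace = ∑ i, W (f i) (f i) := by simp [Matrix.trace, gramOn]
  rw [this] at h1
  linarith

/-- A maximal direction of `W` relative to `G` is an eigenvector. -/
theorem eq_of_isMax {W G : Eu n →L[ℝ] Eu n →L[ℝ] ℝ} (hWs : ∀ x y, W x y = W y x)
    (hGs : ∀ x y, G x y = G y x) {Λ : ℝ} (hmax : ∀ z, W z z ≤ Λ * G z z) {v : Eu n}
    (hv : W v v = Λ * G v v) (z : Eu n) : W v z = Λ * G v z := by
  by_contra hne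
  set H := Λ * G v z - W v z with hH
  have hH0 : H ≠ 0 := fun h => hne (by linarith)
  set q := Λ * G z z - W z z with hq
  have hq0 : 0 ≤ q := sub_nonneg.2 (hmax z)
  have key : ∀ s : ℝ, 0 ≤ 2 * s * H + s ^ 2 * q := by
    intro s
    have := hmax (v + s • z)
    simp only [map_add, map_smul, _root_.add_apply, _root_.smul_apply,
      smul_eq_mul, hWs z v, hGs z v] at this
    rw [hH, hq]
    nlinarith
  -- The nonnegative form Λ G - W would be negative near its minimiser s = -H / q; dividing by q + 1
  -- instead also covers q = 0.
  have h1 := key (-H / (q + 1))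
  have h2 : 2 * (-H / (q + 1)) * H + (-H / (q + 1)) ^ 2 * q =
      -(H ^ 2 * (q + 2)) / (q + 1) ^ 2 := by field_simp; ring
  rw [h2] at h1
  have : 0 < H ^ 2 * (q + 2) / (q + 1) ^ 2 := by positivity
  rw [neg_div] at h1
  linarith

end LinearAlgebra

/-! ### Differentiation along the 1-jet of a function. -/

section Jet

variable {X : Type*} [NormedAddCommGroup X] [NormedSpace ℝ X]

/-- The `1`-jet `x ↦ (x, Du(x))`. -/
def jet (u : X → ℝ) (x : X) : X × (X →L[ℝ] ℝ) := (x, fderiv ℝ u x)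

/-- The derivative of the `1`-jet. -/
def jetDir (u : X → ℝ) (x ξ : X) : X × (X →L[ℝ] ℝ) := (ξ, fderiv ℝ (fderiv ℝ u) x ξ)

/-- The modified Hessian `D²u - A(x, Du)`. -/
def wHess (A : X × (X →L[ℝ] ℝ) → X →L[ℝ] X →L[ℝ] ℝ) (u : X → ℝ) (x : X) : X →L[ℝ] X →L[ℝ] ℝ :=
  fderiv ℝ (fderiv ℝ u) x - A (jet u x)

variable {u : X → ℝ} {a : X}

theorem contDiffAt_jet {k m : ℕ∞ω} (hu : ContDiffAt ℝ k u a) (h : m + 1 ≤ k) :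
    ContDiffAt ℝ m (jet u) a := contDiffAt_id.prodMk (hu.fderiv_right h)

theorem hasFDerivAt_jet (hu : ContDiffAt ℝ 2 u a) :
    HasFDerivAt (jet u) ((ContinuousLinearMap.id ℝ X).prod (fderiv ℝ (fderiv ℝ u) a)) a :=
  (hasFDerivAt_id a).prodMk
    ((hu.fderiv_right (m := 1) (by norm_num)).differentiableAt (by simp)).hasFDerivAt

theorem fderiv_jet (hu : ContDiffAt ℝ 2 u a) (ξ : X) : fderiv ℝ (jet u) a ξ = jetDir u a ξ := by
  rw [(hasFDerivAt_jet hu).fderiv]; rfl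

/-- The base-point component of the jet is the identity, so only the covector component has a second
derivative. Hence third derivatives of `u` enter later formulas only through p-derivatives of the
coefficients. -/
theorem fderiv_fderiv_jet (hu : ContDiffAt ℝ 3 u a) (v w : X) :
    fderiv ℝ (fderiv ℝ (jet u)) a v w = (0, fderiv ℝ (fderiv ℝ (fderiv ℝ u)) a v w) := by
  have hJ : ContDiffAt ℝ 2 (jet u) a := contDiffAt_jet hu (by norm_num)
  have h1 := fderiv_fderiv_clm_comp (ContinuousLinearMap.fst ℝ X (X →L[ℝ] ℝ)) hJ v w
  have h2 := fderiv_fderiv_clm_comp (ContinuousLinearMap.snd ℝ X (X →L[ℝ] ℝ)) hJ v w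
  refine Prod.ext ?_ h2.symm
  refine h1.symm.trans ?_
  have : fderiv ℝ (fun x : X => (ContinuousLinearMap.fst ℝ X (X →L[ℝ] ℝ)) (jet u x)) =
      fun _ => ContinuousLinearMap.id ℝ X := by
    ext1 x; exact fderiv_id
  rw [this]; simp

theorem fderiv_comp_jet {Z : Type*} [NormedAddCommGroup Z] [NormedSpace ℝ Z]
    {f : X × (X →L[ℝ] ℝ) → Z} (hf : DifferentiableAt ℝ f (jet u a)) (hu : ContDiffAt ℝ 2 u a)
    (ξ : X) : fderiv ℝ (fun x => f (jet u x)) a ξ = fderiv ℝ f (jet u a) (jetDir u a ξ) := by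
  have h : HasFDerivAt (fun x => f (jet u x)) _ a := hf.hasFDerivAt.comp a (hasFDerivAt_jet hu)
  rw [h.fderiv]; rfl

theorem fderiv_fderiv_comp_jet {Z : Type*} [NormedAddCommGroup Z] [NormedSpace ℝ Z]
    {f : X × (X →L[ℝ] ℝ) → Z} (hf : ContDiffAt ℝ 2 f (jet u a)) (hu : ContDiffAt ℝ 3 u a)
    (v : X) : fderiv ℝ (fderiv ℝ (fun x => f (jet u x))) a v v =
      fderiv ℝ (fderiv ℝ f) (jet u a) (jetDir u a v) (jetDir u a v) +
        fderiv ℝ f (jet u a) (0, fderiv ℝ (fderiv ℝ (fderiv ℝ u)) a v v) := by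
  rw [fderiv_fderiv_comp hf (contDiffAt_jet hu (by norm_num)), fderiv_fderiv_jet hu,
    fderiv_jet (hu.of_le (by norm_num))]

variable {A : X × (X →L[ℝ] ℝ) → X →L[ℝ] X →L[ℝ] ℝ}

/-- Evaluation of a bilinear form on the diagonal. -/
def evalDiag (z : X) : (X →L[ℝ] X →L[ℝ] ℝ) →L[ℝ] ℝ :=
  (ContinuousLinearMap.apply ℝ ℝ z).comp (ContinuousLinearMap.apply ℝ (X →L[ℝ] ℝ) z)

theorem evalDiag_apply (z : X) (W : X →L[ℝ] X →L[ℝ] ℝ) : evalDiag z W = W z z := rfl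

theorem contDiffAt_wHess (hu : ContDiffAt ℝ 4 u a) (hA : ContDiffAt ℝ 2 A (jet u a)) :
    ContDiffAt ℝ 2 (wHess A u) a :=
  ((hu.fderiv_right (m := 3) (by norm_num)).fderiv_right (m := 2) (by norm_num)).sub
    (hA.comp a (contDiffAt_jet hu (by norm_num)))

/-- First derivative of `w_{zz}`. -/
theorem fderiv_wHess (hu : ContDiffAt ℝ 4 u a) (hA : ContDiffAt ℝ 2 A (jet u a)) (z ξ : X) :
    fderiv ℝ (fun x => wHess A u x z z) a ξ =
      fderiv ℝ (fderiv ℝ (fderiv ℝ u)) a z z ξ -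
        fderiv ℝ A (jet u a) (jetDir u a ξ) z z := by
  have hu2 : ContDiffAt ℝ 2 (fderiv ℝ (fderiv ℝ u)) a :=
    (hu.fderiv_right (m := 3) (by norm_num)).fderiv_right (m := 2) (by norm_num)
  have hA' : DifferentiableAt ℝ A (jet u a) := hA.differentiableAt (by simp)
  have hc : DifferentiableAt ℝ (fun x => A (jet u x)) a :=
    hA'.comp a (hasFDerivAt_jet (hu.of_le (by norm_num))).differentiableAt
  have h1 : fderiv ℝ (wHess A u) a ξ = fderiv ℝ (fderiv ℝ (fderiv ℝ u)) a ξ -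
      fderiv ℝ A (jet u a) (jetDir u a ξ) := by
    rw [← fderiv_comp_jet hA' (hu.of_le (by norm_num))]
    have : wHess A u = fun x => fderiv ℝ (fderiv ℝ u) x - A (jet u x) := rfl
    rw [this, fderiv_fun_sub (hu2.differentiableAt (by simp)) hc]
    rfl
  have h2 : HasFDerivAt (fun x => wHess A u x z z)
      ((evalDiag z).comp (fderiv ℝ (wHess A u) a)) a :=
    (evalDiag z).hasFDerivAt.comp a
      ((contDiffAt_wHess hu hA).differentiableAt (by simp)).hasFDerivAt
  rw [h2.fderiv, ContinuousLinearMap.comp_apply, h1, evalDiag_apply, fderiv3_symm (hu.of_le (by norm_num))]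
  rfl

/-- Second derivative of `w_{zz}`. -/
theorem fderiv_fderiv_wHess (hu : ContDiffAt ℝ 4 u a) (hA : ContDiffAt ℝ 2 A (jet u a)) (z v : X) :
    fderiv ℝ (fderiv ℝ (fun x => wHess A u x z z)) a v v =
      fderiv ℝ (fderiv ℝ (fun x => fderiv ℝ (fderiv ℝ u) x z z)) a v v -
      (fderiv ℝ (fderiv ℝ A) (jet u a) (jetDir u a v) (jetDir u a v) z z +
        fderiv ℝ A (jet u a) (0, fderiv ℝ (fderiv ℝ (fderiv ℝ u)) a v v) z z) := by
  have hu2 : ContDiffAt ℝ 2 (fderiv ℝ (fderiv ℝ u)) a :=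
    (hu.fderiv_right (m := 3) (by norm_num)).fderiv_right (m := 2) (by norm_num)
  have hc : ContDiffAt ℝ 2 (fun x => A (jet u x)) a :=
    hA.comp a (contDiffAt_jet hu (by norm_num))
  have h1 : fderiv ℝ (fderiv ℝ (wHess A u)) a v v =
      fderiv ℝ (fderiv ℝ (fderiv ℝ (fderiv ℝ u))) a v v -
      fderiv ℝ (fderiv ℝ (fun x => A (jet u x))) a v v := by
    have hev : fderiv ℝ (wHess A u) =ᶠ[𝓝 a] fun x => fderiv ℝ (fderiv ℝ (fderiv ℝ u)) x -
        fderiv ℝ (fun x => A (jet u x)) x := by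
      filter_upwards [hu2.eventually (by simp), hc.eventually (by simp)] with x h1 h2
      exact fderiv_fun_sub (h1.differentiableAt (by simp)) (h2.differentiableAt (by simp))
    rw [hev.fderiv_eq, fderiv_fun_sub
      ((hu2.fderiv_right (m := 1) (by norm_num)).differentiableAt (by simp))
      ((hc.fderiv_right (m := 1) (by norm_num)).differentiableAt (by simp))]
    rfl
  have h2 := fderiv_fderiv_clm_comp (evalDiag z) (contDiffAt_wHess hu hA) v v
  have h3 := fderiv_fderiv_clm_comp (evalDiag z) hu2 v v
  simp only [evalDiag_apply] at h2 h3
  rw [h2, h3, h1, fderiv_fderiv_comp_jet hA (hu.of_le (by norm_num))]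
  rfl

end Jet

/-! ### The differential inequality at a spatial maximum. -/

section Comparison

variable {n : ℕ}

variable {u θ : Eu n → ℝ} {A : Eu n × (Eu n →L[ℝ] ℝ) → Eu n →L[ℝ] Eu n →L[ℝ] ℝ} {B : Eu n × (Eu n →L[ℝ] ℝ) → ℝ}
  {G : Eu n → Eu n →L[ℝ] Eu n →L[ℝ] ℝ} {a v : Eu n} {Λ : ℝ}

/-- The linearized right-hand side lies above `θ` and touches it. -/
theorem theta_le_of_basis
    (hW : ∀ᶠ x in 𝓝 a, (∀ y z, wHess A u x y z = wHess A u x z y) ∧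
      ∀ y, y ≠ 0 → 0 < wHess A u x y y)
    (hθ : ∀ᶠ x in 𝓝 a, θ x = Real.log (gram (wHess A u x)).det - B (jet u x))
    (f : Module.Basis (Fin n) ℝ (Eu n))
    (hf : ∀ i j, wHess A u a (f i) (f j) = if i = j then 1 else 0) :
    ∃ k : ℝ, (∀ᶠ x in 𝓝 a, θ x ≤ k + ((∑ i, wHess A u x (f i) (f i)) - B (jet u x))) ∧
      θ a = k + ((∑ i, wHess A u a (f i) (f i)) - B (jet u a)) := by
  refine ⟨Real.log (gram (wHess A u a)).det - n, ?_, ?_⟩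
  · filter_upwards [hW, hθ] with x hx hx'
    rw [hx']
    have := log_det_gram_le f hf hx.1 hx.2
    linarith
  · rw [hθ.self_of_nhds]
    simp [hf]

/-- The evolution of `w_{vv}` at a spatial maximum is bounded in terms of the second derivatives of
`A`, `B`, `G` and of the Hessian of `u`. -/
theorem evolution_le (hu : ContDiffAt ℝ 4 u a) (hA : ContDiffAt ℝ 2 A (jet u a))
    (hB : ContDiffAt ℝ 2 B (jet u a)) (hG : ContDiffAt ℝ 2 G a) (hθ2 : ContDiffAt ℝ 2 θ a)
    (hW : ∀ᶠ x in 𝓝 a, (∀ y z, wHess A u x y z = wHess A u x z y) ∧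
      ∀ y, y ≠ 0 → 0 < wHess A u x y y)
    (hθ : ∀ᶠ x in 𝓝 a, θ x = Real.log (gram (wHess A u x)).det - B (jet u x))
    (hmax : ∀ᶠ x in 𝓝 a, wHess A u x v v ≤ Λ * G x v v)
    (heq : wHess A u a v v = Λ * G a v v)
    (f : Module.Basis (Fin n) ℝ (Eu n))
    (hf : ∀ i j, wHess A u a (f i) (f j) = if i = j then 1 else 0)
    (κ : Eu n) (hκ : ∀ p : Eu n →L[ℝ] ℝ, p κ = fderiv ℝ A (jet u a) (0, p) v v) :
    ∃ τ : Eu n →L[ℝ] ℝ,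
      (∀ ξ, τ ξ = Λ * fderiv ℝ G a ξ v v + fderiv ℝ A (jet u a) (jetDir u a ξ) v v) ∧
      fderiv ℝ (fderiv ℝ θ) a v v - fderiv ℝ θ a κ ≤
        (∑ i, (Λ * fderiv ℝ (fderiv ℝ G) a (f i) (f i) v v
          + fderiv ℝ (fderiv ℝ A) (jet u a) (jetDir u a (f i)) (jetDir u a (f i)) v v
          - fderiv ℝ (fderiv ℝ A) (jet u a) (jetDir u a v) (jetDir u a v) (f i) (f i)
          - fderiv ℝ A (jet u a) (0, τ) (f i) (f i)
          + fderiv ℝ A (jet u a) (jetDir u a κ) (f i) (f i)))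
        - fderiv ℝ (fderiv ℝ B) (jet u a) (jetDir u a v) (jetDir u a v)
        - fderiv ℝ B (jet u a) (0, τ) + fderiv ℝ B (jet u a) (jetDir u a κ) := by
  have hu2 : ContDiffAt ℝ 2 (fderiv ℝ (fderiv ℝ u)) a :=
    (hu.fderiv_right (m := 3) (by norm_num)).fderiv_right (m := 2) (by norm_num)
  have hw2 := contDiffAt_wHess hu hA
  have hwz : ∀ z, ContDiffAt ℝ 2 (fun x => wHess A u x z z) a := fun z =>
    (evalDiag z).contDiff.contDiffAt.comp a hw2
  have hBJ : ContDiffAt ℝ 2 (fun x => B (jet u x)) a :=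
    hB.comp a (contDiffAt_jet hu (by norm_num))
  have hGz : ContDiffAt ℝ 2 (fun x => G x v v) a := (evalDiag v).contDiff.contDiffAt.comp a hG
  have hGΛ : ContDiffAt ℝ 2 (fun x => Λ * G x v v) a := contDiffAt_const.mul hGz
  have hG1 : ∀ ξ, fderiv ℝ (fun x => Λ * G x v v) a ξ = Λ * fderiv ℝ G a ξ v v := by
    intro ξ
    rw [fderiv_const_mul (hGz.differentiableAt (by simp))]
    have : HasFDerivAt (fun x => G x v v) ((evalDiag v).comp (fderiv ℝ G a)) a :=
      (evalDiag v).hasFDerivAt.comp a (hG.differentiableAt (by simp)).hasFDerivAt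
    rw [this.fderiv]; rfl
  have hG2 : ∀ ξ, fderiv ℝ (fderiv ℝ (fun x => Λ * G x v v)) a ξ ξ =
      Λ * fderiv ℝ (fderiv ℝ G) a ξ ξ v v := by
    intro ξ
    exact fderiv_fderiv_clm_comp (Λ • evalDiag v) hG ξ ξ
  -- τ is D³u(v, v, ·). The first-order condition for w_vv ≤ Λ G_vv at the touching point expresses
  -- it through second derivatives of `u`.
  refine ⟨fderiv ℝ (fderiv ℝ (fderiv ℝ u)) a v v, ?_, ?_⟩
  · intro ξ
    have h1 := fderiv_wHess hu hA v ξ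
    rw [fderiv_eq_of_eventually_le ((hwz v).differentiableAt (by simp))
      (hGΛ.differentiableAt (by simp)) hmax heq, hG1] at h1
    linarith
  obtain ⟨k, hle, hk⟩ := theta_le_of_basis hW hθ f hf
  set τ := fderiv ℝ (fderiv ℝ (fderiv ℝ u)) a v v with hτ
  have hS : ContDiffAt ℝ 2 (fun x => ∑ i, wHess A u x (f i) (f i)) a :=
    ContDiffAt.sum fun i _ => hwz (f i)
  have hL : ContDiffAt ℝ 2
      (fun x => k + ((∑ i, wHess A u x (f i) (f i)) - B (jet u x))) a :=
    contDiffAt_const.add (hS.sub hBJ)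
  -- first derivative
  have d1 : fderiv ℝ θ a κ = (∑ i, fderiv ℝ (fun x => wHess A u x (f i) (f i)) a κ) -
      fderiv ℝ B (jet u a) (jetDir u a κ) := by
    rw [fderiv_eq_of_eventually_le (hθ2.differentiableAt (by simp))
      (hL.differentiableAt (by simp)) hle hk, fderiv_const_add,
      fderiv_fun_sub (hS.differentiableAt (by simp)) (hBJ.differentiableAt (by simp)),
      fderiv_fun_sum fun i _ => (hwz (f i)).differentiableAt (by simp)]
    rw [← fderiv_comp_jet (hB.differentiableAt (by simp)) (hu.of_le (by norm_num))]
    simp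
  -- second derivative
  have d2 : fderiv ℝ (fderiv ℝ θ) a v v ≤
      (∑ i, fderiv ℝ (fderiv ℝ (fun x => wHess A u x (f i) (f i))) a v v) -
      (fderiv ℝ (fderiv ℝ B) (jet u a) (jetDir u a v) (jetDir u a v) +
        fderiv ℝ B (jet u a) (0, τ)) := by
    refine (fderiv_fderiv_le_of_eventually_le hθ2 hL hle hk v).trans_eq ?_
    rw [← fderiv_fderiv_comp_jet hB (hu.of_le (by norm_num))]
    have hev : fderiv ℝ (fun x => k + ((∑ i, wHess A u x (f i) (f i)) - B (jet u x))) =ᶠ[𝓝 a]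
        fun x => (∑ i, fderiv ℝ (fun x => wHess A u x (f i) (f i)) x) -
          fderiv ℝ (fun x => B (jet u x)) x := by
      have hwev : ∀ᶠ x in 𝓝 a, ∀ i, ContDiffAt ℝ 2 (fun x => wHess A u x (f i) (f i)) x :=
        eventually_all.2 fun i => (hwz (f i)).eventually (by simp)
      filter_upwards [hwev, hBJ.eventually (by simp)] with x h1 h2
      have h3 : DifferentiableAt ℝ (fun x => ∑ i, wHess A u x (f i) (f i)) x :=
        (ContDiffAt.sum fun i _ => h1 i).differentiableAt (by simp : (2 : ℕ∞ω) ≠ 0)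
      rw [fderiv_const_add, fderiv_fun_sub h3 (h2.differentiableAt (by simp)),
        fderiv_fun_sum fun i _ => (h1 i).differentiableAt (by simp)]
    have hd : ∀ i, DifferentiableAt ℝ (fderiv ℝ (fun x => wHess A u x (f i) (f i))) a :=
      fun i => ((hwz (f i)).fderiv_right (m := 1) (by norm_num)).differentiableAt (by simp)
    rw [hev.fderiv_eq, fderiv_fun_sub (DifferentiableAt.fun_sum fun i _ => hd i)
      ((hBJ.fderiv_right (m := 1) (by norm_num)).differentiableAt (by simp)),
      fderiv_fun_sum fun i _ => hd i]
    simp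
  -- The fourth derivatives agree by `fderiv4_symm`. The uncontrolled D³u(fᵢ, fᵢ, ·) occurs twice,
  -- in D_pA(·)(v, v) from ∂ᵢ²w_vv and evaluated at κ from ∂_κ w(fᵢ, fᵢ); the choice of κ makes the
  -- two cancel.
  have key : ∀ i, fderiv ℝ (fderiv ℝ (fun x => wHess A u x (f i) (f i))) a v v -
      fderiv ℝ (fun x => wHess A u x (f i) (f i)) a κ ≤
      Λ * fderiv ℝ (fderiv ℝ G) a (f i) (f i) v v
          + fderiv ℝ (fderiv ℝ A) (jet u a) (jetDir u a (f i)) (jetDir u a (f i)) v v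
          - fderiv ℝ (fderiv ℝ A) (jet u a) (jetDir u a v) (jetDir u a v) (f i) (f i)
          - fderiv ℝ A (jet u a) (0, τ) (f i) (f i)
          + fderiv ℝ A (jet u a) (jetDir u a κ) (f i) (f i) := by
    intro i
    have e1 := fderiv_fderiv_wHess hu hA (f i) v
    have e2 := fderiv_fderiv_wHess hu hA v (f i)
    have e3 := fderiv_wHess hu hA (f i) κ
    have e4 := fderiv4_symm hu v (f i)
    have e5 := fderiv_fderiv_le_of_eventually_le (hwz v) hGΛ hmax heq (f i)
    rw [hG2] at e5
    have e6 := hκ (fderiv ℝ (fderiv ℝ (fderiv ℝ u)) a (f i) (f i))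
    linarith
  have hsum := Finset.sum_le_sum fun i (_ : i ∈ Finset.univ) => key i
  rw [Finset.sum_sub_distrib] at hsum
  linarith

end Comparison

/-! ### Operator norm bounds. -/

section Estimates

variable {X : Type*} [NormedAddCommGroup X] [NormedSpace ℝ X]

theorem abs_bilin_le {W : X →L[ℝ] X →L[ℝ] ℝ} {k : ℝ} (hk : ‖W‖ ≤ k) (x y : X) :
    |W x y| ≤ k * ‖x‖ * ‖y‖ := by
  rw [← Real.norm_eq_abs]
  refine (W.le_opNorm₂ x y).trans ?_
  gcongr

theorem abs_jetBilin_le {P : X × (X →L[ℝ] ℝ) →L[ℝ] X →L[ℝ] X →L[ℝ] ℝ} {k : ℝ} (hk : ‖P‖ ≤ k)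
    (q : X × (X →L[ℝ] ℝ)) (x : X) : |P q x x| ≤ k * ‖q‖ * ‖x‖ ^ 2 := by
  have h1 : ‖P q‖ ≤ k * ‖q‖ := (P.le_opNorm q).trans (by gcongr)
  exact (abs_bilin_le h1 x x).trans_eq (by ring)

theorem abs_jetBilin₂_le
    {P : X × (X →L[ℝ] ℝ) →L[ℝ] X × (X →L[ℝ] ℝ) →L[ℝ] X →L[ℝ] X →L[ℝ] ℝ} {k : ℝ} (hk : ‖P‖ ≤ k)
    (q r : X × (X →L[ℝ] ℝ)) (x : X) : |P q r x x| ≤ k * ‖q‖ * ‖r‖ * ‖x‖ ^ 2 := by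
  have h1 : ‖P q‖ ≤ k * ‖q‖ := (P.le_opNorm q).trans (by gcongr)
  exact abs_jetBilin_le h1 r x

theorem jetBilin₂_add_smul
    (P : X × (X →L[ℝ] ℝ) →L[ℝ] X × (X →L[ℝ] ℝ) →L[ℝ] X →L[ℝ] X →L[ℝ] ℝ)
    (c : ℝ) (q r : X × (X →L[ℝ] ℝ)) (x : X) :
    P (c • q + r) (c • q + r) x x =
      c ^ 2 * P q q x x + c * P q r x x + c * P r q x x + P r r x x := by
  have h1 : ∀ s, P (c • q + r) s x x = c * P q s x x + P r s x x := fun s => by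
    rw [P.map_add, P.map_smul]; rfl
  have h2 : ∀ s, P s (c • q + r) x x = c * P s q x x + P s r x x := fun s => by
    rw [(P s).map_add, (P s).map_smul]; rfl
  rw [h1, h2, h2]
  ring

/-- The Cauchy-Schwarz inequality for the semidefinite form `W`, obtained from a discriminant,
reduces the operator norm to the diagonal values. -/
theorem norm_le_of_le {W G : X →L[ℝ] X →L[ℝ] ℝ} {k Λ : ℝ} (hWs : ∀ x y, W x y = W y x)
    (h0 : ∀ x, 0 ≤ W x x) (hmax : ∀ z, W z z ≤ Λ * G z z) (hG : ‖G‖ ≤ k) (hΛ : 0 ≤ Λ) :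
    ‖W‖ ≤ k * Λ := by
  have hk : 0 ≤ k := (norm_nonneg _).trans hG
  refine W.opNorm_le_bound₂ (by positivity) fun x y => ?_
  have hd : ∀ z, W z z ≤ k * Λ * ‖z‖ ^ 2 := fun z => by
    refine (hmax z).trans ?_
    have := (abs_le.1 (abs_bilin_le hG z z)).2
    nlinarith [mul_le_mul_of_nonneg_left this hΛ]
  have hcs : W x y ^ 2 ≤ W x x * W y y := by
    have := discrim_le_zero (a := W y y) (b := 2 * W x y) (c := W x x) fun s => by
      have := h0 (x + s • y)
      simp only [map_add, map_smul, _root_.add_apply, _root_.smul_apply, smul_eq_mul,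
        hWs y x] at this
      linarith
    rw [discrim] at this
    linarith
  have h2 : W x y ^ 2 ≤ (k * Λ * ‖x‖ * ‖y‖) ^ 2 := by
    refine hcs.trans ((mul_le_mul (hd x) (hd y) (h0 y) (by positivity)).trans_eq (by ring))
  rw [Real.norm_eq_abs]
  exact abs_le_of_sq_le_sq h2 (by positivity)

end Estimates

/-! ### Absorption of the lower-order terms by the Ma-Trudinger-Wang term. -/

section Core

variable {n : ℕ}

/-- The sum of the `μ i` is large if the largest eigenvalue is. -/
theorem exists_large_of_det {W G : Eu n →L[ℝ] Eu n →L[ℝ] ℝ} {k Λ K : ℝ} (hk : 0 < k) (hK : 1 ≤ K)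
    (hΛ : k ^ 2 * K ^ n < Λ)
    (hdW : (gram W).det ≤ k) (hdG : 1 ≤ k * (gram G).det)
    (f : Module.Basis (Fin n) ℝ (Eu n)) {μ : Fin n → ℝ}
    (hWf : ∀ i j, W (f i) (f j) = if i = j then 1 else 0)
    (hGf : ∀ i j, G (f i) (f j) = if i = j then μ i else 0) (hμ : ∀ i, 0 ≤ μ i)
    {v : Eu n} (hv : G v v = 1) (hWv : W v v = Λ) : K ≤ ∑ i, μ i := by
  by_contra hlt
  push Not at hlt
  have hle : ∀ i, μ i ≤ K := fun i =>
    (Finset.single_le_sum (fun j _ => hμ j) (Finset.mem_univ i)).trans hlt.le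
  have hΛ0 : 0 < Λ := lt_of_le_of_lt (by positivity) hΛ
  -- If every Λ μᵢ exceeded 1, then Λ G > W on nonzero vectors, whereas the two forms agree at `v`.
  obtain ⟨j, hj⟩ : ∃ j, Λ * μ j ≤ 1 := by
    by_contra hcon
    push Not at hcon
    have hve : v = ∑ i, f.repr v i • f i := (f.sum_repr v).symm
    have e1 : ∑ i, (f.repr v i) ^ 2 = Λ := by
      rw [← hWv]; conv_rhs => rw [hve, bilin_sum_sum]
      simp [hWf, sq]
    have e2 : ∑ i, (f.repr v i) ^ 2 * μ i = 1 := by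
      rw [← hv]; conv_rhs => rw [hve, bilin_sum_sum]
      simp [hGf, sq]
    have : ∑ i, (f.repr v i) ^ 2 < ∑ i, Λ * ((f.repr v i) ^ 2 * μ i) := by
      refine Finset.sum_lt_sum (fun i _ => ?_) ?_
      · nlinarith [sq_nonneg (f.repr v i), hcon i]
      · by_contra hz
        push Not at hz
        have hz0 : ∀ i, f.repr v i ^ 2 = 0 := fun i => by
          have := hz i (Finset.mem_univ i)
          nlinarith [sq_nonneg (f.repr v i), hcon i]
        simp [hz0] at e1
        exact hΛ0.ne e1
    rw [← Finset.mul_sum, e1, e2] at this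
    linarith
  have d1 := det_gramOn f W
  have d2 := det_gramOn f G
  have e1 : gramOn f W = 1 := by ext i j; simp [gramOn, hWf, Matrix.one_apply]
  have e2 : gramOn f G = Matrix.diagonal μ := by
    ext i j; simp [gramOn, hGf, Matrix.diagonal_apply]
  rw [e1, Matrix.det_one] at d1
  rw [e2, Matrix.det_diagonal] at d2
  set P := (Matrix.of fun i k => f i k).det
  have hP : 1 ≤ P ^ 2 * k := d1.trans_le (by gcongr)
  -- ∏ μᵢ is the basis-independent ratio det G / det W, so it is at least 1 / k². With one factor at
  -- most 1 / Λ and the others at most K this contradicts the size of Λ.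
  have hprod : 1 ≤ k ^ 2 * ∏ i, μ i := by
    rw [d2]
    calc (1 : ℝ) ≤ (P ^ 2 * k) * (k * (gram G).det) := one_le_mul_of_one_le_of_one_le hP hdG
      _ = _ := by ring
  have hprod2 : Λ * ∏ i, μ i ≤ K ^ n := by
    rw [← Finset.mul_prod_erase _ _ (Finset.mem_univ j), ← mul_assoc]
    calc Λ * μ j * ∏ i ∈ Finset.univ.erase j, μ i ≤ 1 * ∏ i ∈ Finset.univ.erase j, K := by
          refine mul_le_mul hj (Finset.prod_le_prod (fun i _ => hμ i) fun i _ => hle i)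
            (Finset.prod_nonneg fun i _ => hμ i) zero_le_one
      _ ≤ K ^ n := by
          rw [one_mul, Finset.prod_const]
          exact pow_le_pow_right₀ hK ((Finset.card_le_univ _).trans_eq (Fintype.card_fin n))
  have : Λ ≤ k ^ 2 * K ^ n := by
    calc Λ = Λ * 1 := (mul_one _).symm
      _ ≤ Λ * (k ^ 2 * ∏ i, μ i) := by gcongr
      _ = k ^ 2 * (Λ * ∏ i, μ i) := by ring
      _ ≤ k ^ 2 * K ^ n := by gcongr
  linarith

set_option maxHeartbeats 1600000 in
/-- The terms that the Ma-Trudinger-Wang condition has to absorb are of lower order. -/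
theorem evolution_terms_nonpos (n : ℕ) (k δ : ℝ) (hk : 1 ≤ k) (hδ : 0 < δ) :
    ∃ C : ℝ, 1 ≤ C ∧ ∀ (W A₀ G₀ : Eu n →L[ℝ] Eu n →L[ℝ] ℝ)
      (DA : Eu n × (Eu n →L[ℝ] ℝ) →L[ℝ] Eu n →L[ℝ] Eu n →L[ℝ] ℝ)
      (D2A : Eu n × (Eu n →L[ℝ] ℝ) →L[ℝ] Eu n × (Eu n →L[ℝ] ℝ) →L[ℝ]
        Eu n →L[ℝ] Eu n →L[ℝ] ℝ)
      (DB : Eu n × (Eu n →L[ℝ] ℝ) →L[ℝ] ℝ)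
      (D2B : Eu n × (Eu n →L[ℝ] ℝ) →L[ℝ] Eu n × (Eu n →L[ℝ] ℝ) →L[ℝ] ℝ)
      (DG : Eu n →L[ℝ] Eu n →L[ℝ] Eu n →L[ℝ] ℝ)
      (D2G : Eu n →L[ℝ] Eu n →L[ℝ] Eu n →L[ℝ] Eu n →L[ℝ] ℝ)
      (f : Module.Basis (Fin n) ℝ (Eu n)) (μ : Fin n → ℝ) (v κ : Eu n) (τ : Eu n →L[ℝ] ℝ) (Λ : ℝ)
      (J : Eu n → Eu n × (Eu n →L[ℝ] ℝ)),
      ‖A₀‖ ≤ k → ‖G₀‖ ≤ k → ‖DA‖ ≤ k → ‖D2A‖ ≤ k → ‖DB‖ ≤ k → ‖D2B‖ ≤ k → ‖DG‖ ≤ k → ‖D2G‖ ≤ k →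
      (∀ z, ‖z‖ ^ 2 ≤ k * G₀ z z) → (gram W).det ≤ k → 1 ≤ k * (gram G₀).det →
      (∀ x y, W x y = W y x) → (∀ x y, G₀ x y = G₀ y x) → (∀ x, 0 ≤ W x x) →
      (∀ z, W z z ≤ Λ * G₀ z z) → G₀ v v = 1 → W v v = Λ →
      (∀ i j, W (f i) (f j) = if i = j then 1 else 0) →
      (∀ i j, G₀ (f i) (f j) = if i = j then μ i else 0) →
      (∀ z, G₀ v z = 0 → δ * G₀ z z ≤ D2A (0, G₀ v) (0, G₀ v) z z) →
      (∀ ξ, J ξ = (ξ, W ξ + A₀ ξ)) →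
      (∀ p : Eu n →L[ℝ] ℝ, p κ = DA (0, p) v v) →
      (∀ ξ, τ ξ = Λ * DG ξ v v + DA (J ξ) v v) → C ≤ Λ →
      (∑ i, (Λ * D2G (f i) (f i) v v + D2A (J (f i)) (J (f i)) v v - D2A (J v) (J v) (f i) (f i)
          - DA (0, τ) (f i) (f i) + DA (J κ) (f i) (f i)))
        - D2B (J v) (J v) - DB (0, τ) + DB (J κ) ≤ 0 := by
  -- K is the size of S = Σ μᵢ for which half of δ Λ² S dominates all terms of order Λ² without a
  -- factor S: (3k⁶ + δ)Λ for each of the n indices and 9k⁶Λ² from `B`.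
  set K : ℝ := 1 + 2 * (n * (3 * k ^ 6 + δ) + 9 * k ^ 6) / δ with hKdef
  have hk0 : 0 < k := by linarith
  have hK1 : 1 ≤ K := by
    rw [hKdef]; have : 0 ≤ 2 * (n * (3 * k ^ 6 + δ) + 9 * k ^ 6) / δ := by positivity
    linarith
  -- The three summands give Λ ≥ 1, the lower bound S ≥ K through `exists_large_of_det`, and δ Λ ≥
  -- 22k⁶, which absorbs the total 11k⁶ Λ S into the other half of δ Λ² S.
  refine ⟨1 + k ^ 2 * K ^ n + 22 * k ^ 6 / δ, ?_, ?_⟩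
  · have : 0 ≤ k ^ 2 * K ^ n + 22 * k ^ 6 / δ := by positivity
    linarith
  intro W A₀ G₀ DA D2A DB D2B DG D2G f μ v κ τ Λ J hA hG hDA hD2A hDB hD2B hDG hD2G hlow hdW hdG
    hWs hGs hW0 hmax hGv hWv hWf hGf hmtw hJ hκ hτ hC
  have hp1 : 0 ≤ k ^ 2 * K ^ n := by positivity
  have hp2 : 0 ≤ 22 * k ^ 6 / δ := by positivity
  have hΛ1 : 1 ≤ Λ := by linarith
  have hΛK : k ^ 2 * K ^ n < Λ := by linarith
  have hΛδ : 22 * k ^ 6 ≤ δ * Λ := by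
    have : 22 * k ^ 6 / δ ≤ Λ := by linarith
    rw [div_le_iff₀ hδ] at this
    linarith
  have hΛ0 : 0 < Λ := by linarith
  have hpw : ∀ {i j : ℕ}, i ≤ j → k ^ i ≤ k ^ j := fun h => pow_le_pow_right₀ hk h
  have hμ : ∀ i, 1 ≤ Λ * μ i := fun i => by
    have := hmax (f i)
    rwa [hWf, hGf, if_pos rfl, if_pos rfl] at this
  have hμ0 : ∀ i, 0 < μ i := fun i => by
    by_contra hneg
    push Not at hneg
    nlinarith [hμ i]
  have hS := exists_large_of_det hk0 hK1 hΛK hdW hdG f hWf hGf (fun i => (hμ0 i).le) hGv hWv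
  have heig := eq_of_isMax hWs hGs hmax (v := v) (by rw [hGv, hWv, mul_one])
  have hv2 : ‖v‖ ^ 2 ≤ k := by simpa [hGv] using hlow v
  have hv1 : ‖v‖ ≤ k := abs_le_of_sq_le_sq' (by nlinarith) hk0.le |>.2
  have hf2 : ∀ i, ‖f i‖ ^ 2 ≤ k * μ i := fun i => by simpa [hGf] using hlow (f i)
  have hWn : ‖W‖ ≤ k * Λ := norm_le_of_le hWs hW0 hmax hG hΛ0.le
  have hJn : ∀ ξ, ‖J ξ‖ ≤ 2 * k * Λ * ‖ξ‖ := fun ξ => by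
    rw [hJ]
    refine norm_prod_le_iff.2 ⟨?_, ?_⟩
    · have : 1 ≤ k * Λ := one_le_mul_of_one_le_of_one_le hk hΛ1
      nlinarith [norm_nonneg ξ]
    · calc ‖W ξ + A₀ ξ‖ ≤ ‖W ξ‖ + ‖A₀ ξ‖ := norm_add_le _ _
        _ ≤ k * Λ * ‖ξ‖ + k * ‖ξ‖ := add_le_add (W.le_of_opNorm_le hWn ξ) (A₀.le_of_opNorm_le hA ξ)
        _ ≤ 2 * k * Λ * ‖ξ‖ := by nlinarith [mul_nonneg (mul_nonneg hk0.le (sub_nonneg.2 hΛ1)) (norm_nonneg ξ)]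
  have hκn : ‖κ‖ ≤ k ^ 2 := by
    refine NormedSpace.norm_le_dual_bound ℝ κ (by positivity) fun p => ?_
    rw [hκ p, Real.norm_eq_abs]
    refine (abs_jetBilin_le hDA _ _).trans ?_
    have : ‖((0 : Eu n), p)‖ = ‖p‖ := by simp [Prod.norm_def]
    rw [this]
    nlinarith [norm_nonneg p, mul_nonneg hk0.le (norm_nonneg p)]
  have hτn : ‖τ‖ ≤ 3 * k ^ 3 * Λ := by
    refine τ.opNorm_le_bound (by positivity) fun ξ => ?_
    rw [hτ ξ, Real.norm_eq_abs]
    have h1 : |DG ξ v v| ≤ k * ‖ξ‖ * ‖v‖ * ‖v‖ :=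
      abs_bilin_le ((DG.le_opNorm ξ).trans (by gcongr)) v v
    have h2 := abs_jetBilin_le hDA (J ξ) v
    calc |Λ * DG ξ v v + DA (J ξ) v v| ≤ |Λ * DG ξ v v| + |DA (J ξ) v v| := abs_add_le _ _
      _ = Λ * |DG ξ v v| + |DA (J ξ) v v| := by rw [abs_mul, abs_of_pos hΛ0]
      _ ≤ Λ * (k * ‖ξ‖ * ‖v‖ * ‖v‖) + k * ‖J ξ‖ * ‖v‖ ^ 2 := by gcongr
      _ ≤ Λ * (k * ‖ξ‖ * k) + k * (2 * k * Λ * ‖ξ‖) * k := by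
          have : k * ‖ξ‖ * ‖v‖ * ‖v‖ ≤ k * ‖ξ‖ * k := by
            rw [mul_assoc _ ‖v‖, ← sq]; gcongr
          have := hJn ξ
          gcongr
      _ = (k ^ 2 + 2 * k ^ 3) * Λ * ‖ξ‖ := by ring
      _ ≤ 3 * k ^ 3 * Λ * ‖ξ‖ := by
          have := hpw (show 2 ≤ 3 by norm_num)
          gcongr; linarith
  have h0τ : ‖((0 : Eu n), τ)‖ ≤ 3 * k ^ 3 * Λ := by
    have : ‖((0 : Eu n), τ)‖ = ‖τ‖ := by simp [Prod.norm_def]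
    rwa [this]
  have hJκ : ‖J κ‖ ≤ 2 * k ^ 3 * Λ := (hJn κ).trans (by
    calc 2 * k * Λ * ‖κ‖ ≤ 2 * k * Λ * k ^ 2 := by gcongr
      _ = _ := by ring)
  have hJv : ‖J v‖ ≤ 2 * k ^ 2 * Λ := (hJn v).trans (by
    calc 2 * k * Λ * ‖v‖ ≤ 2 * k * Λ * k := by gcongr
      _ = _ := by ring)
  have t1 : ∀ i, Λ * D2G (f i) (f i) v v ≤ k ^ 6 * (Λ * μ i) := fun i => by
    have h1 : ‖D2G (f i)‖ ≤ k * ‖f i‖ := (D2G.le_opNorm _).trans (by gcongr)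
    have h2 : ‖D2G (f i) (f i)‖ ≤ k * ‖f i‖ * ‖f i‖ :=
      ((D2G (f i)).le_opNorm _).trans (by gcongr)
    have h3 := (abs_le.1 (abs_bilin_le h2 v v)).2
    calc Λ * D2G (f i) (f i) v v ≤ Λ * (k * ‖f i‖ * ‖f i‖ * ‖v‖ * ‖v‖) := by gcongr
      _ = Λ * (k * ‖f i‖ ^ 2 * ‖v‖ ^ 2) := by ring
      _ ≤ Λ * (k * (k * μ i) * k) := by have := hf2 i; have := hμ0 i; gcongr
      _ = k ^ 3 * (Λ * μ i) := by ring
      _ ≤ k ^ 6 * (Λ * μ i) := by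
          have := hμ0 i
          gcongr; norm_num
  -- The crude bound ‖W‖ ≤ kΛ would yield a term of order Λ² μᵢ, comparable to the good one. Instead
  -- W fᵢ = μᵢ⁻¹ G fᵢ, of squared norm at most k³ / μᵢ ≤ k³ Λ.
  have hWf2 : ∀ i, ‖W (f i)‖ ^ 2 ≤ k ^ 3 * Λ := fun i => by
    have h1 : μ i • W (f i) = G₀ (f i) := by
      have : ((μ i • W (f i) : Eu n →L[ℝ] ℝ) : Eu n →ₗ[ℝ] ℝ) = (G₀ (f i) : Eu n →ₗ[ℝ] ℝ) := by
        refine f.ext fun j => ?_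
        simp [hWf, hGf]
      exact ContinuousLinearMap.coe_injective this
    have h2 : μ i * ‖W (f i)‖ ≤ k * ‖f i‖ := by
      have := G₀.le_of_opNorm_le hG (f i)
      rwa [← h1, norm_smul, Real.norm_of_nonneg (hμ0 i).le] at this
    have h3 : (μ i * ‖W (f i)‖) ^ 2 ≤ (k * ‖f i‖) ^ 2 := by
      have := hμ0 i
      gcongr
    have h4 : μ i * (μ i * ‖W (f i)‖ ^ 2) ≤ μ i * k ^ 3 := by
      calc μ i * (μ i * ‖W (f i)‖ ^ 2) = (μ i * ‖W (f i)‖) ^ 2 := by ring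
        _ ≤ (k * ‖f i‖) ^ 2 := h3
        _ = k ^ 2 * ‖f i‖ ^ 2 := by ring
        _ ≤ k ^ 2 * (k * μ i) := by have := hf2 i; gcongr
        _ = _ := by ring
    have h5 := le_of_mul_le_mul_left h4 (hμ0 i)
    calc ‖W (f i)‖ ^ 2 = 1 * ‖W (f i)‖ ^ 2 := (one_mul _).symm
      _ ≤ Λ * μ i * ‖W (f i)‖ ^ 2 := by gcongr; exact hμ i
      _ = Λ * (μ i * ‖W (f i)‖ ^ 2) := by ring
      _ ≤ Λ * k ^ 3 := by gcongr
      _ = _ := by ring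
  have hJf : ∀ i, ‖J (f i)‖ ^ 2 ≤ 2 * k ^ 3 * (Λ + μ i) := fun i => by
    have h1 : ‖J (f i)‖ ≤ ‖W (f i)‖ + k * ‖f i‖ := by
      rw [hJ]
      refine norm_prod_le_iff.2 ⟨?_, ?_⟩
      · change ‖f i‖ ≤ _
        nlinarith [norm_nonneg (f i), norm_nonneg (W (f i))]
      · exact (norm_add_le _ _).trans (add_le_add le_rfl (A₀.le_of_opNorm_le hA _))
    calc ‖J (f i)‖ ^ 2 ≤ (‖W (f i)‖ + k * ‖f i‖) ^ 2 := by gcongr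
      _ ≤ 2 * ‖W (f i)‖ ^ 2 + 2 * k ^ 2 * ‖f i‖ ^ 2 := by
          nlinarith [sq_nonneg (‖W (f i)‖ - k * ‖f i‖)]
      _ ≤ 2 * (k ^ 3 * Λ) + 2 * k ^ 2 * (k * μ i) := by
          have := hf2 i; have := hWf2 i; gcongr
      _ = _ := by ring
  have t2 : ∀ i, D2A (J (f i)) (J (f i)) v v ≤ 2 * k ^ 6 * (Λ + Λ * μ i) := fun i => by
    have h1 := (abs_le.1 (abs_jetBilin₂_le hD2A (J (f i)) (J (f i)) v)).2
    have hμi := hμ0 i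
    calc D2A (J (f i)) (J (f i)) v v ≤ k * ‖J (f i)‖ * ‖J (f i)‖ * ‖v‖ ^ 2 := h1
      _ = k * ‖J (f i)‖ ^ 2 * ‖v‖ ^ 2 := by ring
      _ ≤ k * (2 * k ^ 3 * (Λ + μ i)) * k := by have := hJf i; gcongr
      _ = 2 * k ^ 5 * (Λ + 1 * μ i) := by ring
      _ ≤ 2 * k ^ 6 * (Λ + Λ * μ i) := by
          gcongr; norm_num
  have hGvn : ‖G₀ v‖ ≤ k ^ 2 := (G₀.le_of_opNorm_le hG v).trans (by nlinarith)
  have t3 : ∀ i, - D2A (J v) (J v) (f i) (f i) ≤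
      - (δ * Λ ^ 2 * μ i) + (k ^ 6 + δ) * Λ + 3 * k ^ 6 * (Λ * μ i) := fun i => by
    set η : Eu n × (Eu n →L[ℝ] ℝ) := (0, G₀ v) with hη
    set r : Eu n × (Eu n →L[ℝ] ℝ) := (v, A₀ v) with hr
    -- By the eigenvector property the jet derivative in direction `v` is Λ times the pure covector
    -- η = G(v, ·) plus a bounded remainder, so D²A(Jv, Jv) is Λ² D_p²A(η, η) up to order Λ.
    have hJvd : J v = Λ • η + r := by
      rw [hJ, hη, hr]
      ext1
      · simp
      · ext z; simp [heig]
    have hηn : ‖η‖ ≤ k ^ 2 := by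
      refine norm_prod_le_iff.2 ⟨?_, hGvn⟩
      simp [hη]; positivity
    have hrn : ‖r‖ ≤ k ^ 2 := by
      refine norm_prod_le_iff.2 ⟨?_, ?_⟩
      · exact hv1.trans (by nlinarith)
      · exact (A₀.le_of_opNorm_le hA v).trans (by nlinarith)
    have hbd : ∀ q s : Eu n × (Eu n →L[ℝ] ℝ), ‖q‖ ≤ k ^ 2 → ‖s‖ ≤ k ^ 2 →
        |D2A q s (f i) (f i)| ≤ k ^ 6 * μ i := fun q s hq hs => by
      refine (abs_jetBilin₂_le hD2A q s (f i)).trans ?_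
      calc k * ‖q‖ * ‖s‖ * ‖f i‖ ^ 2 ≤ k * k ^ 2 * k ^ 2 * (k * μ i) := by
            have := hf2 i; gcongr
        _ = _ := by ring
    have hexp : D2A (J v) (J v) (f i) (f i) = Λ ^ 2 * D2A η η (f i) (f i) +
        Λ * D2A η r (f i) (f i) + Λ * D2A r η (f i) (f i) + D2A r r (f i) (f i) := by
      rw [hJvd, jetBilin₂_add_smul]
    have b1 := (abs_le.1 (hbd η r hηn hrn)).1
    have b2 := (abs_le.1 (hbd r η hrn hηn)).1
    have b3 := (abs_le.1 (hbd r r hrn hrn)).1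
    -- The hypothesis on `D2A` needs fᵢ orthogonal to `v`. If fᵢ is not, it belongs to the top
    -- eigenspace, so μᵢ = 1 / Λ and the crude bound loses only O(1 / Λ).
    have b4 : δ * μ i - (k ^ 6 + δ) / Λ ≤ D2A η η (f i) (f i) := by
      by_cases hor : G₀ v (f i) = 0
      · have := hmtw (f i) hor
        rw [hGf, if_pos rfl] at this
        have h2 : 0 ≤ (k ^ 6 + δ) / Λ := by positivity
        linarith
      · have e1 : G₀ v (f i) = μ i * W v (f i) := by
          have h2 := f.sum_repr v
          rw [← h2]
          simp only [map_sum, map_smul, _root_.sum_apply, _root_.smul_apply, smul_eq_mul, hWf, hGf]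
          rw [Finset.mul_sum]
          refine Finset.sum_congr rfl fun j _ => ?_
          by_cases hji : j = i
          · subst hji; simp; ring
          · simp [hji]
        rw [heig] at e1
        have e2 : μ i * Λ = 1 := by
          have : (μ i * Λ - 1) * G₀ v (f i) = 0 := by linarith
          rcases mul_eq_zero.1 this with h | h
          · linarith
          · exact absurd h hor
        have e3 : μ i = 1 / Λ := by rw [eq_div_iff hΛ0.ne']; exact e2
        have := (abs_le.1 (hbd η η hηn hηn)).1
        rw [e3] at this ⊢
        have h4 : (k ^ 6 + δ) / Λ = k ^ 6 * (1 / Λ) + δ * (1 / Λ) := by ring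
        rw [h4]
        linarith
    have b5 : Λ ^ 2 * (δ * μ i - (k ^ 6 + δ) / Λ) ≤ Λ ^ 2 * D2A η η (f i) (f i) := by gcongr
    have b6 : Λ ^ 2 * (δ * μ i - (k ^ 6 + δ) / Λ) = δ * Λ ^ 2 * μ i - (k ^ 6 + δ) * Λ := by
      field_simp
    have c1 := mul_le_mul_of_nonneg_left b1 hΛ0.le
    have c2 := mul_le_mul_of_nonneg_left b2 hΛ0.le
    have c3 : k ^ 6 * μ i ≤ k ^ 6 * (Λ * μ i) := by
      have := hμ0 i
      rw [show k ^ 6 * μ i = k ^ 6 * (1 * μ i) by ring]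
      gcongr
    rw [hexp]
    linarith
  have t45 : ∀ (q : Eu n × (Eu n →L[ℝ] ℝ)) (m : ℝ), ‖q‖ ≤ m * k ^ 3 * Λ → 0 ≤ m → ∀ i,
      |DA q (f i) (f i)| ≤ m * k ^ 6 * (Λ * μ i) := fun q m hq hm i => by
    have hμi := hμ0 i
    calc |DA q (f i) (f i)| ≤ k * ‖q‖ * ‖f i‖ ^ 2 := abs_jetBilin_le hDA q (f i)
      _ ≤ k * (m * k ^ 3 * Λ) * (k * μ i) := by have := hf2 i; gcongr
      _ = m * k ^ 5 * (Λ * μ i) := by ring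
      _ ≤ m * k ^ 6 * (Λ * μ i) := by
          gcongr; norm_num
  have t4 := fun i => (abs_le.1 (t45 _ 3 h0τ (by norm_num) i)).1
  have t5 := fun i => (abs_le.1 (t45 _ 2 hJκ (by norm_num) i)).2
  have hΛsq : Λ ≤ Λ ^ 2 := by nlinarith
  have t6 : - D2B (J v) (J v) ≤ 4 * k ^ 6 * Λ ^ 2 := by
    have h1 : |D2B (J v) (J v)| ≤ k * ‖J v‖ * ‖J v‖ := by
      rw [← Real.norm_eq_abs]
      refine (D2B.le_opNorm₂ _ _).trans ?_
      gcongr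
    have h2 := (abs_le.1 h1).1
    calc - D2B (J v) (J v) ≤ k * ‖J v‖ * ‖J v‖ := by linarith
      _ ≤ k * (2 * k ^ 2 * Λ) * (2 * k ^ 2 * Λ) := by gcongr
      _ = 4 * k ^ 5 * Λ ^ 2 := by ring
      _ ≤ 4 * k ^ 6 * Λ ^ 2 := by
          gcongr; norm_num
  have t78 : ∀ (q : Eu n × (Eu n →L[ℝ] ℝ)) (m : ℝ), ‖q‖ ≤ m * k ^ 3 * Λ → 0 ≤ m →
      |DB q| ≤ m * k ^ 6 * Λ ^ 2 := fun q m hq hm => by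
    rw [← Real.norm_eq_abs]
    calc ‖DB q‖ ≤ k * ‖q‖ := DB.le_of_opNorm_le hDB q
      _ ≤ k * (m * k ^ 3 * Λ) := by gcongr
      _ = m * k ^ 4 * Λ := by ring
      _ ≤ m * k ^ 6 * Λ ^ 2 := by
          gcongr; norm_num
  have t7 := (abs_le.1 (t78 _ 3 h0τ (by norm_num))).1
  have t8 := (abs_le.1 (t78 _ 2 hJκ (by norm_num))).2
  have hsum := Finset.sum_le_sum (s := Finset.univ) fun i _ => show
      Λ * D2G (f i) (f i) v v + D2A (J (f i)) (J (f i)) v v - D2A (J v) (J v) (f i) (f i)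
          - DA (0, τ) (f i) (f i) + DA (J κ) (f i) (f i) ≤
        (11 * k ^ 6 * Λ - δ * Λ ^ 2) * μ i + (3 * k ^ 6 + δ) * Λ by
    have := t1 i; have := t2 i; have := t3 i; have := t4 i; have := t5 i
    linarith
  have hrhs : ∑ i, ((11 * k ^ 6 * Λ - δ * Λ ^ 2) * μ i + (3 * k ^ 6 + δ) * Λ) =
      (11 * k ^ 6 * Λ - δ * Λ ^ 2) * ∑ i, μ i + n * ((3 * k ^ 6 + δ) * Λ) := by
    rw [Finset.sum_add_distrib, ← Finset.mul_sum]
    simp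
  rw [hrhs] at hsum
  set S := ∑ i, μ i with hSdef
  have hS0 : 0 ≤ S := by linarith
  have hKδ : 2 * (n * (3 * k ^ 6 + δ) + 9 * k ^ 6) ≤ δ * S := by
    have h1 : 2 * (n * (3 * k ^ 6 + δ) + 9 * k ^ 6) / δ ≤ S := by linarith
    rw [div_le_iff₀ hδ] at h1
    linarith
  -- The good term δ Λ² S is split in two halves: one against the terms ΛS, one against those of
  -- order Λ².
  have u1 : 11 * k ^ 6 * Λ * S ≤ δ * Λ ^ 2 * S / 2 := by
    have := mul_le_mul_of_nonneg_right hΛδ (mul_nonneg hΛ0.le hS0)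
    nlinarith
  have u2 : (n * (3 * k ^ 6 + δ) + 9 * k ^ 6) * Λ ^ 2 ≤ δ * Λ ^ 2 * S / 2 := by
    have := mul_le_mul_of_nonneg_right hKδ (sq_nonneg Λ)
    linarith
  have u3 : (n : ℝ) * ((3 * k ^ 6 + δ) * Λ) ≤ n * (3 * k ^ 6 + δ) * Λ ^ 2 := by
    rw [mul_assoc]
    have : 0 ≤ 3 * k ^ 6 + δ := by positivity
    gcongr
  linarith

end Core

/-! ### The evolution estimate in one chart. -/

section EvolutionEstimate

variable {n : ℕ}

/-- Reflexivity in finite dimension. It turns p ↦ D_pA(p)(v, v) into a vector κ, so that D_pA(Dθ)(v,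
v) becomes the first derivative of θ along κ. -/
theorem exists_dual_vector (L : (Eu n →L[ℝ] ℝ) →ₗ[ℝ] ℝ) : ∃ κ : Eu n, ∀ p : Eu n →L[ℝ] ℝ,
    p κ = L p := by
  refine ⟨∑ i, L (EuclideanSpace.proj i) • coordVec i, fun p => ?_⟩
  have hp : p = ∑ i, p (coordVec i) • (EuclideanSpace.proj i : Eu n →L[ℝ] ℝ) := by
    ext x
    conv_lhs => rw [← sum_coordVec x]
    simp [mul_comm]
  conv_rhs => rw [hp]
  simp [mul_comm]

/-- For a function with `θ = ln det (D²u - A(x, Du)) - B(x, Du)`, the evolution `w_{vvt}` is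
nonpositive at a spatial maximum if the maximum is large, under bounds on the coefficients. -/
theorem exists_evolution_nonpos (n : ℕ) (k δ : ℝ) (hk : 1 ≤ k) (hδ : 0 < δ) :
    ∃ C : ℝ, ∀ (u θ : Eu n → ℝ) (A : Eu n × (Eu n →L[ℝ] ℝ) → Eu n →L[ℝ] Eu n →L[ℝ] ℝ)
      (B : Eu n × (Eu n →L[ℝ] ℝ) → ℝ) (G : Eu n → Eu n →L[ℝ] Eu n →L[ℝ] ℝ) (a v : Eu n) (Λ : ℝ),
      ContDiffAt ℝ 4 u a → ContDiffAt ℝ 2 A (jet u a) → ContDiffAt ℝ 2 B (jet u a) →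
      ContDiffAt ℝ 2 G a → ContDiffAt ℝ 2 θ a →
      (∀ᶠ x in 𝓝 a, (∀ y z, wHess A u x y z = wHess A u x z y) ∧
        ∀ y, y ≠ 0 → 0 < wHess A u x y y) →
      (∀ᶠ x in 𝓝 a, θ x = Real.log (gram (wHess A u x)).det - B (jet u x)) →
      (∀ᶠ x in 𝓝 a, ∀ z, wHess A u x z z ≤ Λ * G x z z) →
      G a v v = 1 → wHess A u a v v = Λ → (∀ x y, G a x y = G a y x) →
      (∀ z, ‖z‖ ^ 2 ≤ k * G a z z) → (gram (wHess A u a)).det ≤ k → 1 ≤ k * (gram (G a)).det →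
      ‖A (jet u a)‖ ≤ k → ‖fderiv ℝ A (jet u a)‖ ≤ k → ‖fderiv ℝ (fderiv ℝ A) (jet u a)‖ ≤ k →
      ‖fderiv ℝ B (jet u a)‖ ≤ k → ‖fderiv ℝ (fderiv ℝ B) (jet u a)‖ ≤ k →
      ‖G a‖ ≤ k → ‖fderiv ℝ G a‖ ≤ k → ‖fderiv ℝ (fderiv ℝ G) a‖ ≤ k →
      (∀ z, G a v z = 0 →
        δ * G a z z ≤ fderiv ℝ (fderiv ℝ A) (jet u a) (0, G a v) (0, G a v) z z) →
      C ≤ Λ →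
      fderiv ℝ (fderiv ℝ θ) a v v - fderiv ℝ A (jet u a) (0, fderiv ℝ θ a) v v ≤ 0 := by
  obtain ⟨C, -, hC⟩ := evolution_terms_nonpos n k δ hk hδ
  refine ⟨C, ?_⟩
  intro u θ A B G a v Λ hu hA hB hG hθ2 hW hθ hmax hGv hWv hGs hlow hdW hdG bA bDA bD2A bDB bD2B
    bG bDG bD2G hmtw hCΛ
  have hWa := hW.self_of_nhds
  obtain ⟨f, μ, hWf, hGf⟩ := exists_simultaneous_basis (V := Eu n) finrank_euclideanSpace_fin
    (wHess A u a).toLinearMap₁₂ (G a).toLinearMap₁₂ hWa.1 hWa.2 hGs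
  let L : (Eu n →L[ℝ] ℝ) →ₗ[ℝ] ℝ :=
    ((evalDiag v).comp ((fderiv ℝ A (jet u a)).comp (ContinuousLinearMap.inr ℝ _ _))).toLinearMap
  obtain ⟨κ, hκ⟩ := exists_dual_vector L
  have hκ' : ∀ p : Eu n →L[ℝ] ℝ, p κ = fderiv ℝ A (jet u a) (0, p) v v := hκ
  obtain ⟨τ, hτ, hle⟩ := evolution_le hu hA hB hG hθ2 hW hθ (hmax.mono fun x hx => hx v)
    (by rw [hGv, hWv, mul_one]) f hWf κ hκ'
  rw [← hκ']
  refine hle.trans ?_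
  exact hC (wHess A u a) (A (jet u a)) (G a) _ _ _ _ _ _ f μ v κ τ Λ (jetDir u a) bA bG bDA bD2A
    bDB bD2B bDG bD2G hlow hdW hdG hWa.1 hGs
    (fun x => by
      by_cases hx : x = 0
      · simp [hx]
      · exact (hWa.2 x hx).le)
    hmax.self_of_nhds hGv hWv hWf hGf hmtw
    (fun ξ => by
      have : fderiv ℝ (fderiv ℝ u) a ξ = wHess A u a ξ + A (jet u a) ξ := by
        simp [wHess]
      rw [← this]; rfl)
    hκ' hτ hCΛ

end EvolutionEstimate

/-! ### Derivatives in space and time up to the initial time. -/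

section Time

variable {X Z : Type*} [NormedAddCommGroup X] [NormedSpace ℝ X]
  [NormedAddCommGroup Z] [NormedSpace ℝ Z] {h k : X × ℝ → Z} {U : Set X} {J : Set ℝ}

theorem fderiv_partial_eq (hU : IsOpen U)
    (hh : DifferentiableOn ℝ h (U ×ˢ J)) {a : X} {t : ℝ} (ha : a ∈ U) (ht : t ∈ J) :
    fderiv ℝ (fun x => h (x, t)) a =
      (fderivWithin ℝ h (U ×ˢ J) (a, t)).comp (ContinuousLinearMap.inl ℝ X ℝ) := by
  have h1 := (hh (a, t) ⟨ha, ht⟩).hasFDerivWithinAt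
  have h2 : HasFDerivWithinAt (fun x : X => (x, t)) (ContinuousLinearMap.inl ℝ X ℝ) U a :=
    (hasFDerivAt_prodMk_left a t).hasFDerivWithinAt
  have h3 : HasFDerivWithinAt (fun x => h (x, t)) _ U a :=
    h1.comp a h2 (fun x hx => (⟨hx, ht⟩ : (x, t) ∈ U ×ˢ J))
  exact (h3.hasFDerivAt (hU.mem_nhds ha)).fderiv

theorem hasDerivWithinAt_time (hh : DifferentiableOn ℝ h (U ×ˢ J)) {a : X} {t : ℝ} (ha : a ∈ U)
    (ht : t ∈ J) : HasDerivWithinAt (fun s => h (a, s))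
      (fderivWithin ℝ h (U ×ˢ J) (a, t) (0, 1)) J t := by
  have h1 := (hh (a, t) ⟨ha, ht⟩).hasFDerivWithinAt
  have h2 : HasDerivWithinAt (fun s : ℝ => (a, s)) ((0 : X), (1 : ℝ)) J t :=
    (hasDerivAt_const t a).prodMk (hasDerivAt_id t) |>.hasDerivWithinAt
  exact h1.comp_hasDerivWithinAt t h2 (fun s hs => (⟨ha, hs⟩ : (a, s) ∈ U ×ˢ J))

/-- The spatial derivative of a time slice is a component of the derivative within `U ×ˢ J`, which
remains smooth up to the boundary in time. -/
theorem contDiffOn_fderiv_partial (hU : IsOpen U) (hJ : UniqueDiffOn ℝ J)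
    (hh : ContDiffOn ℝ ∞ h (U ×ˢ J)) :
    ContDiffOn ℝ ∞ (fun q : X × ℝ => fderiv ℝ (fun x => h (x, q.2)) q.1) (U ×ˢ J) := by
  have h1 : ContDiffOn ℝ ∞ (fderivWithin ℝ h (U ×ˢ J)) (U ×ˢ J) :=
    hh.fderivWithin (hU.uniqueDiffOn.prod hJ) (by simp)
  refine (h1.clm_comp (contDiffOn_const (c := ContinuousLinearMap.inl ℝ X ℝ))).congr fun q hq => ?_
  exact fderiv_partial_eq hU (hh.differentiableOn (by simp)) hq.1 hq.2

/-- Applied to the flow equation, this yields smoothness of θ directly from that of `u`, without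
using its formula. -/
theorem contDiffOn_time_deriv (hU : IsOpen U) (hJ : UniqueDiffOn ℝ J)
    (hh : ContDiffOn ℝ ∞ h (U ×ˢ J))
    (hk : ∀ a ∈ U, ∀ t ∈ J, HasDerivWithinAt (fun s => h (a, s)) (k (a, t)) J t) :
    ContDiffOn ℝ ∞ k (U ×ˢ J) := by
  have h1 : ContDiffOn ℝ ∞ (fderivWithin ℝ h (U ×ˢ J)) (U ×ˢ J) :=
    hh.fderivWithin (hU.uniqueDiffOn.prod hJ) (by simp)
  refine (h1.clm_apply (contDiffOn_const (c := ((0 : X), (1 : ℝ))))).congr fun q hq => ?_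
  exact (hJ q.2 hq.2).eq_deriv _ (hk q.1 hq.1 q.2 hq.2)
    (hasDerivWithinAt_time (hh.differentiableOn (by simp)) hq.1 hq.2)

/-- Exchange of the derivatives in space and in time, up to the boundary in time. -/
theorem hasDerivWithinAt_fderiv_partial (hU : IsOpen U) (hJ : UniqueDiffOn ℝ J)
    (hJ' : J ⊆ closure (interior J)) (hh : ContDiffOn ℝ ∞ h (U ×ˢ J))
    (hk : ∀ a ∈ U, ∀ t ∈ J, HasDerivWithinAt (fun s => h (a, s)) (k (a, t)) J t)
    {a : X} {t : ℝ} (ha : a ∈ U) (ht : t ∈ J) :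
    HasDerivWithinAt (fun s => fderiv ℝ (fun x => h (x, s)) a)
      (fderiv ℝ (fun x => k (x, t)) a) J t := by
  have hUJ : UniqueDiffOn ℝ (U ×ˢ J) := hU.uniqueDiffOn.prod hJ
  have hd := hh.differentiableOn (by simp)
  have h1 : ContDiffOn ℝ ∞ (fderivWithin ℝ h (U ×ˢ J)) (U ×ˢ J) := hh.fderivWithin hUJ (by simp)
  have h1d := h1.differentiableOn (by simp)
  -- Symmetry of the second derivative within a set holds at points in the closure of its interior;
  -- `hJ'` makes this available at the endpoint of `J`.
  have hsym : IsSymmSndFDerivWithinAt ℝ h (U ×ˢ J) (a, t) := by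
    refine ContDiffWithinAt.isSymmSndFDerivWithinAt (n := ∞) (hh _ ⟨ha, ht⟩)
      (by simp only [minSmoothness_of_isRCLikeNormedField]; exact ENat.LEInfty.out) hUJ ?_ ⟨ha, ht⟩
    rw [interior_prod_eq, closure_prod_eq, hU.interior_eq]
    exact ⟨subset_closure ha, hJ' ht⟩
  have e1 := hasDerivWithinAt_time h1d ha ht
  have e2 : HasDerivWithinAt (fun s => (fderivWithin ℝ h (U ×ˢ J) (a, s)).comp
      (ContinuousLinearMap.inl ℝ X ℝ))
      ((fderivWithin ℝ (fderivWithin ℝ h (U ×ˢ J)) (U ×ˢ J) (a, t) (0, 1)).comp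
        (ContinuousLinearMap.inl ℝ X ℝ)) J t := by
    have := e1.clm_comp (hasDerivWithinAt_const t J (ContinuousLinearMap.inl ℝ X ℝ))
    simpa using this
  have e3 : (fderivWithin ℝ (fderivWithin ℝ h (U ×ˢ J)) (U ×ˢ J) (a, t) (0, 1)).comp
        (ContinuousLinearMap.inl ℝ X ℝ) = fderiv ℝ (fun x => k (x, t)) a := by
    have hkd : DifferentiableOn ℝ k (U ×ˢ J) :=
      (contDiffOn_time_deriv hU hJ hh hk).differentiableOn (by simp)
    rw [fderiv_partial_eq hU hkd ha ht]
    ext ξ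
    simp only [ContinuousLinearMap.comp_apply, ContinuousLinearMap.inl_apply]
    rw [hsym]
    have hc : EqOn k (fun q => fderivWithin ℝ h (U ×ˢ J) q (0, 1)) (U ×ˢ J) := fun q hq =>
      (hJ q.2 hq.2).eq_deriv _ (hk q.1 hq.1 q.2 hq.2) (hasDerivWithinAt_time hd hq.1 hq.2)
    rw [fderivWithin_congr hc (hc ⟨ha, ht⟩)]
    have := ((h1d _ ⟨ha, ht⟩).hasFDerivWithinAt.clm_apply
      (hasFDerivWithinAt_const ((0 : X), (1 : ℝ)) (a, t) (U ×ˢ J))).fderivWithin (hUJ _ ⟨ha, ht⟩)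
    rw [this]
    simp
  rw [e3] at e2
  exact e2.congr (fun s hs => fderiv_partial_eq hU hd ha hs) (fderiv_partial_eq hU hd ha ht)

end Time

/-! ### Change of preferred charts. -/

section Charts

variable {n : ℕ} {M : Type*} [TopologicalSpace M] [ChartedSpace (EuclideanSpace ℝ (Fin n)) M]

/-- The expression of a function in the preferred chart at `x₀`. -/
def loc {Z : Type*} (x₀ : M) (f : M → Z) (a : Eu n) : Z := f ((extChartAt (𝓡 n) x₀).symm a)

theorem contDiffAt_loc_of_contMDiff [IsManifold (𝓡 n) ∞ M] {x₀ : M} {f : M → ℝ}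
    (hf : ContMDiff (𝓡 n) 𝓘(ℝ, ℝ) ∞ f) {a : Eu n} (ha : a ∈ (extChartAt (𝓡 n) x₀).target) : ContDiffAt ℝ ∞ (loc x₀ f) a := by
  rw [← contMDiffAt_iff_contDiffAt]
  have h2 : ContMDiffAt 𝓘(ℝ, Eu n) (𝓡 n) ∞ (extChartAt (𝓡 n) x₀).symm a :=
    (contMDiffOn_extChartAt_symm x₀).contMDiffAt ((isOpen_extChartAt_target x₀).mem_nhds ha)
  exact hf.contMDiffAt.comp a h2

/-- The transition map from the preferred chart at `x` to the one at `x₀`. -/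
def trans (x₀ x : M) (a : Eu n) : Eu n :=
  extChartAt (𝓡 n) x₀ ((extChartAt (𝓡 n) x).symm a)

/-- The derivative of the transition map at `x`. -/
def tau (x₀ x : M) : Eu n →L[ℝ] Eu n := fderiv ℝ (trans x₀ x) (extChartAt (𝓡 n) x x)

/-- The derivative at `x` of the transition map from the chart at `x₀` to the one at `x`. -/
def tauInv (x₀ x : M) : Eu n →L[ℝ] Eu n := fderiv ℝ (trans x x₀) (extChartAt (𝓡 n) x₀ x)

variable {x₀ x : M}

theorem trans_self_apply (x₀ x : M) :
    trans x₀ x (extChartAt (𝓡 n) x x) = extChartAt (𝓡 n) x₀ x := by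
  simp [trans]

theorem trans_apply_of_mem (hx : x ∈ (extChartAt (𝓡 n) x₀).source) :
    trans x x₀ (extChartAt (𝓡 n) x₀ x) = extChartAt (𝓡 n) x x := by
  simp only [trans, (extChartAt (𝓡 n) x₀).left_inv hx]

theorem chart_symm_mem_nhds (x₀ : M) {a : Eu n} (ha : a ∈ (extChartAt (𝓡 n) x₀).target) {s : Set M}
    (hs : s ∈ 𝓝 ((extChartAt (𝓡 n) x₀).symm a)) :
    ∀ᶠ a' in 𝓝 a, (extChartAt (𝓡 n) x₀).symm a' ∈ s :=
  (continuousAt_extChartAt_symm'' (I := 𝓡 n) ha).eventually hs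

theorem loc_eventuallyEq {Z : Type*} (f : M → Z) (hx : x ∈ (extChartAt (𝓡 n) x₀).source) :
    loc x f =ᶠ[𝓝 (extChartAt (𝓡 n) x x)] fun a => loc x₀ f (trans x₀ x a) := by
  have := chart_symm_mem_nhds x (mem_extChartAt_target (I := 𝓡 n) x)
    (s := (extChartAt (𝓡 n) x₀).source)
    (by rw [extChartAt_to_inv]; exact (isOpen_extChartAt_source (I := 𝓡 n) x₀).mem_nhds hx)
  filter_upwards [this] with a ha
  simp only [loc, trans, (extChartAt (𝓡 n) x₀).left_inv ha]

/-- No regularity is needed: where `f` is not differentiable both sides take the default value zero.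
In the converse direction, differentiability in the chart gives the continuity that manifold
differentiability also asks for. -/
theorem covector_eq (f : M → ℝ) (x : M) :
    covector (n := n) f x = fderiv ℝ (loc x f) (extChartAt (𝓡 n) x x) := by
  have hw : writtenInExtChartAt (𝓡 n) 𝓘(ℝ, ℝ) x f = loc x f := by
    ext a; rfl
  by_cases h : MDifferentiableAt (𝓡 n) 𝓘(ℝ, ℝ) f x
  · refine h.mfderiv.trans ?_
    rw [hw, ModelWithCorners.range_eq_univ, fderivWithin_univ]
  · refine (mfderiv_zero_of_not_mdifferentiableAt h).trans ?_
    by_contra hne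
    apply h
    have hd : DifferentiableAt ℝ (loc x f) (extChartAt (𝓡 n) x x) := by
      by_contra hnd
      exact hne (fderiv_zero_of_not_differentiableAt hnd).symm
    rw [mdifferentiableAt_iff]
    refine ⟨?_, by rw [hw]; exact hd.differentiableWithinAt⟩
    have hc : ContinuousAt (fun y => loc x f (extChartAt (𝓡 n) x y)) x :=
      hd.continuousAt.comp (continuousAt_extChartAt (I := 𝓡 n) x)
    refine hc.congr ?_
    filter_upwards [extChartAt_source_mem_nhds (I := 𝓡 n) x] with y hy
    simp only [loc, (extChartAt (𝓡 n) x).left_inv hy]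

theorem tau_self (x : M) (V : Eu n) : tau x x V = V := by
  have h2 : trans x x =ᶠ[𝓝 (extChartAt (𝓡 n) x x)] id := by
    filter_upwards [extChartAt_target_mem_nhds (I := 𝓡 n) x] with a ha
    exact (extChartAt (𝓡 n) x).right_inv ha
  rw [tau, h2.fderiv_eq, fderiv_id]
  rfl

variable [IsManifold (𝓡 n) ∞ M]

theorem contDiffAt_trans {a : Eu n} (ha : a ∈ (extChartAt (𝓡 n) x).target)
    (hx : (extChartAt (𝓡 n) x).symm a ∈ (extChartAt (𝓡 n) x₀).source) :
    ContDiffAt ℝ ∞ (trans x₀ x) a := by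
  rw [← contMDiffAt_iff_contDiffAt]
  have h1 : ContMDiffAt (𝓡 n) 𝓘(ℝ, Eu n) ∞ (extChartAt (𝓡 n) x₀)
      ((extChartAt (𝓡 n) x).symm a) :=
    contMDiffAt_extChartAt' (by simpa using hx)
  have h2 : ContMDiffAt 𝓘(ℝ, Eu n) (𝓡 n) ∞ (extChartAt (𝓡 n) x).symm a :=
    (contMDiffOn_extChartAt_symm x).contMDiffAt ((isOpen_extChartAt_target x).mem_nhds ha)
  exact h1.comp a h2

theorem contDiffAt_trans_self (hx : x ∈ (extChartAt (𝓡 n) x₀).source) :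
    ContDiffAt ℝ ∞ (trans x₀ x) (extChartAt (𝓡 n) x x) :=
  contDiffAt_trans (mem_extChartAt_target x) (by rwa [extChartAt_to_inv])

theorem contDiffAt_trans_inv (hx : x ∈ (extChartAt (𝓡 n) x₀).source) :
    ContDiffAt ℝ ∞ (trans x x₀) (extChartAt (𝓡 n) x₀ x) :=
  contDiffAt_trans ((extChartAt (𝓡 n) x₀).map_source hx)
    (by rw [(extChartAt (𝓡 n) x₀).left_inv hx]; exact mem_extChartAt_source x)

theorem tauInv_tau (hx : x ∈ (extChartAt (𝓡 n) x₀).source) (V : Eu n) :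
    tauInv x₀ x (tau x₀ x V) = V := by
  have h1 := loc_eventuallyEq (fun y => extChartAt (𝓡 n) x y) hx
  have h2 : loc x (fun y => extChartAt (𝓡 n) x y) =ᶠ[𝓝 (extChartAt (𝓡 n) x x)] id := by
    filter_upwards [extChartAt_target_mem_nhds (I := 𝓡 n) x] with a ha
    exact (extChartAt (𝓡 n) x).right_inv ha
  have h3 := (h1.symm.trans h2).fderiv_eq (𝕜 := ℝ)
  have hd := (contDiffAt_trans_inv hx).differentiableAt (by simp)
  rw [← trans_self_apply x₀ x] at hd
  have h4 : fderiv ℝ (fun a => trans x x₀ (trans x₀ x a)) (extChartAt (𝓡 n) x x) =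
      (tauInv x₀ x).comp (tau x₀ x) := by
    have := fderiv_comp (extChartAt (𝓡 n) x x) hd
      ((contDiffAt_trans_self hx).differentiableAt (by simp))
    rw [trans_self_apply] at this
    exact this
  have h5 : fderiv ℝ (fun a => trans x x₀ (trans x₀ x a)) (extChartAt (𝓡 n) x x) =
    ContinuousLinearMap.id ℝ (Eu n) := h3.trans fderiv_id
  rw [h4] at h5
  exact congrArg (fun L => L V) h5

theorem tau_tauInv (hx : x ∈ (extChartAt (𝓡 n) x₀).source) (V : Eu n) :
    tau x₀ x (tauInv x₀ x V) = V := by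
  have h : Function.LeftInverse (tauInv x₀ x) (tau x₀ x) := tauInv_tau hx
  have hinj : Function.Injective (tau x₀ x).toLinearMap := h.injective
  obtain ⟨V', rfl⟩ := LinearMap.injective_iff_surjective.1 hinj V
  exact congrArg (tau x₀ x) (h V')

theorem tau_ne_zero (hx : x ∈ (extChartAt (𝓡 n) x₀).source) {V : Eu n} (hV : V ≠ 0) :
    tau x₀ x V ≠ 0 := fun h => hV (by rw [← tauInv_tau hx V, h, map_zero])

theorem tauInv_ne_zero (hx : x ∈ (extChartAt (𝓡 n) x₀).source) {V : Eu n} (hV : V ≠ 0) :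
    tauInv x₀ x V ≠ 0 := fun h => hV (by rw [← tau_tauInv hx V, h, map_zero])

/-- The differential of a function in a fixed chart. -/
theorem covector_apply {f : M → ℝ} (hx : x ∈ (extChartAt (𝓡 n) x₀).source)
    (hf : DifferentiableAt ℝ (loc x₀ f) (extChartAt (𝓡 n) x₀ x)) (V : Eu n) :
    covector f x V = fderiv ℝ (loc x₀ f) (extChartAt (𝓡 n) x₀ x) (tau x₀ x V) := by
  rw [covector_eq, (loc_eventuallyEq f hx).fderiv_eq]
  rw [← trans_self_apply x₀ x] at hf
  have := fderiv_comp (extChartAt (𝓡 n) x x) hf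
    ((contDiffAt_trans_self hx).differentiableAt (by simp))
  rw [trans_self_apply] at this
  exact congrArg (fun L => L V) this

theorem contDiffAt_loc {Z : Type*} [NormedAddCommGroup Z] [NormedSpace ℝ Z] {f : M → Z} {k : ℕ∞ω}
    (hk : k ≤ ∞) (hx : x ∈ (extChartAt (𝓡 n) x₀).source)
    (hf : ContDiffAt ℝ k (loc x₀ f) (extChartAt (𝓡 n) x₀ x)) :
    ContDiffAt ℝ k (loc x f) (extChartAt (𝓡 n) x x) := by
  refine ContDiffAt.congr_of_eventuallyEq ?_ (loc_eventuallyEq f hx)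
  rw [← trans_self_apply x₀ x] at hf
  exact hf.comp _ ((contDiffAt_trans_self hx).of_le hk)

/-- The coordinate Hessian of a function in a fixed chart. -/
theorem hessAt_eq {f : M → ℝ} (hx : x ∈ (extChartAt (𝓡 n) x₀).source)
    (hf : ContDiffAt ℝ 2 (loc x₀ f) (extChartAt (𝓡 n) x₀ x)) (V W : Eu n) :
    hessAt f x V W =
      fderiv ℝ (fderiv ℝ (loc x₀ f)) (extChartAt (𝓡 n) x₀ x) (tau x₀ x V) (tau x₀ x W) +
      fderiv ℝ (loc x₀ f) (extChartAt (𝓡 n) x₀ x)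
        (fderiv ℝ (fderiv ℝ (trans x₀ x)) (extChartAt (𝓡 n) x x) V W) := by
  have hf' := contDiffAt_loc ENat.LEInfty.out hx hf
  have h1 : hessAt f x V W = fderiv ℝ (fderiv ℝ (loc x f)) (extChartAt (𝓡 n) x x) V W := by
    rw [fderiv_fderiv_symm hf']
    exact fderiv_clm_apply_const
      ((hf'.fderiv_right (m := 1) (by norm_num)).differentiableAt (by simp)) W V
  rw [h1, (loc_eventuallyEq f hx).fderiv.fderiv_eq]
  rw [← trans_self_apply x₀ x] at hf
  have := fderiv_fderiv_comp hf ((contDiffAt_trans_self hx).of_le ENat.LEInfty.out) V W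
  rw [trans_self_apply] at this
  exact this

end Charts

/-! ### The local correspondence between target points and covectors. -/

section Legendre

variable {n : ℕ}

/-- The partial differential of `F` in the first variable. -/
def dX (F : Eu n × Eu n → ℝ) (q : Eu n × Eu n) : Eu n →L[ℝ] ℝ :=
  (fderiv ℝ F q).comp (ContinuousLinearMap.inl ℝ (Eu n) (Eu n))

/-- The mixed second differential `W ↦ V ↦ D_b D_a F (W)(V)`. -/
def mixedForm (F : Eu n × Eu n → ℝ) (q : Eu n × Eu n) : Eu n →L[ℝ] Eu n →L[ℝ] ℝ :=
  (fderiv ℝ (dX F) q).comp (ContinuousLinearMap.inr ℝ (Eu n) (Eu n))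

/-- The matrix of the mixed second differential. -/
def mixedMat (F : Eu n × Eu n → ℝ) (q : Eu n × Eu n) : Matrix (Fin n) (Fin n) ℝ :=
  Matrix.of fun i s => mixedForm F q (coordVec s) (coordVec i)

/-- Minus the second differential of `F` in the first variable. -/
def negHessX (F : Eu n × Eu n → ℝ) (q : Eu n × Eu n) : Eu n →L[ℝ] Eu n →L[ℝ] ℝ :=
  -(fderiv ℝ (dX F) q).comp (ContinuousLinearMap.inl ℝ (Eu n) (Eu n))

/-- The map `(a, b) ↦ (a, -D_a F(a, b))`. -/
def legendre (F : Eu n × Eu n → ℝ) (q : Eu n × Eu n) : Eu n × (Eu n →L[ℝ] ℝ) := (q.1, -dX F q)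

variable {F : Eu n × Eu n → ℝ} {q : Eu n × Eu n}

theorem dX_eq (hF : DifferentiableAt ℝ F q) :
    dX F q = fderiv ℝ (fun a => F (a, q.2)) q.1 := by
  have h : HasFDerivAt (fun a => F (a, q.2)) (dX F q) q.1 :=
    (show HasFDerivAt F (fderiv ℝ F q) (q.1, q.2) from hF.hasFDerivAt).comp q.1
      (hasFDerivAt_prodMk_left q.1 q.2)
  exact h.fderiv.symm

theorem contDiffAt_dX (hF : ContDiffAt ℝ ∞ F q) : ContDiffAt ℝ ∞ (dX F) q :=
  (hF.fderiv_right (m := ∞) (by simp)).clm_comp contDiffAt_const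

theorem contDiffAt_mixedForm (hF : ContDiffAt ℝ ∞ F q) : ContDiffAt ℝ ∞ (mixedForm F) q :=
  ((contDiffAt_dX hF).fderiv_right (m := ∞) (by simp)).clm_comp contDiffAt_const

theorem contDiffAt_negHessX (hF : ContDiffAt ℝ ∞ F q) : ContDiffAt ℝ ∞ (negHessX F) q :=
  (((contDiffAt_dX hF).fderiv_right (m := ∞) (by simp)).clm_comp contDiffAt_const).neg

theorem contDiffAt_det {Y : Type*} [NormedAddCommGroup Y] [NormedSpace ℝ Y] {k : ℕ∞ω}
    {f : Y → Matrix (Fin n) (Fin n) ℝ} {y : Y} (hf : ∀ i j, ContDiffAt ℝ k (fun y => f y i j) y) :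
    ContDiffAt ℝ k (fun y => (f y).det) y := by
  simp only [Matrix.det_apply']
  exact ContDiffAt.sum fun σ _ => contDiffAt_const.mul (contDiffAt_prod fun i _ => hf _ _)

theorem contDiffAt_det_mixedMat (hF : ContDiffAt ℝ ∞ F q) :
    ContDiffAt ℝ ∞ (fun q => (mixedMat F q).det) q :=
  contDiffAt_det fun i s => by
    have := contDiffAt_mixedForm hF
    simp only [mixedMat, Matrix.of_apply]
    exact (this.clm_apply contDiffAt_const).clm_apply contDiffAt_const

theorem contDiffAt_legendre (hF : ContDiffAt ℝ ∞ F q) : ContDiffAt ℝ ∞ (legendre F) q :=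
  contDiffAt_fst.prodMk (contDiffAt_dX hF).neg

theorem fderiv_dX_apply (ξ ζ : Eu n) :
    fderiv ℝ (dX F) q (ξ, ζ) = -negHessX F q ξ + mixedForm F q ζ := by
  have : (ξ, ζ) = ContinuousLinearMap.inl ℝ (Eu n) (Eu n) ξ +
    ContinuousLinearMap.inr ℝ (Eu n) (Eu n) ζ := by simp
  rw [this, map_add]
  simp [negHessX, mixedForm]

theorem mixedForm_apply (W V : Eu n) :
    mixedForm F q W V = ∑ i, ∑ s, V i * mixedMat F q i s * W s := by
  conv_lhs => rw [← sum_coordVec W, ← sum_coordVec V, bilin_sum_sum]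
  rw [Finset.sum_comm]
  refine Finset.sum_congr rfl fun x _ => Finset.sum_congr rfl fun y _ => ?_
  simp only [mixedMat, Matrix.of_apply]; ring

theorem mixedForm_coordVec (W : Eu n) (i : Fin n) :
    mixedForm F q W (coordVec i) = (mixedMat F q).mulVec W.ofLp i := by
  conv_lhs => rw [← sum_coordVec W, map_sum, _root_.sum_apply]
  simp [Matrix.mulVec, dotProduct, mixedMat, mul_comm]

theorem mixedForm_injective (hdet : (mixedMat F q).det ≠ 0) :
    Function.Injective (mixedForm F q) := by
  rw [injective_iff_map_eq_zero]
  intro W hW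
  have h : (mixedMat F q).mulVec W.ofLp = 0 := by
    ext i
    rw [← mixedForm_coordVec, hW]; rfl
  have := Matrix.eq_zero_of_mulVec_eq_zero hdet h
  ext i
  exact congrFun this i

theorem finrank_dual_eq : Module.finrank ℝ (Eu n →L[ℝ] ℝ) = Module.finrank ℝ (Eu n) := by
  rw [← (LinearMap.toContinuousLinearMap (𝕜 := ℝ) (E := Eu n) (F' := ℝ)).finrank_eq]
  exact Subspace.dual_finrank_eq

/-- The derivative is block triangular with diagonal blocks the identity and minus the mixed second
differential, so it is injective, hence bijective by dimension. -/
theorem exists_hasFDerivAt_legendre (hF : ContDiffAt ℝ ∞ F q) (hdet : (mixedMat F q).det ≠ 0) :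
    ∃ L : (Eu n × Eu n) ≃L[ℝ] (Eu n × (Eu n →L[ℝ] ℝ)),
      HasFDerivAt (legendre F) (L : (Eu n × Eu n) →L[ℝ] (Eu n × (Eu n →L[ℝ] ℝ))) q := by
  have h1 : HasFDerivAt (legendre F)
      ((ContinuousLinearMap.fst ℝ (Eu n) (Eu n)).prod (-fderiv ℝ (dX F) q)) q :=
    hasFDerivAt_fst.prodMk ((contDiffAt_dX hF).differentiableAt (by simp)).hasFDerivAt.neg
  set D := (ContinuousLinearMap.fst ℝ (Eu n) (Eu n)).prod (-fderiv ℝ (dX F) q)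
  have hinj : Function.Injective D.toLinearMap := by
    rw [injective_iff_map_eq_zero]
    rintro ⟨ξ, ζ⟩ h
    have h2 : ξ = 0 := congrArg Prod.fst h
    have h3 : -fderiv ℝ (dX F) q (ξ, ζ) = 0 := congrArg Prod.snd h
    rw [fderiv_dX_apply, h2, map_zero, neg_zero, zero_add, neg_eq_zero] at h3
    rw [h2, mixedForm_injective hdet (h3.trans (map_zero _).symm)]
    rfl
  have hdim : Module.finrank ℝ (Eu n × Eu n) = Module.finrank ℝ (Eu n × (Eu n →L[ℝ] ℝ)) := by
    rw [Module.finrank_prod, Module.finrank_prod, finrank_dual_eq]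
  refine ⟨(LinearEquiv.ofInjectiveOfFinrankEq D.toLinearMap hinj hdim).toContinuousLinearEquiv, ?_⟩
  convert h1
  ext x <;> rfl

/-- `e` is a local inverse situation for `legendre F`, on a set where `F` is smooth and
nondegenerate. -/
structure IsLegendreChart (F : Eu n × Eu n → ℝ)
    (e : OpenPartialHomeomorph (Eu n × Eu n) (Eu n × (Eu n →L[ℝ] ℝ))) : Prop where
  apply : ∀ q, e q = legendre F q
  smooth : ∀ q ∈ e.source, ContDiffAt ℝ ∞ F q
  det_ne : ∀ q ∈ e.source, (mixedMat F q).det ≠ 0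

theorem exists_legendreChart {O : Set (Eu n × Eu n)} (hO : IsOpen O)
    (hF : ∀ q ∈ O, ContDiffAt ℝ ∞ F q) (hq : q ∈ O) (hdet : (mixedMat F q).det ≠ 0) :
    ∃ e : OpenPartialHomeomorph (Eu n × Eu n) (Eu n × (Eu n →L[ℝ] ℝ)),
      IsLegendreChart F e ∧ q ∈ e.source ∧ e.source ⊆ O := by
  obtain ⟨L, hL⟩ := exists_hasFDerivAt_legendre (hF q hq) hdet
  have hleg := contDiffAt_legendre (hF q hq)
  let e₀ := hleg.toOpenPartialHomeomorph _ hL (by simp)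
  -- The inverse function theorem gives a chart around one point only; restricting it to the open
  -- nondegeneracy set makes the inverse smooth on the whole target.
  have hO' : IsOpen (O ∩ (fun q => (mixedMat F q).det) ⁻¹' {0}ᶜ) := by
    refine ContinuousOn.isOpen_inter_preimage (fun q hq => ?_) hO isOpen_compl_singleton
    exact (contDiffAt_det_mixedMat (hF q hq)).continuousAt.continuousWithinAt
  refine ⟨e₀.restrOpen _ hO', ⟨fun q => rfl, fun q hq => hF q hq.2.1, fun q hq => hq.2.2⟩,
    ⟨ContDiffAt.mem_toOpenPartialHomeomorph_source hleg hL (by simp), hq, hdet⟩,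
    fun q hq => hq.2.1⟩

namespace IsLegendreChart

variable {e : OpenPartialHomeomorph (Eu n × Eu n) (Eu n × (Eu n →L[ℝ] ℝ))}

theorem symm_fst (h : IsLegendreChart F e) {p : Eu n × (Eu n →L[ℝ] ℝ)} (hp : p ∈ e.target) :
    (e.symm p).1 = p.1 := by
  have := congrArg Prod.fst (e.right_inv hp)
  rwa [h.apply] at this

theorem symm_eq (h : IsLegendreChart F e) {p : Eu n × (Eu n →L[ℝ] ℝ)} (hp : p ∈ e.target) :
    e.symm p = (p.1, (e.symm p).2) := Prod.ext (h.symm_fst hp) rfl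

theorem dX_symm (h : IsLegendreChart F e) {p : Eu n × (Eu n →L[ℝ] ℝ)} (hp : p ∈ e.target) :
    -dX F (e.symm p) = p.2 := by
  have := congrArg Prod.snd (e.right_inv hp)
  rwa [h.apply] at this

theorem contDiffAt_symm (h : IsLegendreChart F e) {p : Eu n × (Eu n →L[ℝ] ℝ)}
    (hp : p ∈ e.target) : ContDiffAt ℝ ∞ e.symm p := by
  have hs := e.map_target hp
  obtain ⟨L, hL⟩ := exists_hasFDerivAt_legendre (h.smooth _ hs) (h.det_ne _ hs)
  have he : (e : Eu n × Eu n → _) = legendre F := funext h.apply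
  exact e.contDiffAt_symm hp (by rw [he]; exact hL) (by rw [he]; exact contDiffAt_legendre (h.smooth _ hs))

theorem contDiffAt_comp_symm (h : IsLegendreChart F e) {Z : Type*} [NormedAddCommGroup Z]
    [NormedSpace ℝ Z] {f : Eu n × Eu n → Z} {p : Eu n × (Eu n →L[ℝ] ℝ)}
    (hp : p ∈ e.target) (hf : ContDiffAt ℝ ∞ f (e.symm p)) :
    ContDiffAt ℝ ∞ (fun p => f (e.symm p)) p := hf.comp p (h.contDiffAt_symm hp)

end IsLegendreChart

end Legendre

section Slices

variable {n : ℕ} {F : Eu n × Eu n → ℝ} {q : Eu n × Eu n}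

theorem contDiffAt_slice {k : ℕ∞ω} (hF : ContDiffAt ℝ k F q) :
    ContDiffAt ℝ k (fun a => F (a, q.2)) q.1 :=
  ContDiffAt.comp q.1 (show ContDiffAt ℝ k F (q.1, q.2) from hF)
    (contDiffAt_id.prodMk contDiffAt_const)

theorem eventually_slice_fst {P : Eu n × Eu n → Prop} (h : ∀ᶠ q' in 𝓝 q, P q') :
    ∀ᶠ a in 𝓝 q.1, P (a, q.2) :=
  (show ContinuousAt (fun a : Eu n => (a, q.2)) q.1 by fun_prop).eventually h

theorem fderiv_fderiv_slice (hF : ContDiffAt ℝ 2 F q) :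
    fderiv ℝ (fderiv ℝ (fun a => F (a, q.2))) q.1 = -negHessX F q := by
  have h1 : fderiv ℝ (fun a => F (a, q.2)) =ᶠ[𝓝 q.1] fun a => dX F (a, q.2) := by
    have := (hF.of_le (m := 1) (by norm_num)).eventually (by simp)
    filter_upwards [eventually_slice_fst this] with a ha
    exact (dX_eq (ha.differentiableAt (by simp))).symm
  have hd : DifferentiableAt ℝ (dX F) (q.1, q.2) := 
    ((hF.fderiv_right (m := 1) (by norm_num)).clm_comp contDiffAt_const).differentiableAt (by simp)
  have h2 : HasFDerivAt (fun a => dX F (a, q.2)) _ q.1 :=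
    hd.hasFDerivAt.comp (f := fun a : Eu n => (a, q.2)) q.1 (hasFDerivAt_prodMk_left q.1 q.2)
  rw [h1.fderiv_eq, h2.fderiv, negHessX, neg_neg]

end Slices

/-! ### The Ma-Trudinger-Wang tensor along a segment of covectors. -/

section MTW

variable {n : ℕ}

theorem fderiv_affine {X : Type*} [NormedAddCommGroup X] [NormedSpace ℝ X] (p η : X) (r : ℝ) :
    fderiv ℝ (fun r : ℝ => p - r • η) r = ContinuousLinearMap.toSpanSingleton ℝ (-η) := by
  have h : HasDerivAt (fun r : ℝ => p - r • η) (-η) r := by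
    simpa using ((hasDerivAt_id r).smul_const η).const_sub p
  exact h.hasFDerivAt.fderiv

theorem fderiv_affine_one {X : Type*} [NormedAddCommGroup X] [NormedSpace ℝ X] (p η : X) (r : ℝ) :
    fderiv ℝ (fun r : ℝ => p - r • η) r 1 = -η := by
  rw [fderiv_affine, ContinuousLinearMap.toSpanSingleton_apply, one_smul]

theorem fderiv_fderiv_affine {X : Type*} [NormedAddCommGroup X] [NormedSpace ℝ X]
    (p η : X) : fderiv ℝ (fderiv ℝ (fun r : ℝ => p - r • η)) 0 1 1 = 0 := by
  have : fderiv ℝ (fun r : ℝ => p - r • η) =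
      fun _ => ContinuousLinearMap.toSpanSingleton ℝ (-η) := funext (fderiv_affine p η)
  rw [this]; simp

/-- Second derivative of `S` along a curve on which `Q` is affine. -/
theorem fderiv_fderiv_along_segment {S : Eu n → ℝ} {Q : Eu n → Eu n →L[ℝ] ℝ} {b : ℝ → Eu n}
    {p₀ η : Eu n →L[ℝ] ℝ} (hS : ContDiffAt ℝ 2 S (b 0)) (hQ : ContDiffAt ℝ 2 Q (b 0))
    (hb : ContDiffAt ℝ 2 b 0) (hQb : ∀ᶠ r in 𝓝 (0 : ℝ), Q (b r) = p₀ - r • η)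
    {m : Matrix (Fin n) (Fin n) ℝ} (hm : ∀ i s, m i s = fderiv ℝ Q (b 0) (coordVec s) (coordVec i))
    (hdet : m.det ≠ 0) {W : Eu n}
    (hW : W = ∑ p, ∑ k, (m⁻¹ p k * η (coordVec k)) • coordVec p) :
    fderiv ℝ (fderiv ℝ (fun r => S (b r))) 0 1 1 =
      fderiv ℝ (fderiv ℝ S) (b 0) W W -
      ∑ s, ∑ k, fderiv ℝ S (b 0) (coordVec s) * m⁻¹ s k *
        fderiv ℝ (fderiv ℝ Q) (b 0) W W (coordVec k) := by
  have hmul : m⁻¹ * m = 1 := Matrix.nonsing_inv_mul m (isUnit_iff_ne_zero.2 hdet)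
  -- The derivative of `Q` is inverted by the matrix m⁻¹; this is used for both the velocity and the
  -- acceleration of `b`.
  have key : ∀ (X : Eu n) (ζ : Eu n →L[ℝ] ℝ), fderiv ℝ Q (b 0) X = ζ →
      X = ∑ p, ∑ k, (m⁻¹ p k * ζ (coordVec k)) • coordVec p := by
    intro X ζ h
    have h1 : ∀ k, ζ (coordVec k) = ∑ s, m k s * X s := by
      intro k
      rw [← h]
      conv_lhs => rw [← sum_coordVec X, map_sum, _root_.sum_apply]
      refine Finset.sum_congr rfl fun s _ => ?_
      rw [map_smul, _root_.smul_apply, hm, smul_eq_mul, mul_comm]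
    have h2 : ∀ p, ∑ k, m⁻¹ p k * ζ (coordVec k) = X p := by
      intro p
      have h3 : (m⁻¹.mulVec (m.mulVec X.ofLp)) p = X p := by
        rw [Matrix.mulVec_mulVec, hmul, Matrix.one_mulVec]
      rw [← h3]
      simp only [Matrix.mulVec, dotProduct, h1]
    conv_lhs => rw [← sum_coordVec X]
    refine Finset.sum_congr rfl fun p _ => ?_
    rw [← h2 p, Finset.sum_smul]
  have hQd : DifferentiableAt ℝ Q (b 0) := hQ.differentiableAt (by simp)
  have hbd : DifferentiableAt ℝ b 0 := hb.differentiableAt (by simp)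
  have hev : (fun r => Q (b r)) =ᶠ[𝓝 0] fun r : ℝ => p₀ - r • η := hQb
  have h1 : fderiv ℝ Q (b 0) (fderiv ℝ b 0 1) = -η := by
    have h : HasFDerivAt (fun r => Q (b r)) _ 0 := hQd.hasFDerivAt.comp 0 hbd.hasFDerivAt
    have h' : fderiv ℝ (fun r => Q (b r)) 0 1 = -η := by
      rw [hev.fderiv_eq (𝕜 := ℝ)]
      exact fderiv_affine_one p₀ η 0
    rw [h.fderiv] at h'
    exact h'
  have hb1 : fderiv ℝ b 0 1 = -W := by
    rw [key _ _ h1, hW]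
    simp
  have h2 := fderiv_fderiv_comp hQ hb 1 1
  -- `Q` is affine along `b`, so the acceleration of `b` compensates D²Q(W, W). This is the origin
  -- of the second term of the tensor.
  have h0 : fderiv ℝ (fderiv ℝ (fun r => Q (b r))) 0 1 1 = 0 := by
    rw [hev.fderiv.fderiv_eq]
    exact fderiv_fderiv_affine p₀ η
  rw [h0, hb1] at h2
  simp only [map_neg, _root_.neg_apply, neg_neg] at h2
  have h3 : fderiv ℝ Q (b 0) (fderiv ℝ (fderiv ℝ b) 0 1 1) = -fderiv ℝ (fderiv ℝ Q) (b 0) W W :=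
    eq_neg_of_add_eq_zero_right h2.symm
  have hb2 := key _ _ h3
  rw [fderiv_fderiv_comp hS hb 1 1, hb1]
  simp only [map_neg, _root_.neg_apply, neg_neg]
  conv_lhs => rw [hb2]
  simp only [map_sum, map_smul, smul_eq_mul, _root_.neg_apply, sub_eq_add_neg]
  congr 1
  rw [← Finset.sum_neg_distrib]
  refine Finset.sum_congr rfl fun s _ => ?_
  rw [← Finset.sum_neg_distrib]
  refine Finset.sum_congr rfl fun k _ => by ring

end MTW

section CostCharts

variable {n : ℕ} {M N : Type*}
  [TopologicalSpace M] [ChartedSpace (EuclideanSpace ℝ (Fin n)) M]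
  [TopologicalSpace N] [ChartedSpace (EuclideanSpace ℝ (Fin n)) N]
  {c : M × N → WithTop ℝ} {x₀ x : M} {y₀ y : N}

/-- The cost in the preferred charts at two points, as a function on the product. -/
def costF (c : M × N → WithTop ℝ) (x₀ : M) (y₀ : N) (q : Eu n × Eu n) : ℝ :=
  costLoc c x₀ y₀ q.1 q.2

/-- The coordinates of a pair of points. -/
def pairCoord (x₀ x : M) (y₀ y : N) : Eu n × Eu n :=
  (extChartAt (𝓡 n) x₀ x, extChartAt (𝓡 n) y₀ y)

/-- `mtw` as a second derivative along a curve on which `D_x c` is affine. -/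
theorem mtw_eq {b : ℝ → Eu n} {p₀ η : Eu n →L[ℝ] ℝ} {V : Eu n}
    (hF : ContDiffAt ℝ ∞ (costF (n := n) c x y) (pairCoord x x y y))
    (hdet : (mixedHess (n := n) c x y).det ≠ 0) (hb : ContDiffAt ℝ 2 b 0)
    (hb0 : b 0 = extChartAt (𝓡 n) y y)
    (hQb : ∀ᶠ r in 𝓝 (0 : ℝ),
      fderiv ℝ (fun a => costLoc c x y a (b r)) (extChartAt (𝓡 n) x x) = p₀ - r • η) :
    mtw c x y V η = -fderiv ℝ (fderiv ℝ (fun r => fderiv ℝ (fun a =>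
      fderiv ℝ (fun a' => costLoc c x y a' (b r)) a V) (extChartAt (𝓡 n) x x) V)) 0 1 1 := by
  set a₀ := extChartAt (𝓡 n) x x
  set b₀ := extChartAt (𝓡 n) y y
  set Q : Eu n → Eu n →L[ℝ] ℝ := fun b => fderiv ℝ (fun a => costLoc c x y a b) a₀ with hQ
  set S : Eu n → ℝ := fun b => fderiv ℝ (fun a =>
    fderiv ℝ (fun a' => costLoc c x y a' b) a V) a₀ V with hS
  have hcont : ContinuousAt (fun b : Eu n => (a₀, b)) b₀ := by fun_prop
  have hev : ∀ᶠ b in 𝓝 b₀, ContDiffAt ℝ 3 (costF (n := n) c x y) (a₀, b) :=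
    hcont.eventually ((hF.of_le (m := 3) ENat.LEInfty.out).eventually (by simp))
  have hQ' : Q =ᶠ[𝓝 b₀] fun b => dX (costF (n := n) c x y) (a₀, b) := by
    filter_upwards [hev] with b hb
    exact (dX_eq (hb.differentiableAt (by simp))).symm
  have hS' : S =ᶠ[𝓝 b₀] fun b => -negHessX (costF (n := n) c x y) (a₀, b) V V := by
    filter_upwards [hev] with b hb
    have h2 := contDiffAt_slice (hb.of_le (m := 2) (by norm_num))
    have h := fderiv_clm_apply_const
      ((h2.fderiv_right (m := 1) (by norm_num)).differentiableAt (by simp)) V V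
    have h' := fderiv_fderiv_slice (hb.of_le (m := 2) (by norm_num))
    exact h.trans (congrArg (fun L => L V V) h')
  have hpair : ContDiffAt ℝ ∞ (fun b : Eu n => (a₀, b)) b₀ := contDiffAt_const.prodMk contDiffAt_id
  have hQc : ContDiffAt ℝ 2 Q b₀ :=
    (((contDiffAt_dX hF).comp b₀ hpair).of_le ENat.LEInfty.out).congr_of_eventuallyEq hQ'
  have hSc : ContDiffAt ℝ 2 S b₀ := by
    refine (ContDiffAt.of_le (n := ∞) ?_ ENat.LEInfty.out).congr_of_eventuallyEq hS'
    exact ((((contDiffAt_negHessX hF).comp b₀ hpair).clm_apply contDiffAt_const).clm_apply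
      contDiffAt_const).neg
  have hQd : DifferentiableAt ℝ Q b₀ := hQc.differentiableAt (by simp)
  have hpd2 : ∀ (R : Eu n → ℝ) (W : Eu n), ContDiffAt ℝ 2 R b₀ →
      fderiv ℝ (fun b => fderiv ℝ R b W) b₀ W = fderiv ℝ (fderiv ℝ R) b₀ W W := fun R W hR =>
    fderiv_clm_apply_const ((hR.fderiv_right (m := 1) (by norm_num)).differentiableAt (by simp)) W W
  have hm : ∀ i s, mixedHess (n := n) c x y i s = fderiv ℝ Q b₀ (coordVec s) (coordVec i) :=
    fun i s => fderiv_clm_apply_const hQd (coordVec s) (coordVec i)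
  have hseg := fderiv_fderiv_along_segment (S := S) (Q := Q) (b := b) (p₀ := p₀) (η := η)
    (by rwa [hb0]) (by rwa [hb0]) hb hQb (m := mixedHess (n := n) c x y)
    (by rw [hb0]; exact hm) hdet (W := sharp c x y η) rfl
  rw [hseg, hb0, neg_sub]
  have e1 : ∀ k, atPt x y (pd2 (sharp (n := n) c x y η) (pd2 (sharp c x y η)
      (pd1 (coordVec k) (costLoc c x y)))) =
      fderiv ℝ (fderiv ℝ Q) b₀ (sharp c x y η) (sharp c x y η) (coordVec k) := by
    intro k
    have h1 : ContDiffAt ℝ 2 (fun b => Q b (coordVec k)) b₀ := hQc.clm_apply contDiffAt_const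
    refine (hpd2 _ _ h1).trans ?_
    exact fderiv_fderiv_clm_comp (ContinuousLinearMap.apply ℝ ℝ (coordVec k)) hQc _ _
  have e2 : atPt x y (pd2 (sharp (n := n) c x y η) (pd2 (sharp c x y η)
      (pd1 V (pd1 V (costLoc c x y))))) =
      fderiv ℝ (fderiv ℝ S) b₀ (sharp c x y η) (sharp c x y η) := hpd2 _ _ hSc
  simp only [mtw]
  rw [e2]
  congr 1
  refine Finset.sum_congr rfl fun s _ => Finset.sum_congr rfl fun k _ => ?_
  rw [e1]
  rfl

end CostCharts

/-! ### Tensoriality of the mixed derivative and charts for the cost. -/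

section Product

variable {n : ℕ} {F F' : Eu n × Eu n → ℝ} {q : Eu n × Eu n} {φ ψ : Eu n → Eu n}

/-- The derivative in the first variable brings out Dφ, which does not depend on the second
variable; no second derivative of the coordinate changes can arise. -/
theorem mixedForm_comp (hF : ContDiffAt ℝ ∞ F (φ q.1, ψ q.2)) (hφ : ContDiffAt ℝ ∞ φ q.1)
    (hψ : ContDiffAt ℝ ∞ ψ q.2) (hF' : F' =ᶠ[𝓝 q] fun q => F (φ q.1, ψ q.2)) (W V : Eu n) :
    mixedForm F' q W V =
      mixedForm F (φ q.1, ψ q.2) (fderiv ℝ ψ q.2 W) (fderiv ℝ φ q.1 V) := by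
  have hg : ContDiffAt ℝ ∞ (fun q : Eu n × Eu n => (φ q.1, ψ q.2)) q :=
    (ContDiffAt.comp q hφ contDiffAt_fst).prodMk (ContDiffAt.comp q hψ contDiffAt_snd)
  have hF'c : ContDiffAt ℝ ∞ F' q := (hF.comp q hg).congr_of_eventuallyEq hF'
  have hcont : ContinuousAt (fun b : Eu n => (q.1, b)) q.2 := by fun_prop
  have hcont2 : ContinuousAt (fun b : Eu n => (φ q.1, ψ b)) q.2 :=
    continuousAt_const.prodMk hψ.continuousAt
  have hψd := (hψ.differentiableAt (by simp)).hasFDerivAt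
  have key : (fun b => dX F' (q.1, b)) =ᶠ[𝓝 q.2]
      fun b => (dX F (φ q.1, ψ b)).comp (fderiv ℝ φ q.1) := by
    have hd : ∀ᶠ q' in 𝓝 q, DifferentiableAt ℝ F' q' :=
      ((hF'c.of_le (m := 1) ENat.LEInfty.out).eventually (by simp)).mono
        fun _ h => h.differentiableAt (by simp)
    have hd2 : ∀ᶠ q' in 𝓝 (φ q.1, ψ q.2), DifferentiableAt ℝ F q' :=
      ((hF.of_le (m := 1) ENat.LEInfty.out).eventually (by simp)).mono
        fun _ h => h.differentiableAt (by simp)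
    filter_upwards [hcont.eventually hF'.eventuallyEq_nhds, hcont.eventually hd,
      hcont2.eventually hd2] with b h1 h2 h3
    have h4 : (fun a => F' (a, b)) =ᶠ[𝓝 q.1] fun a => F (φ a, ψ b) :=
      (show ContinuousAt (fun a : Eu n => (a, b)) q.1 by fun_prop).eventually h1
    rw [dX_eq h2, dX_eq h3]
    refine h4.fderiv_eq.trans ?_
    exact fderiv_comp (g := fun a => F (a, ψ b)) q.1
      (h3.comp (f := fun a : Eu n => (a, ψ b)) (φ q.1)
        (hasFDerivAt_prodMk_left _ _).differentiableAt) (hφ.differentiableAt (by simp))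
  have hd1 : HasFDerivAt (fun b => dX F' (q.1, b)) (mixedForm F' q) q.2 :=
    HasFDerivAt.comp (g := dX F') (f := fun b : Eu n => (q.1, b)) q.2
      ((contDiffAt_dX hF'c).differentiableAt (by simp)).hasFDerivAt
      (hasFDerivAt_prodMk_right q.1 q.2)
  have hd2 : HasFDerivAt (fun b => dX F (φ q.1, ψ b))
      ((mixedForm F (φ q.1, ψ q.2)).comp (fderiv ℝ ψ q.2)) q.2 :=
    HasFDerivAt.comp (g := fun b => dX F (φ q.1, b)) q.2
      (HasFDerivAt.comp (g := dX F) (f := fun b : Eu n => (φ q.1, b)) (ψ q.2)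
        ((contDiffAt_dX hF).differentiableAt (by simp)).hasFDerivAt
        (hasFDerivAt_prodMk_right _ _)) hψd
  have e1 := fderiv_clm_apply_const hd1.differentiableAt W V
  have hd3 : HasFDerivAt (fun b => dX F (φ q.1, ψ b) (fderiv ℝ φ q.1 V)) _ q.2 :=
    hd2.clm_apply (hasFDerivAt_const _ _)
  have e2 : (fun b => dX F' (q.1, b) V) =ᶠ[𝓝 q.2]
      fun b => dX F (φ q.1, ψ b) (fderiv ℝ φ q.1 V) :=
    key.mono fun b hb => congrArg (fun L => L V) hb
  rw [hd1.fderiv, e2.fderiv_eq, hd3.fderiv] at e1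
  rw [← e1]
  simp

end Product

section CostChart

variable {n : ℕ} {M N : Type*}
  [TopologicalSpace M] [ChartedSpace (EuclideanSpace ℝ (Fin n)) M]
  [TopologicalSpace N] [ChartedSpace (EuclideanSpace ℝ (Fin n)) N]
  {c : M × N → WithTop ℝ} {x₀ x : M} {y₀ y : N}

theorem isOpen_compl_singSet (c : M × N → WithTop ℝ) : IsOpen (singSet n c)ᶜ := by
  rw [isOpen_iff_forall_mem_open]
  rintro p hp
  simp only [singSet, mem_compl_iff, mem_ofPred_eq, not_not] at hp
  obtain ⟨U, hU, hpU, h⟩ := hp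
  refine ⟨U, fun q hq => ?_, hU, hpU⟩
  simp only [singSet, mem_compl_iff, mem_ofPred_eq, not_not]
  exact ⟨U, hU, hq, h⟩

/-- The coordinate pairs, in the charts at `x₀` and `y₀`, of points off `sing(c)`. -/
def regularCoords (c : M × N → WithTop ℝ) (x₀ : M) (y₀ : N) : Set (Eu n × Eu n) :=
  ((extChartAt (𝓡 n) x₀).target ×ˢ (extChartAt (𝓡 n) y₀).target) ∩
    (fun q => ((extChartAt (𝓡 n) x₀).symm q.1, (extChartAt (𝓡 n) y₀).symm q.2)) ⁻¹'
      (singSet n c)ᶜ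

theorem isOpen_regularCoords (c : M × N → WithTop ℝ) (x₀ : M) (y₀ : N) :
    IsOpen (regularCoords (n := n) c x₀ y₀) := by
  refine ContinuousOn.isOpen_inter_preimage ?_
    ((isOpen_extChartAt_target (I := 𝓡 n) x₀).prod (isOpen_extChartAt_target (I := 𝓡 n) y₀))
    (isOpen_compl_singSet c)
  exact ((continuousOn_extChartAt_symm x₀).comp continuousOn_fst fun q hq => hq.1).prodMk
    ((continuousOn_extChartAt_symm y₀).comp continuousOn_snd fun q hq => hq.2)

theorem pairCoord_mem_regularCoords (hx : x ∈ (extChartAt (𝓡 n) x₀).source)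
    (hy : y ∈ (extChartAt (𝓡 n) y₀).source) (h : (x, y) ∉ singSet n c) :
    pairCoord x₀ x y₀ y ∈ regularCoords (n := n) c x₀ y₀ := by
  refine ⟨⟨(extChartAt (𝓡 n) x₀).map_source hx, (extChartAt (𝓡 n) y₀).map_source hy⟩, ?_⟩
  simp only [pairCoord, mem_preimage, (extChartAt (𝓡 n) x₀).left_inv hx,
    (extChartAt (𝓡 n) y₀).left_inv hy]
  exact h


/-- The cost in the preferred charts at `x` and `y` in terms of the charts at `x₀` and `y₀`. -/
theorem costF_eventuallyEq (hx : x ∈ (extChartAt (𝓡 n) x₀).source)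
    (hy : y ∈ (extChartAt (𝓡 n) y₀).source) :
    costF (n := n) c x y =ᶠ[𝓝 (pairCoord x x y y)]
      fun q => costF c x₀ y₀ (trans x₀ x q.1, trans y₀ y q.2) := by
  have h1 := chart_symm_mem_nhds x (mem_extChartAt_target (I := 𝓡 n) x)
    (s := (extChartAt (𝓡 n) x₀).source)
    (by rw [extChartAt_to_inv]; exact (isOpen_extChartAt_source (I := 𝓡 n) x₀).mem_nhds hx)
  have h2 := chart_symm_mem_nhds y (mem_extChartAt_target (I := 𝓡 n) y)
    (s := (extChartAt (𝓡 n) y₀).source)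
    (by rw [extChartAt_to_inv]; exact (isOpen_extChartAt_source (I := 𝓡 n) y₀).mem_nhds hy)
  rw [pairCoord, nhds_prod_eq]
  filter_upwards [h1.prod_inl _, h2.prod_inr _] with q hq1 hq2
  simp only [costF, costLoc, trans, (extChartAt (𝓡 n) x₀).left_inv hq1,
    (extChartAt (𝓡 n) y₀).left_inv hq2]

variable [IsManifold (𝓡 n) ∞ M] [IsManifold (𝓡 n) ∞ N]

theorem contDiffAt_costF {q : Eu n × Eu n} (hq : q ∈ regularCoords c x₀ y₀) :
    ContDiffAt ℝ ∞ (costF c x₀ y₀) q := by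
  obtain ⟨⟨h1, h2⟩, h3⟩ := hq
  simp only [singSet, mem_compl_iff, mem_preimage, mem_ofPred_eq, not_not] at h3
  obtain ⟨U, hU, hqU, -, hs⟩ := h3
  rw [← contMDiffAt_iff_contDiffAt]
  have hx : ContMDiffAt 𝓘(ℝ, Eu n) (𝓡 n) ∞ (extChartAt (𝓡 n) x₀).symm q.1 :=
    (contMDiffOn_extChartAt_symm x₀).contMDiffAt ((isOpen_extChartAt_target x₀).mem_nhds h1)
  have hy : ContMDiffAt 𝓘(ℝ, Eu n) (𝓡 n) ∞ (extChartAt (𝓡 n) y₀).symm q.2 :=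
    (contMDiffOn_extChartAt_symm y₀).contMDiffAt ((isOpen_extChartAt_target y₀).mem_nhds h2)
  have hf : ContMDiffAt 𝓘(ℝ, Eu n × Eu n) 𝓘(ℝ, Eu n) ∞ (Prod.fst : Eu n × Eu n → Eu n) q :=
    contDiffAt_fst.contMDiffAt
  have hg : ContMDiffAt 𝓘(ℝ, Eu n × Eu n) 𝓘(ℝ, Eu n) ∞ (Prod.snd : Eu n × Eu n → Eu n) q :=
    contDiffAt_snd.contMDiffAt
  have := (hx.comp q hf).prodMk (hy.comp q hg)
  exact ContMDiffAt.comp (f := fun q : Eu n × Eu n =>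
    ((extChartAt (𝓡 n) x₀).symm q.1, (extChartAt (𝓡 n) y₀).symm q.2)) q
    (hs.contMDiffAt (hU.mem_nhds hqU)) this

/-- The left side consists of iterated partial derivatives, the right side of restrictions of total
derivatives; they agree because the cost is smooth near a regular pair. -/
theorem mixedHess_eq_mixedMat (h : (x, y) ∉ singSet n c) :
    mixedHess (n := n) c x y = mixedMat (costF c x y) (pairCoord x x y y) := by
  have hF : ContDiffAt ℝ ∞ (costF (n := n) c x y) (pairCoord x x y y) :=
    contDiffAt_costF (pairCoord_mem_regularCoords (mem_extChartAt_source x)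
      (mem_extChartAt_source y) h)
  set a₀ := extChartAt (𝓡 n) x x
  set b₀ := extChartAt (𝓡 n) y y
  have hcont : ContinuousAt (fun b : Eu n => (a₀, b)) b₀ := by fun_prop
  have hQ' : (fun b : Eu n => fderiv ℝ (fun a => costLoc c x y a b) a₀) =ᶠ[𝓝 b₀]
      fun b => dX (costF (n := n) c x y) (a₀, b) := by
    filter_upwards [hcont.eventually ((hF.of_le (m := 1) ENat.LEInfty.out).eventually (by simp))]
      with b hb
    exact (dX_eq (hb.differentiableAt (by simp))).symm
  have hd : DifferentiableAt ℝ (dX (costF (n := n) c x y)) (a₀, b₀) :=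
    (contDiffAt_dX hF).differentiableAt (by simp)
  have h2 : HasFDerivAt (fun b => dX (costF (n := n) c x y) (a₀, b)) _ b₀ :=
    hd.hasFDerivAt.comp (f := fun b : Eu n => (a₀, b)) b₀ (hasFDerivAt_prodMk_right a₀ b₀)
  ext i s
  have h3 := fderiv_clm_apply_const (h2.congr_of_eventuallyEq hQ').differentiableAt
    (coordVec s) (coordVec i)
  refine h3.trans ?_
  rw [(h2.congr_of_eventuallyEq hQ').fderiv]
  rfl

theorem exists_costChart (hdet : IsNondegenerate n c) (h : (x₀, y₀) ∉ singSet n c) :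
    ∃ e : OpenPartialHomeomorph (Eu n × Eu n) (Eu n × (Eu n →L[ℝ] ℝ)),
      IsLegendreChart (costF c x₀ y₀) e ∧ pairCoord x₀ x₀ y₀ y₀ ∈ e.source ∧
        e.source ⊆ regularCoords c x₀ y₀ := by
  refine exists_legendreChart (isOpen_regularCoords c x₀ y₀) (fun q hq => contDiffAt_costF hq)
    (pairCoord_mem_regularCoords (mem_extChartAt_source x₀) (mem_extChartAt_source y₀) h) ?_
  rw [← mixedHess_eq_mixedMat h]
  exact hdet x₀ y₀ h

theorem mixedForm_chart (hx : x ∈ (extChartAt (𝓡 n) x₀).source)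
    (hy : y ∈ (extChartAt (𝓡 n) y₀).source) (h : (x, y) ∉ singSet n c) (W V : Eu n) :
    mixedForm (costF c x y) (pairCoord x x y y) W V =
      mixedForm (costF c x₀ y₀) (pairCoord x₀ x y₀ y) (tau y₀ y W) (tau x₀ x V) := by
  have hF : ContDiffAt ℝ ∞ (costF (n := n) c x₀ y₀) (pairCoord x₀ x y₀ y) :=
    contDiffAt_costF (pairCoord_mem_regularCoords hx hy h)
  have := mixedForm_comp (φ := trans x₀ x) (ψ := trans y₀ y) (q := pairCoord x x y y)
    (F := costF (n := n) c x₀ y₀) (F' := costF (n := n) c x y)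
    (by simp only [pairCoord, trans_self_apply]; exact hF)
    (contDiffAt_trans_self hx) (contDiffAt_trans_self hy) (costF_eventuallyEq hx hy) W V
  simp only [pairCoord, trans_self_apply] at this
  exact this

end CostChart

section Scalar

theorem fderiv_fderiv_neg_add {g k : ℝ → ℝ} (hg : ContDiffAt ℝ 2 g 0) (hk : ContDiffAt ℝ 2 k 0) :
    fderiv ℝ (fderiv ℝ (fun r => -g r + k r)) 0 1 1 =
      -fderiv ℝ (fderiv ℝ g) 0 1 1 + fderiv ℝ (fderiv ℝ k) 0 1 1 := by
  have hev : fderiv ℝ (fun r => -g r + k r) =ᶠ[𝓝 0] fun r => -fderiv ℝ g r + fderiv ℝ k r := by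
    filter_upwards [hg.eventually (by simp), hk.eventually (by simp)] with r h1 h2
    have h1' := (h1.differentiableAt (by simp)).hasFDerivAt
    exact (h1'.neg.add (h2.differentiableAt (by simp)).hasFDerivAt).fderiv
  have hg1 := ((hg.fderiv_right (m := 1) (by norm_num)).differentiableAt (by simp)).hasFDerivAt
  have hk1 := ((hk.fderiv_right (m := 1) (by norm_num)).differentiableAt (by simp)).hasFDerivAt
  have h : HasFDerivAt (fun r => -fderiv ℝ g r + fderiv ℝ k r) _ 0 := hg1.neg.add hk1
  rw [hev.fderiv_eq, h.fderiv]
  rfl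

theorem fderiv_fderiv_comp_of_eq_zero {X Y Z : Type*} [NormedAddCommGroup X] [NormedSpace ℝ X]
    [NormedAddCommGroup Y] [NormedSpace ℝ Y] [NormedAddCommGroup Z] [NormedSpace ℝ Z]
    {f : Y → Z} {g : X → Y} {a v : X} {w : Y} (hf : ContDiffAt ℝ 2 f (g a))
    (hg : ContDiffAt ℝ 2 g a) (h1 : fderiv ℝ g a v = w) (h2 : fderiv ℝ (fderiv ℝ g) a v v = 0) :
    fderiv ℝ (fderiv ℝ (fun x => f (g x))) a v v = fderiv ℝ (fderiv ℝ f) (g a) w w := by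
  rw [fderiv_fderiv_comp hf hg, h1, h2, map_zero, add_zero]

end Scalar

/-! ### The Ma-Trudinger-Wang tensor as a second derivative in p. -/

section Transfer

variable {n : ℕ} {M N : Type*}
  [TopologicalSpace M] [ChartedSpace (EuclideanSpace ℝ (Fin n)) M]
  [TopologicalSpace N] [ChartedSpace (EuclideanSpace ℝ (Fin n)) N]
  {c : M × N → WithTop ℝ} {x₀ x : M} {y₀ y : N}
  {e : OpenPartialHomeomorph (Eu n × Eu n) (Eu n × (Eu n →L[ℝ] ℝ))}

theorem notMem_singSet_of_mem (hsub : e.source ⊆ regularCoords c x₀ y₀)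
    (hx : x ∈ (extChartAt (𝓡 n) x₀).source) (hy : y ∈ (extChartAt (𝓡 n) y₀).source)
    (hxy : pairCoord x₀ x y₀ y ∈ e.source) : (x, y) ∉ singSet n c := by
  have := (hsub hxy).2
  simp only [pairCoord, mem_preimage, (extChartAt (𝓡 n) x₀).left_inv hx,
    (extChartAt (𝓡 n) y₀).left_inv hy] at this
  exact this

variable [IsManifold (𝓡 n) ∞ M] [IsManifold (𝓡 n) ∞ N]

set_option maxHeartbeats 800000 in
/-- The Ma-Trudinger-Wang tensor as a second derivative in the covector variable. -/
theorem mtw_eq_fderiv_fderiv (h : IsLegendreChart (costF c x₀ y₀) e)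
    (hsub : e.source ⊆ regularCoords c x₀ y₀) (hnd : IsNondegenerate n c)
    (hx : x ∈ (extChartAt (𝓡 n) x₀).source) (hy : y ∈ (extChartAt (𝓡 n) y₀).source)
    (hxy : pairCoord x₀ x y₀ y ∈ e.source) (η : Eu n →L[ℝ] ℝ) (V : Eu n) :
    mtw c x y V (η.comp (tau x₀ x)) =
      fderiv ℝ (fderiv ℝ (fun p => negHessX (costF c x₀ y₀) (e.symm p)))
        (e (pairCoord x₀ x y₀ y)) (0, η) (0, η) (tau x₀ x V) (tau x₀ x V) := by
  have hns := notMem_singSet_of_mem hsub hx hy hxy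
  set F := costF (n := n) c x₀ y₀ with hF
  set a₀ := extChartAt (𝓡 n) x₀ x with ha₀
  set p₀ : Eu n →L[ℝ] ℝ := -dX F (pairCoord x₀ x y₀ y) with hp₀
  have he : e (pairCoord x₀ x y₀ y) = (a₀, p₀) := by rw [h.apply]; rfl
  have htgt : (a₀, p₀) ∈ e.target := he ▸ e.map_source hxy
  set A : Eu n × (Eu n →L[ℝ] ℝ) → Eu n →L[ℝ] Eu n →L[ℝ] ℝ := fun p => negHessX F (e.symm p) with hA
  rw [he]
  -- A straight line in the covector variable; its preimage under the Legendre chart is a curve of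
  -- target points along which D_x c is affine, as `mtw_eq` requires.
  set β : ℝ → Eu n × (Eu n →L[ℝ] ℝ) := fun r => (a₀, p₀ + r • η) with hβ
  have hβ0 : β 0 = (a₀, p₀) := by simp [hβ]
  have hβd : ∀ r, HasFDerivAt β (ContinuousLinearMap.toSpanSingleton ℝ
      ((0 : Eu n), η)) r := by
    intro r
    have h1 : HasDerivAt (fun r : ℝ => p₀ + r • η) η r := by
      simpa using ((hasDerivAt_id r).smul_const η).const_add p₀
    exact ((hasDerivAt_const r a₀).prodMk h1).hasFDerivAt
  have hβs : ContDiff ℝ ∞ β := contDiff_const.prodMk (contDiff_const.add (contDiff_id.smul contDiff_const))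
  have hsymm0 : e.symm (a₀, p₀) = pairCoord x₀ x y₀ y := by rw [← he, e.left_inv hxy]
  set b' : ℝ → Eu n := fun r => (e.symm (β r)).2 with hb'
  have hb'0 : b' 0 = extChartAt (𝓡 n) y₀ y := by
    simp only [hb', hβ0, hsymm0]; rfl
  have hb's : ContDiffAt ℝ ∞ b' 0 := by
    have h1 : ContDiffAt ℝ ∞ e.symm (β 0) := h.contDiffAt_symm (by rwa [hβ0])
    exact contDiffAt_snd.comp (0 : ℝ) (h1.comp (0 : ℝ) hβs.contDiffAt)
  set b : ℝ → Eu n := fun r => trans y y₀ (b' r) with hb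
  have hbs : ContDiffAt ℝ ∞ b 0 := by
    have := contDiffAt_trans_inv hy
    rw [← hb'0] at this
    exact this.comp (0 : ℝ) hb's
  have hb0 : b 0 = extChartAt (𝓡 n) y y := by
    simp only [hb, hb'0]; exact trans_apply_of_mem hy
  set f : ℝ → M → ℝ := fun r x' => realCost c x' ((extChartAt (𝓡 n) y₀).symm (b' r)) with hf
  have hβtgt : ∀ᶠ r in 𝓝 (0 : ℝ), β r ∈ e.target :=
    hβs.continuous.continuousAt.eventually
      (by rw [hβ0]; exact e.open_target.mem_nhds htgt)
  have hloc : ∀ᶠ r in 𝓝 (0 : ℝ), ∀ a, costLoc c x y a (b r) = loc x (f r) a := by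
    have h1 := chart_symm_mem_nhds y₀ ((extChartAt (𝓡 n) y₀).map_source hy)
      (s := (extChartAt (𝓡 n) y).source)
      (by
        rw [(extChartAt (𝓡 n) y₀).left_inv hy]
        exact extChartAt_source_mem_nhds (I := 𝓡 n) y)
    rw [← hb'0] at h1
    filter_upwards [hb's.continuousAt.eventually h1] with r hr a
    simp only [costLoc, loc, hf, hb, trans, (extChartAt (𝓡 n) y).left_inv hr]
  have hsl : ∀ᶠ r in 𝓝 (0 : ℝ), ContDiffAt ℝ ∞ (loc x₀ (f r)) a₀ ∧
      fderiv ℝ (loc x₀ (f r)) a₀ = -(p₀ + r • η) ∧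
      fderiv ℝ (fderiv ℝ (loc x₀ (f r))) a₀ = -A (β r) := by
    filter_upwards [hβtgt] with r hr
    have h1 := h.smooth _ (e.map_target hr)
    have h2 := h.symm_eq hr
    have h3 := contDiffAt_slice h1
    have h4 := fderiv_fderiv_slice (h1.of_le (m := 2) ENat.LEInfty.out)
    have h5 := dX_eq (h1.differentiableAt (by simp))
    have h6 := h.dX_symm hr
    have h7 : (e.symm (β r)).1 = a₀ := h.symm_fst hr
    rw [h7] at h3 h4 h5
    refine ⟨h3, ?_, h4⟩
    exact h5.symm.trans (neg_eq_iff_eq_neg.1 h6)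
  have hQ : ∀ᶠ r in 𝓝 (0 : ℝ),
      fderiv ℝ (fun a => costLoc c x y a (b r)) (extChartAt (𝓡 n) x x) =
        -p₀.comp (tau x₀ x) - r • η.comp (tau x₀ x) := by
    filter_upwards [hloc, hsl] with r h1 h2
    have h3 : (fun a => costLoc c x y a (b r)) = loc x (f r) := funext h1
    rw [h3]
    ext W
    refine (congrArg (fun L : Eu n →L[ℝ] ℝ => L W) (covector_eq (f r) x).symm).trans ?_
    refine (covector_apply hx (h2.1.differentiableAt (by simp)) W).trans ?_
    rw [h2.2.1]
    simp [sub_eq_add_neg, add_comm]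
  refine (mtw_eq (V := V) (contDiffAt_costF (pairCoord_mem_regularCoords (mem_extChartAt_source x)
      (mem_extChartAt_source y) hns)) (hnd x y hns) (hbs.of_le ENat.LEInfty.out) hb0 hQ).trans ?_
  -- A coordinate Hessian is not tensorial: changing charts adds the first derivative applied to κ.
  -- Along β that correction is affine in r, so it disappears from the second derivative.
  set κ : Eu n := fderiv ℝ (fderiv ℝ (trans x₀ x)) (extChartAt (𝓡 n) x x) V V with hκ
  have hS : (fun r => fderiv ℝ (fun a =>
      fderiv ℝ (fun a' => costLoc c x y a' (b r)) a V) (extChartAt (𝓡 n) x x) V) =ᶠ[𝓝 0]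
      fun r => -(A (β r) (tau x₀ x V) (tau x₀ x V)) + (-p₀ κ - r • η κ) := by
    filter_upwards [hloc, hsl] with r h1 h2
    have h3 : (fun a => costLoc c x y a (b r)) = loc x (f r) := funext h1
    rw [h3]
    refine (hessAt_eq (f := f r) hx (h2.1.of_le ENat.LEInfty.out) V V).trans ?_
    rw [h2.2.1, h2.2.2]
    change -(A (β r) (tau x₀ x V) (tau x₀ x V)) + -(p₀ κ + r • η κ) = _
    rw [neg_add, sub_eq_add_neg]
  have hAs : ContDiffAt ℝ ∞ A (a₀, p₀) :=
    h.contDiffAt_comp_symm htgt (contDiffAt_negHessX (h.smooth _ (e.map_target htgt)))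
  have hA2 : ContDiffAt ℝ 2 A (β 0) := by rw [hβ0]; exact hAs.of_le ENat.LEInfty.out
  have hg : ContDiffAt ℝ 2 (fun r => A (β r) (tau x₀ x V) (tau x₀ x V)) 0 :=
    ((hA2.comp (0 : ℝ) (hβs.contDiffAt.of_le ENat.LEInfty.out)).clm_apply
      contDiffAt_const).clm_apply contDiffAt_const
  have hk : ContDiffAt ℝ 2 (fun r : ℝ => -p₀ κ - r • η κ) 0 :=
    contDiffAt_const.sub (contDiffAt_id.smul contDiffAt_const)
  rw [hS.fderiv.fderiv_eq, fderiv_fderiv_neg_add hg hk, fderiv_fderiv_affine, add_zero, neg_neg]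
  have h1 := fderiv_fderiv_clm_comp (evalDiag (tau x₀ x V))
    (hA2.comp (0 : ℝ) (hβs.contDiffAt.of_le ENat.LEInfty.out)) 1 1
  have h3 : fderiv ℝ β = fun _ => ContinuousLinearMap.toSpanSingleton ℝ ((0 : Eu n), η) :=
    funext fun r => (hβd r).fderiv
  have h2 := fderiv_fderiv_comp_of_eq_zero hA2 (hβs.contDiffAt.of_le ENat.LEInfty.out)
    (v := 1) (w := ((0 : Eu n), η)) (by rw [h3]; simp) (by rw [h3]; simp)
  rw [hβ0] at h2
  exact h1.trans (congrArg (evalDiag (tau x₀ x V)) h2)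

end Transfer

/-! ### Smoothness and positivity of the metric coefficients. -/

section Transition

variable {n : ℕ}

theorem sum_smul_ofLp {f : Fin n → Eu n} (v : Fin n → ℝ) (k : Fin n) :
    (∑ i, v i • f i) k = Matrix.vecMul v (Matrix.of fun i k => f i k) k := by
  simp [Matrix.vecMul, dotProduct]

theorem det_gram_pos {W : Eu n →L[ℝ] Eu n →L[ℝ] ℝ} (hs : ∀ x y, W x y = W y x)
    (h : ∀ x, x ≠ 0 → 0 < W x x) : 0 < (gram W).det := by
  have := (posDef_gram hs h (EuclideanSpace.basisFun (Fin n) ℝ).toBasis).det_pos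
  have h2 : gramOn (EuclideanSpace.basisFun (Fin n) ℝ).toBasis W = gram W := by
    ext i j; simp [gram, gramOn, coordVec]
  rwa [h2] at this

/-- In finite dimension a form is a finite combination of fixed forms with its entries as
coefficients. -/
theorem contDiffAt_bilin {X : Type*} [NormedAddCommGroup X] [NormedSpace ℝ X]
    {G : X → Eu n →L[ℝ] Eu n →L[ℝ] ℝ} {a : X} {k : ℕ∞ω}
    (h : ∀ V W : Eu n, ContDiffAt ℝ k (fun x => G x V W) a) : ContDiffAt ℝ k G a := by
  have hG : G = fun x => ∑ i, ∑ j, G x (coordVec i) (coordVec j) •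
      (EuclideanSpace.proj i : Eu n →L[ℝ] ℝ).smulRight (EuclideanSpace.proj j : Eu n →L[ℝ] ℝ) := by
    ext x V W
    conv_lhs => rw [← sum_coordVec V, ← sum_coordVec W, bilin_sum_sum]
    simp only [_root_.sum_apply, _root_.smul_apply, ContinuousLinearMap.smulRight_apply,
      PiLp.proj_apply, smul_eq_mul]
    refine Finset.sum_congr rfl fun i _ => Finset.sum_congr rfl fun j _ => by ring
  rw [hG]
  exact ContDiffAt.sum fun i _ => ContDiffAt.sum fun j _ => (h _ _).smul contDiffAt_const

variable {M : Type*} [TopologicalSpace M] [ChartedSpace (EuclideanSpace ℝ (Fin n)) M]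

/-- The determinant of the derivative of the transition map to the chart at `x₀`. -/
def tauDet (x₀ x : M) : ℝ := (Matrix.of fun i k => tau x₀ x (coordVec i) k : Matrix (Fin n) (Fin n) ℝ).det

variable [IsManifold (𝓡 n) ∞ M]

theorem tauDet_ne_zero {x₀ x : M} (hx : x ∈ (extChartAt (𝓡 n) x₀).source) :
    tauDet (n := n) x₀ x ≠ 0 := by
  intro h0
  obtain ⟨v, hv, hv'⟩ := Matrix.exists_vecMul_eq_zero_iff.2 h0
  apply hv
  have h1 : tau x₀ x (∑ i, v i • coordVec i) = 0 := by
    rw [map_sum]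
    simp only [map_smul]
    ext k
    rw [sum_smul_ofLp, hv']; rfl
  have h2 : ∑ i, v i • (coordVec i : Eu n) = 0 := by
    rw [← tauInv_tau hx (∑ i, v i • coordVec i), h1, map_zero]
  have h3 := sum_coordVec (WithLp.toLp 2 v)
  simp only at h3
  rw [h2] at h3
  ext i
  exact (congrArg (fun w : Eu n => w i) h3).symm

/-- The transition to the chart at `x₁` from the one at `x₀`, through the chart at `x`. -/
theorem tau_tauInv_eq {x₀ x₁ x : M} (hx : x ∈ (extChartAt (𝓡 n) x₀).source)
    (hx₁ : x ∈ (extChartAt (𝓡 n) x₁).source) (V : Eu n) :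
    tau x₁ x (tauInv x₀ x V) = fderiv ℝ (trans x₁ x₀) (extChartAt (𝓡 n) x₀ x) V := by
  have hev : trans x₁ x₀ =ᶠ[𝓝 (extChartAt (𝓡 n) x₀ x)] fun a => trans x₁ x (trans x x₀ a) := by
    have := chart_symm_mem_nhds x₀ ((extChartAt (𝓡 n) x₀).map_source hx)
      (s := (extChartAt (𝓡 n) x).source)
      (by rw [(extChartAt (𝓡 n) x₀).left_inv hx]; exact extChartAt_source_mem_nhds (I := 𝓡 n) x)
    filter_upwards [this] with a ha
    simp only [trans, (extChartAt (𝓡 n) x).left_inv ha]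
  rw [hev.fderiv_eq]
  have hd := (contDiffAt_trans_self hx₁).differentiableAt (by simp)
  rw [← trans_apply_of_mem hx] at hd
  have := fderiv_comp (extChartAt (𝓡 n) x₀ x) hd
    ((contDiffAt_trans_inv hx).differentiableAt (by simp))
  rw [trans_apply_of_mem hx] at this
  exact (congrArg (fun L => L V) this).symm

/-- Fields with constant coefficients in the chart at `x₀` are smooth sections. Pairing two of them
gives the smoothness of `metricLoc` out of that of the Riemannian bundle. -/
theorem contMDiffAt_section {x₀ x₁ : M} (hx : x₁ ∈ (extChartAt (𝓡 n) x₀).source) (V : Eu n) :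
    ContMDiffAt 𝓘(ℝ, Eu n) ((𝓡 n).prod 𝓘(ℝ, Eu n)) ∞
      (fun a => (⟨(extChartAt (𝓡 n) x₀).symm a, tauInv x₀ ((extChartAt (𝓡 n) x₀).symm a) V⟩ :
        TotalSpace (Eu n) (fun x : M => TangentSpace (𝓡 n) x))) (extChartAt (𝓡 n) x₀ x₁) := by
  have hsymm : ContMDiffAt 𝓘(ℝ, Eu n) (𝓡 n) ∞ (extChartAt (𝓡 n) x₀).symm (extChartAt (𝓡 n) x₀ x₁) :=
    (contMDiffOn_extChartAt_symm x₀).contMDiffAt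
      ((isOpen_extChartAt_target x₀).mem_nhds ((extChartAt (𝓡 n) x₀).map_source hx))
  rw [contMDiffAt_totalSpace]
  refine ⟨hsymm, ?_⟩
  simp only [(extChartAt (𝓡 n) x₀).left_inv hx]
  have h1 : ContDiffAt ℝ ∞ (fun a => fderiv ℝ (trans x₁ x₀) a V) (extChartAt (𝓡 n) x₀ x₁) :=
    ((contDiffAt_trans_inv hx).fderiv_right (m := ∞) (by simp)).clm_apply contDiffAt_const
  rw [contMDiffAt_iff_contDiffAt]
  refine h1.congr_of_eventuallyEq ?_
  have h2 := chart_symm_mem_nhds x₀ ((extChartAt (𝓡 n) x₀).map_source hx)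
      (s := (extChartAt (𝓡 n) x₁).source)
      (by rw [(extChartAt (𝓡 n) x₀).left_inv hx]; exact extChartAt_source_mem_nhds (I := 𝓡 n) x₁)
  filter_upwards [h2, (isOpen_extChartAt_target (I := 𝓡 n) x₀).mem_nhds
    ((extChartAt (𝓡 n) x₀).map_source hx)] with a ha hat
  have h3 := tau_tauInv_eq ((extChartAt (𝓡 n) x₀).map_target hat) ha V
  rw [(extChartAt (𝓡 n) x₀).right_inv hat] at h3
  rw [← h3, TangentBundle.trivializationAt_apply]
  simp only [ModelWithCorners.range_eq_univ, fderivWithin_univ]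
  rfl

end Transition

section Metric

variable {n : ℕ} {M : Type*} [EMetricSpace M] [ChartedSpace (EuclideanSpace ℝ (Fin n)) M]
  [RiemannianBundle (fun x : M => TangentSpace (𝓡 n) x)]

/-- The inner product of the tangent space at `x`, in the preferred chart at `x`. -/
def innerForm (x : M) : Eu n →L[ℝ] Eu n →L[ℝ] ℝ :=
  (innerSL ℝ : TangentSpace (𝓡 n) x →L[ℝ] TangentSpace (𝓡 n) x →L[ℝ] ℝ)

/-- The metric in the preferred chart at `x₀`. -/
def metricLoc (x₀ : M) (a : Eu n) : Eu n →L[ℝ] Eu n →L[ℝ] ℝ :=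
  let x := (extChartAt (𝓡 n) x₀).symm a
  (innerForm x).bilinearComp (tauInv x₀ x) (tauInv x₀ x)

theorem innerForm_symm (x : M) (V W : Eu n) : innerForm x V W = innerForm x W V :=
  real_inner_comm (F := TangentSpace (𝓡 n) x) W V

theorem innerForm_self (x : M) (V : TangentSpace (𝓡 n) x) : innerForm x V V = ‖V‖ ^ 2 :=
  real_inner_self_eq_norm_sq V

theorem innerForm_pos (x : M) {V : Eu n} (hV : V ≠ 0) : 0 < innerForm x V V := by
  have h : (V : TangentSpace (𝓡 n) x) ≠ 0 := hV
  exact (innerForm_self x V).symm ▸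
    pow_pos ((norm_pos_iff (E := TangentSpace (𝓡 n) x)).2 h) 2

theorem metricLoc_apply (x₀ : M) {x : M} (hx : x ∈ (extChartAt (𝓡 n) x₀).source) (V W : Eu n) :
    metricLoc x₀ (extChartAt (𝓡 n) x₀ x) V W =
      innerForm x (tauInv x₀ x V) (tauInv x₀ x W) := by
  simp only [metricLoc, (extChartAt (𝓡 n) x₀).left_inv hx]
  rfl

theorem metricLoc_symm (x₀ : M) (a V W : Eu n) : metricLoc x₀ a V W = metricLoc x₀ a W V := by
  simp only [metricLoc, ContinuousLinearMap.bilinearComp_apply]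
  exact innerForm_symm _ _ _

theorem volDensity_eq (x : M) : volDensity n x = Real.sqrt (gram (innerForm (n := n) x)).det := rfl

theorem det_innerForm_pos (x : M) : 0 < (gram (innerForm (n := n) x)).det :=
  det_gram_pos (innerForm_symm x) fun _ h => innerForm_pos x h

theorem volDensity_pos (x : M) : 0 < volDensity n x := Real.sqrt_pos.2 (det_innerForm_pos x)

variable [IsManifold (𝓡 n) ∞ M]

theorem metricLoc_pos {x₀ x : M} (hx : x ∈ (extChartAt (𝓡 n) x₀).source) {V : Eu n} (hV : V ≠ 0) :
    0 < metricLoc x₀ (extChartAt (𝓡 n) x₀ x) V V := by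
  rw [metricLoc_apply x₀ hx]
  exact innerForm_pos x (tauInv_ne_zero hx hV)

theorem innerForm_eq {x₀ x : M} (hx : x ∈ (extChartAt (𝓡 n) x₀).source) (V W : Eu n) :
    innerForm x V W = metricLoc x₀ (extChartAt (𝓡 n) x₀ x) (tau x₀ x V) (tau x₀ x W) := by
  rw [metricLoc_apply x₀ hx, tauInv_tau hx, tauInv_tau hx]

theorem det_metricLoc_pos {x₀ x : M} (hx : x ∈ (extChartAt (𝓡 n) x₀).source) :
    0 < (gram (metricLoc x₀ (extChartAt (𝓡 n) x₀ x))).det :=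
  det_gram_pos (metricLoc_symm x₀ _) fun _ h => metricLoc_pos hx h

theorem log_volDensity {x₀ x : M} (hx : x ∈ (extChartAt (𝓡 n) x₀).source) :
    Real.log (volDensity n x) = Real.log |tauDet (n := n) x₀ x| +
      Real.log (gram (metricLoc x₀ (extChartAt (𝓡 n) x₀ x))).det / 2 := by
  have h : gram (innerForm x) = gramOn (fun i => tau x₀ x (coordVec i))
      (metricLoc x₀ (extChartAt (𝓡 n) x₀ x)) := by
    ext i j; exact innerForm_eq hx _ _
  have hdet : (gram (innerForm (n := n) x)).det = tauDet (n := n) x₀ x ^ 2 *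
      (gram (metricLoc x₀ (extChartAt (𝓡 n) x₀ x))).det := by rw [h, det_gramOn]; rfl
  rw [volDensity_eq, hdet, Real.log_sqrt (by have := det_metricLoc_pos hx; positivity),
    Real.log_mul (pow_ne_zero 2 (tauDet_ne_zero hx)) (det_metricLoc_pos hx).ne', Real.log_pow,
    Real.log_abs]
  push_cast; ring

variable [IsContMDiffRiemannianBundle (𝓡 n) ∞ (EuclideanSpace ℝ (Fin n))
      (fun x : M => TangentSpace (𝓡 n) x)]

theorem contDiffAt_metricLoc {x₀ x : M} (hx : x ∈ (extChartAt (𝓡 n) x₀).source) :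
    ContDiffAt ℝ ∞ (metricLoc x₀) (extChartAt (𝓡 n) x₀ x) := by
  refine contDiffAt_bilin fun V W => ?_
  rw [← contMDiffAt_iff_contDiffAt]
  exact (contMDiffAt_section hx V).inner_bundle (contMDiffAt_section hx W)

end Metric

/-! ### Maps with a potential, w and θ in fixed charts. -/

section Potential

variable {n : ℕ} {M N : Type*}
  [TopologicalSpace M] [ChartedSpace (EuclideanSpace ℝ (Fin n)) M]
  [TopologicalSpace N] [ChartedSpace (EuclideanSpace ℝ (Fin n)) N]
  {c : M × N → WithTop ℝ} {x₀ x : M} {y₀ y : N} {u : M → ℝ} {T : M → N}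
  {e : OpenPartialHomeomorph (Eu n × Eu n) (Eu n × (Eu n →L[ℝ] ℝ))}

/-- The coefficient `A(a, p) = -D_a²c` of the modified Hessian, as a function of the point and of
the covector. -/
def coefA (c : M × N → WithTop ℝ) (x₀ : M) (y₀ : N)
    (e : OpenPartialHomeomorph (Eu n × Eu n) (Eu n × (Eu n →L[ℝ] ℝ)))
    (p : Eu n × (Eu n →L[ℝ] ℝ)) : Eu n →L[ℝ] Eu n →L[ℝ] ℝ := negHessX (costF c x₀ y₀) (e.symm p)

theorem loc_cost (hy : y ∈ (extChartAt (𝓡 n) y₀).source) :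
    loc x₀ (fun x' => realCost c x' y) =
      fun a : Eu n => costF c x₀ y₀ (a, extChartAt (𝓡 n) y₀ y) := by
  ext a
  simp only [loc, costF, costLoc, (extChartAt (𝓡 n) y₀).left_inv hy]

variable [IsManifold (𝓡 n) ∞ M] [IsManifold (𝓡 n) ∞ N]

theorem DxCost_apply (hx : x ∈ (extChartAt (𝓡 n) x₀).source)
    (hy : y ∈ (extChartAt (𝓡 n) y₀).source) (h : (x, y) ∉ singSet n c) (V : Eu n) :
    DxCost c x y V = dX (costF c x₀ y₀) (pairCoord x₀ x y₀ y) (tau x₀ x V) := by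
  have hF : ContDiffAt ℝ ∞ (costF (n := n) c x₀ y₀) (pairCoord x₀ x y₀ y) :=
    contDiffAt_costF (pairCoord_mem_regularCoords hx hy h)
  have hs := contDiffAt_slice hF
  have hl := loc_cost (n := n) (x₀ := x₀) (c := c) hy
  refine (covector_apply (x₀ := x₀) hx ?_ V).trans ?_
  · rw [hl]; exact hs.differentiableAt (by simp)
  · rw [dX_eq (hF.differentiableAt (by simp)), hl]; rfl

/-- The coordinates of the graph of `T` correspond to the jet of the potential. -/
theorem legendre_eq_jet (h : IsLegendreChart (costF c x₀ y₀) e)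
    (hx : x ∈ (extChartAt (𝓡 n) x₀).source) (hy : T x ∈ (extChartAt (𝓡 n) y₀).source)
    (hT : IsPotentialMap n c u T)
    (hu : DifferentiableAt ℝ (loc x₀ u) (extChartAt (𝓡 n) x₀ x)) :
    e (pairCoord x₀ x y₀ (T x)) = jet (loc x₀ u) (extChartAt (𝓡 n) x₀ x) := by
  rw [h.apply]
  refine Prod.ext rfl ?_
  change -dX (costF c x₀ y₀) (pairCoord x₀ x y₀ (T x)) = fderiv ℝ (loc x₀ u) (extChartAt (𝓡 n) x₀ x)
  ext V
  obtain ⟨h1, h2⟩ := hT x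
  have h3 := DxCost_apply hx hy h1 (tauInv x₀ x V)
  have h4 := covector_apply hx hu (tauInv x₀ x V)
  rw [tau_tauInv hx] at h3 h4
  rw [← h4, _root_.neg_apply, ← h3, ← h2]
  rfl

/-- The Legendre chart produces some regular point with the same D_x c as `T x`; the twist condition
identifies the two. Thus membership of the jet in the open target, a condition stable under
perturbation, keeps `T x` within the chart although no continuity of `T` is assumed. -/
theorem mem_source_of_jet_mem (h : IsLegendreChart (costF c x₀ y₀) e)
    (hsub : e.source ⊆ regularCoords c x₀ y₀) (hinj : IsTwisted n c)
    (hx : x ∈ (extChartAt (𝓡 n) x₀).source) (hT : IsPotentialMap n c u T)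
    (hu : DifferentiableAt ℝ (loc x₀ u) (extChartAt (𝓡 n) x₀ x))
    (hj : jet (loc x₀ u) (extChartAt (𝓡 n) x₀ x) ∈ e.target) :
    T x ∈ (extChartAt (𝓡 n) y₀).source ∧ pairCoord x₀ x y₀ (T x) ∈ e.source := by
  set p := jet (loc x₀ u) (extChartAt (𝓡 n) x₀ x) with hp
  have hs := e.map_target hj
  have hr := hsub hs
  set y := (extChartAt (𝓡 n) y₀).symm (e.symm p).2 with hy
  have hys : y ∈ (extChartAt (𝓡 n) y₀).source := (extChartAt (𝓡 n) y₀).map_target hr.1.2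
  have hfst : (e.symm p).1 = extChartAt (𝓡 n) x₀ x := h.symm_fst hj
  have hpair : pairCoord x₀ x y₀ y = e.symm p := by
    refine Prod.ext hfst.symm ?_
    exact (extChartAt (𝓡 n) y₀).right_inv hr.1.2
  have hns : (x, y) ∉ singSet n c :=
    notMem_singSet_of_mem hsub hx hys (by rw [hpair]; exact hs)
  have hTy : T x = y := by
    refine hinj x (hT x).1 hns ?_
    have h2 := (hT x).2
    have h3 : -DxCost (n := n) c x y = covector u x := by
      ext V
      have e1 := DxCost_apply hx hys hns V
      have e2 := covector_apply hx hu V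
      rw [hpair] at e1
      have e3 := congrArg (fun L : Eu n →L[ℝ] ℝ => L (tau x₀ x V)) (h.dX_symm hj)
      refine (congrArg Neg.neg e1).trans (Eq.trans ?_ e2.symm)
      exact e3
    exact neg_injective (h2.trans h3.symm)
  rw [hTy]
  exact ⟨hys, by rw [hpair]; exact hs⟩

/-- The form `w` in a fixed chart. -/
theorem wForm_eq_wHess (h : IsLegendreChart (costF c x₀ y₀) e)
    (hsub : e.source ⊆ regularCoords c x₀ y₀) (hinj : IsTwisted n c)
    (hx : x ∈ (extChartAt (𝓡 n) x₀).source) (hT : IsPotentialMap n c u T)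
    (hu : ContDiffAt ℝ 2 (loc x₀ u) (extChartAt (𝓡 n) x₀ x))
    (hj : jet (loc x₀ u) (extChartAt (𝓡 n) x₀ x) ∈ e.target) (V W : Eu n) :
    wForm c u T x V W = wHess (coefA c x₀ y₀ e) (loc x₀ u) (extChartAt (𝓡 n) x₀ x)
      (tau x₀ x V) (tau x₀ x W) := by
  have hud : DifferentiableAt ℝ (loc x₀ u) (extChartAt (𝓡 n) x₀ x) := hu.differentiableAt (by simp)
  obtain ⟨hy, hs⟩ := mem_source_of_jet_mem h hsub hinj hx hT hud hj
  have hjet := legendre_eq_jet h hx hy hT hud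
  have hF := h.smooth _ hs
  have hsl := (contDiffAt_slice hF).of_le (m := 2) ENat.LEInfty.out
  have hl := loc_cost (n := n) (x₀ := x₀) (c := c) hy
  set a := extChartAt (𝓡 n) x₀ x
  have hsl' : ContDiffAt ℝ 2 (loc x₀ (fun x' => realCost c x' (T x))) a := by rw [hl]; exact hsl
  have hsum : loc (n := n) x₀ (fun x' => u x' + realCost c x' (T x)) =
      fun a : Eu n => loc x₀ u a + loc x₀ (fun x' => realCost c x' (T x)) a := rfl
  have hd1 : fderiv ℝ (loc x₀ (fun x' => realCost c x' (T x))) a =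
      -fderiv ℝ (loc x₀ u) a := by
    have h1 := dX_eq (hF.differentiableAt (by simp))
    have h2 := congrArg Prod.snd hjet
    rw [h.apply] at h2
    rw [hl]
    exact h1.symm.trans (neg_eq_iff_eq_neg.1 h2)
  have hd2 : fderiv ℝ (fderiv ℝ (loc x₀ (fun x' => realCost c x' (T x)))) a =
      -coefA c x₀ y₀ e (jet (loc x₀ u) a) := by
    rw [hl, coefA, ← hjet, e.left_inv hs]
    exact fderiv_fderiv_slice (hF.of_le ENat.LEInfty.out)
  have hadd : ContDiffAt ℝ 2 (loc x₀ (fun x' => u x' + realCost c x' (T x))) a := hu.add hsl'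
  refine (hessAt_eq hx hadd V W).trans ?_
  have hf1 : fderiv ℝ (loc x₀ (fun x' => u x' + realCost c x' (T x))) =ᶠ[𝓝 a]
      fun a => fderiv ℝ (loc x₀ u) a + fderiv ℝ (loc x₀ (fun x' => realCost c x' (T x))) a := by
    filter_upwards [hu.eventually (by simp), hsl'.eventually (by simp)] with a' h1 h2
    rw [hsum]
    exact fderiv_fun_add (h1.differentiableAt (by simp)) (h2.differentiableAt (by simp))
  have hf2 : fderiv ℝ (fderiv ℝ (loc x₀ (fun x' => u x' + realCost c x' (T x)))) a =
      wHess (coefA c x₀ y₀ e) (loc x₀ u) a := by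
    rw [hf1.fderiv_eq, fderiv_fun_add
      ((hu.fderiv_right (m := 1) (by norm_num)).differentiableAt (by simp))
      ((hsl'.fderiv_right (m := 1) (by norm_num)).differentiableAt (by simp)), hd2,
      ← sub_eq_add_neg]
    rfl
  -- At a critical point the non-tensorial term in the change of charts vanishes.
  have hz : fderiv ℝ (loc x₀ (fun x' => u x' + realCost c x' (T x))) a = 0 :=
    hf1.self_of_nhds.trans (by simp only [hd1]; exact add_neg_cancel _)
  rw [hf2, hz]
  exact add_zero _

theorem det_of_bilin (B : Eu n →L[ℝ] Eu n →L[ℝ] ℝ) (f g : Fin n → Eu n) (m : Matrix (Fin n) (Fin n) ℝ)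
    (hB : ∀ W V, B W V = ∑ i, ∑ s, V i * m i s * W s) :
    (Matrix.of fun i s => B (g s) (f i) : Matrix (Fin n) (Fin n) ℝ).det =
      (Matrix.of fun i k => f i k : Matrix (Fin n) (Fin n) ℝ).det * m.det *
        (Matrix.of fun i k => g i k : Matrix (Fin n) (Fin n) ℝ).det := by
  rw [← Matrix.det_transpose (Matrix.of fun i k => g i k), ← Matrix.det_mul, ← Matrix.det_mul]
  congr 1
  ext i s
  simp only [Matrix.of_apply, Matrix.mul_apply, Matrix.transpose_apply, hB, Finset.sum_mul]
  rw [Finset.sum_comm]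

theorem det_mixedHess (hx : x ∈ (extChartAt (𝓡 n) x₀).source)
    (hy : y ∈ (extChartAt (𝓡 n) y₀).source) (h : (x, y) ∉ singSet n c) :
    (mixedHess (n := n) c x y).det = tauDet (n := n) x₀ x *
      (mixedMat (costF (n := n) c x₀ y₀) (pairCoord x₀ x y₀ y)).det * tauDet (n := n) y₀ y := by
  rw [mixedHess_eq_mixedMat h]
  have := det_of_bilin (mixedForm (costF (n := n) c x₀ y₀) (pairCoord x₀ x y₀ y))
    (fun i => tau x₀ x (coordVec i)) (fun i => tau y₀ y (coordVec i)) _ mixedForm_apply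
  refine Eq.trans ?_ this
  congr 1
  ext i s
  exact mixedForm_chart hx hy h _ _

theorem detW_eq (h : IsLegendreChart (costF c x₀ y₀) e)
    (hsub : e.source ⊆ regularCoords c x₀ y₀) (hinj : IsTwisted n c)
    (hx : x ∈ (extChartAt (𝓡 n) x₀).source) (hT : IsPotentialMap n c u T)
    (hu : ContDiffAt ℝ 2 (loc x₀ u) (extChartAt (𝓡 n) x₀ x))
    (hj : jet (loc x₀ u) (extChartAt (𝓡 n) x₀ x) ∈ e.target) :
    detW n c u T x = tauDet (n := n) x₀ x ^ 2 *
      (gram (wHess (coefA c x₀ y₀ e) (loc x₀ u) (extChartAt (𝓡 n) x₀ x))).det := by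
  have := det_gramOn (fun i => tau x₀ x (coordVec i))
    (wHess (coefA c x₀ y₀ e) (loc x₀ u) (extChartAt (𝓡 n) x₀ x))
  refine Eq.trans ?_ this
  rw [detW]
  congr 1
  ext i j
  exact wForm_eq_wHess h hsub hinj hx hT hu hj _ _

end Potential

section Theta

variable {n : ℕ} {M N : Type*}
  [EMetricSpace M] [ChartedSpace (EuclideanSpace ℝ (Fin n)) M]
  [RiemannianBundle (fun x : M => TangentSpace (𝓡 n) x)]
  [EMetricSpace N] [ChartedSpace (EuclideanSpace ℝ (Fin n)) N]
  [RiemannianBundle (fun y : N => TangentSpace (𝓡 n) y)]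
  {c : M × N → WithTop ℝ} {x₀ x : M} {y₀ y : N} {u : M → ℝ} {T : M → N} {ρ : M → ℝ} {ρ' : N → ℝ}
  {e : OpenPartialHomeomorph (Eu n × Eu n) (Eu n × (Eu n →L[ℝ] ℝ))}

/-- The zeroth order term of the flow, in the charts at `x₀` and `y₀`. -/
def costB (c : M × N → WithTop ℝ) (ρ : M → ℝ) (ρ' : N → ℝ) (x₀ : M) (y₀ : N) (q : Eu n × Eu n) : ℝ :=
  Real.log (loc x₀ ρ q.1) + Real.log (gram (metricLoc x₀ q.1)).det / 2 -
    (Real.log (loc y₀ ρ' q.2) + Real.log (gram (metricLoc y₀ q.2)).det / 2) +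
    Real.log (mixedMat (costF c x₀ y₀) q).det

variable [IsManifold (𝓡 n) ∞ M] [IsManifold (𝓡 n) ∞ N]

/-- The transition determinants cancel: det w contributes that of M twice, the source density and
det c once each with the opposite sign, while the factor for N from the target density cancels
against det c. `costB` needs no absolute value because `Real.log` is even. -/
theorem theta_eq (h : IsLegendreChart (costF c x₀ y₀) e)
    (hsub : e.source ⊆ regularCoords c x₀ y₀) (hinj : IsTwisted n c)
    (hρ : ∀ x, 0 < ρ x) (hρ' : ∀ y, 0 < ρ' y)
    (hx : x ∈ (extChartAt (𝓡 n) x₀).source) (hT : IsPotentialMap n c u T)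
    (hu : ContDiffAt ℝ 2 (loc x₀ u) (extChartAt (𝓡 n) x₀ x))
    (hj : jet (loc x₀ u) (extChartAt (𝓡 n) x₀ x) ∈ e.target) (hpos : 0 < detW n c u T x) :
    theta n c ρ ρ' u T x =
      Real.log (gram (wHess (coefA c x₀ y₀ e) (loc x₀ u) (extChartAt (𝓡 n) x₀ x))).det -
        costB c ρ ρ' x₀ y₀ (e.symm (jet (loc x₀ u) (extChartAt (𝓡 n) x₀ x))) := by
  have hud : DifferentiableAt ℝ (loc x₀ u) (extChartAt (𝓡 n) x₀ x) := hu.differentiableAt (by simp)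
  obtain ⟨hy, hs⟩ := mem_source_of_jet_mem h hsub hinj hx hT hud hj
  have hjet := legendre_eq_jet h hx hy hT hud
  have hdW := detW_eq h hsub hinj hx hT hu hj
  have hne : (gram (wHess (coefA c x₀ y₀ e) (loc x₀ u) (extChartAt (𝓡 n) x₀ x))).det ≠ 0 := by
    intro h0; rw [hdW, h0, mul_zero] at hpos; exact lt_irrefl _ hpos
  have hm := det_mixedHess hx hy (hT x).1
  have hmne := h.det_ne _ hs
  have e1 : loc x₀ ρ (extChartAt (𝓡 n) x₀ x) = ρ x := by
    simp only [loc, (extChartAt (𝓡 n) x₀).left_inv hx]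
  have e2 : loc y₀ ρ' (extChartAt (𝓡 n) y₀ (T x)) = ρ' (T x) := by
    simp only [loc, (extChartAt (𝓡 n) y₀).left_inv hy]
  rw [← hjet, e.left_inv hs, theta, costB, hdW, hm]
  simp only [pairCoord] at hmne ⊢
  rw [e1, e2, Real.log_mul (hρ x).ne' (volDensity_pos x).ne',
    Real.log_mul (hρ' _).ne' (volDensity_pos (T x)).ne', log_volDensity hx, log_volDensity hy,
    Real.log_mul (pow_ne_zero 2 (tauDet_ne_zero hx)) hne, Real.log_pow, Real.log_abs, Real.log_abs,
    Real.log_abs,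
    Real.log_mul (mul_ne_zero (tauDet_ne_zero hx) hmne) (tauDet_ne_zero hy),
    Real.log_mul (tauDet_ne_zero hx) hmne]
  push_cast
  ring

variable [IsContMDiffRiemannianBundle (𝓡 n) ∞ (EuclideanSpace ℝ (Fin n))
      (fun x : M => TangentSpace (𝓡 n) x)]
  [IsContMDiffRiemannianBundle (𝓡 n) ∞ (EuclideanSpace ℝ (Fin n))
      (fun y : N => TangentSpace (𝓡 n) y)]

theorem contDiffAt_det_metricLoc {a : Eu n} (ha : a ∈ (extChartAt (𝓡 n) x₀).target) :
    ContDiffAt ℝ ∞ (fun a => Real.log (gram (metricLoc x₀ a)).det / 2) a := by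
  have hs := (extChartAt (𝓡 n) x₀).map_target ha
  have h1 := contDiffAt_metricLoc hs
  have h2 := det_metricLoc_pos hs
  rw [(extChartAt (𝓡 n) x₀).right_inv ha] at h1 h2
  suffices h3 : ContDiffAt ℝ ∞ (fun a => (gram (metricLoc x₀ a)).det) a from
    (h3.log h2.ne').div_const _
  refine contDiffAt_det (f := fun a => gram (metricLoc x₀ a)) fun i j => ?_
  exact (h1.clm_apply contDiffAt_const).clm_apply contDiffAt_const

theorem contDiffAt_costB (h : IsLegendreChart (costF c x₀ y₀) e)
    (hsub : e.source ⊆ regularCoords c x₀ y₀)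
    (hρ : ContMDiff (𝓡 n) 𝓘(ℝ, ℝ) ∞ ρ) (hρpos : ∀ x, 0 < ρ x)
    (hρ' : ContMDiff (𝓡 n) 𝓘(ℝ, ℝ) ∞ ρ') (hρ'pos : ∀ y, 0 < ρ' y) {q : Eu n × Eu n}
    (hq : q ∈ e.source) : ContDiffAt ℝ ∞ (costB c ρ ρ' x₀ y₀) q := by
  obtain ⟨⟨h1, h2⟩, -⟩ := hsub hq
  have m1 := ((contDiffAt_loc_of_contMDiff hρ h1).log (hρpos _).ne').add
    (contDiffAt_det_metricLoc h1)
  have m2 := ((contDiffAt_loc_of_contMDiff hρ' h2).log (hρ'pos _).ne').add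
    (contDiffAt_det_metricLoc h2)
  have m3 := (contDiffAt_det_mixedMat (h.smooth q hq)).log (h.det_ne q hq)
  exact ((ContDiffAt.comp q m1 contDiffAt_fst).sub (ContDiffAt.comp q m2 contDiffAt_snd)).add m3

end Theta

/-! ### Solutions of the flow in charts. -/

section TimeInterval

theorem convex_timeInterval (l : EReal) : Convex ℝ (timeInterval l) := by
  refine OrdConnected.convex ⟨fun a ha b hb t ht => ⟨ha.1.trans ht.1, ?_⟩⟩
  exact lt_of_le_of_lt (EReal.coe_le_coe_iff.2 ht.2) hb.2

theorem zero_mem_timeInterval {l : EReal} (hl : 0 < l) : (0 : ℝ) ∈ timeInterval l :=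
  ⟨le_rfl, by simpa using hl⟩

theorem Icc_subset_timeInterval {l : EReal} {t : ℝ} (ht : t ∈ timeInterval l) :
    Icc 0 t ⊆ timeInterval l := fun _ hs =>
  ⟨hs.1, lt_of_le_of_lt (EReal.coe_le_coe_iff.2 hs.2) ht.2⟩

theorem exists_gt_mem_timeInterval {l : EReal} {t : ℝ} (ht : t ∈ timeInterval l) :
    ∃ s, t < s ∧ s ∈ timeInterval l := by
  obtain ⟨s, h1, h2⟩ := EReal.lt_iff_exists_real_btwn.1 ht.2
  have h3 : t < s := EReal.coe_lt_coe_iff.1 h1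
  exact ⟨s, h3, ht.1.trans h3.le, h2⟩

theorem timeInterval_mem_nhds {l : EReal} {t : ℝ} (ht : t ∈ timeInterval l) (h0 : 0 < t) :
    timeInterval l ∈ 𝓝 t := by
  obtain ⟨s, h1, h2⟩ := exists_gt_mem_timeInterval ht
  exact mem_of_superset (Icc_mem_nhds h0 h1) (Icc_subset_timeInterval h2)

theorem nonempty_interior_timeInterval {l : EReal} (hl : 0 < l) :
    (interior (timeInterval l)).Nonempty := by
  obtain ⟨s, h1, h2⟩ := exists_gt_mem_timeInterval (zero_mem_timeInterval hl)
  refine ⟨s / 2, mem_interior_iff_mem_nhds.2 ?_⟩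
  exact mem_of_superset (Icc_mem_nhds (by linarith) (by linarith)) (Icc_subset_timeInterval h2)

theorem uniqueDiffOn_timeInterval {l : EReal} (hl : 0 < l) : UniqueDiffOn ℝ (timeInterval l) :=
  uniqueDiffOn_convex (convex_timeInterval l) (nonempty_interior_timeInterval hl)

theorem timeInterval_subset_closure {l : EReal} (hl : 0 < l) :
    timeInterval l ⊆ closure (interior (timeInterval l)) := by
  rw [(convex_timeInterval l).closure_interior_eq_closure_of_nonempty_interior
    (nonempty_interior_timeInterval hl)]
  exact subset_closure

end TimeInterval

section Solution

variable {n : ℕ} {M N : Type*}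
  [EMetricSpace M] [ChartedSpace (EuclideanSpace ℝ (Fin n)) M]
  [RiemannianBundle (fun x : M => TangentSpace (𝓡 n) x)]
  [EMetricSpace N] [ChartedSpace (EuclideanSpace ℝ (Fin n)) N]
  [RiemannianBundle (fun y : N => TangentSpace (𝓡 n) y)]
  {c : M × N → WithTop ℝ} {x₀ x : M} {y₀ y : N} {ρ : M → ℝ} {ρ' : N → ℝ}
  {e : OpenPartialHomeomorph (Eu n × Eu n) (Eu n × (Eu n →L[ℝ] ℝ))}
  {l : EReal} {u : ℝ → M → ℝ} {T : ℝ → M → N} {t : ℝ}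

/-- The right-hand side of the flow in the chart at `x₀`. -/
def thetaLoc (c : M × N → WithTop ℝ) (ρ : M → ℝ) (ρ' : N → ℝ) (u : ℝ → M → ℝ) (T : ℝ → M → N)
    (x₀ : M) (t : ℝ) (a : Eu n) : ℝ := loc x₀ (fun x => theta n c ρ ρ' (u t) (T t) x) a

namespace IsFlowSolution

variable [IsManifold (𝓡 n) ∞ M]

theorem contDiffOn_loc (hs : IsFlowSolution n c ρ ρ' l u T) (x₀ : M) :
    ContDiffOn ℝ ∞ (fun q : Eu n × ℝ => loc x₀ (u q.2) q.1)
      ((extChartAt (𝓡 n) x₀).target ×ˢ timeInterval l) := by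
  rw [← contMDiffOn_iff_contDiffOn]
  have h1 : ContMDiffOn 𝓘(ℝ, Eu n × ℝ) (𝓡 n) ∞
      (fun q : Eu n × ℝ => (extChartAt (𝓡 n) x₀).symm q.1)
      ((extChartAt (𝓡 n) x₀).target ×ˢ timeInterval l) :=
    (contMDiffOn_extChartAt_symm x₀).comp (t := (extChartAt (𝓡 n) x₀).target)
      (contDiff_fst.contMDiff.contMDiffOn) (fun q hq => hq.1)
  have h2 : ContMDiffOn 𝓘(ℝ, Eu n × ℝ) 𝓘(ℝ, ℝ) ∞ (fun q : Eu n × ℝ => q.2)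
      ((extChartAt (𝓡 n) x₀).target ×ˢ timeInterval l) := contDiff_snd.contMDiff.contMDiffOn
  exact hs.smooth.comp (h1.prodMk h2) (fun q hq => ⟨mem_univ _, hq.2⟩)

theorem contDiffOn_thetaLoc (hl : 0 < l) (hs : IsFlowSolution n c ρ ρ' l u T) (x₀ : M) :
    ContDiffOn ℝ ∞ (fun q : Eu n × ℝ => thetaLoc c ρ ρ' u T x₀ q.2 q.1)
      ((extChartAt (𝓡 n) x₀).target ×ˢ timeInterval l) :=
  contDiffOn_time_deriv (isOpen_extChartAt_target x₀) (uniqueDiffOn_timeInterval hl)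
    (hs.contDiffOn_loc x₀) fun a _ t ht => hs.equation t ht ((extChartAt (𝓡 n) x₀).symm a)

theorem contDiffAt_of_contDiffOn {U : Set (Eu n)} {J : Set ℝ} {h : Eu n × ℝ → ℝ}
    (hh : ContDiffOn ℝ ∞ h (U ×ˢ J)) (hU : IsOpen U) {a : Eu n} (ha : a ∈ U) (ht : t ∈ J) :
    ContDiffAt ℝ ∞ (fun a => h (a, t)) a := by
  have : ContDiffOn ℝ ∞ (fun a => h (a, t)) U :=
    hh.comp (contDiff_id.prodMk contDiff_const).contDiffOn (fun a ha => ⟨ha, ht⟩)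
  exact this.contDiffAt (hU.mem_nhds ha)

theorem contDiffAt_loc (hs : IsFlowSolution n c ρ ρ' l u T) (ht : t ∈ timeInterval l)
    {a : Eu n} (ha : a ∈ (extChartAt (𝓡 n) x₀).target) : ContDiffAt ℝ ∞ (loc x₀ (u t)) a :=
  contDiffAt_of_contDiffOn (hs.contDiffOn_loc x₀) (isOpen_extChartAt_target x₀) ha ht

theorem contDiffAt_thetaLoc (hl : 0 < l) (hs : IsFlowSolution n c ρ ρ' l u T)
    (ht : t ∈ timeInterval l) {a : Eu n} (ha : a ∈ (extChartAt (𝓡 n) x₀).target) :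
    ContDiffAt ℝ ∞ (thetaLoc c ρ ρ' u T x₀ t) a :=
  contDiffAt_of_contDiffOn (hs.contDiffOn_thetaLoc hl x₀) (isOpen_extChartAt_target x₀) ha ht

theorem continuousOn_jet (hl : 0 < l) (hs : IsFlowSolution n c ρ ρ' l u T) (x₀ : M) :
    ContinuousOn (fun q : Eu n × ℝ => jet (loc x₀ (u q.2)) q.1)
      ((extChartAt (𝓡 n) x₀).target ×ˢ timeInterval l) :=
  continuousOn_fst.prodMk (contDiffOn_fderiv_partial (isOpen_extChartAt_target x₀)
    (uniqueDiffOn_timeInterval hl) (hs.contDiffOn_loc x₀)).continuousOn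

theorem continuousOn_hess (hl : 0 < l) (hs : IsFlowSolution n c ρ ρ' l u T) (x₀ : M) :
    ContinuousOn (fun q : Eu n × ℝ => fderiv ℝ (fderiv ℝ (loc x₀ (u q.2))) q.1)
      ((extChartAt (𝓡 n) x₀).target ×ˢ timeInterval l) :=
  (contDiffOn_fderiv_partial (isOpen_extChartAt_target x₀) (uniqueDiffOn_timeInterval hl)
    (contDiffOn_fderiv_partial (isOpen_extChartAt_target x₀)
    (uniqueDiffOn_timeInterval hl) (hs.contDiffOn_loc x₀))).continuousOn

/-- The time derivative of the differential of the solution. -/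
theorem hasDerivWithinAt_fderiv (hl : 0 < l) (hs : IsFlowSolution n c ρ ρ' l u T)
    (ht : t ∈ timeInterval l) {a : Eu n} (ha : a ∈ (extChartAt (𝓡 n) x₀).target) :
    HasDerivWithinAt (fun s => fderiv ℝ (loc x₀ (u s)) a)
      (fderiv ℝ (thetaLoc c ρ ρ' u T x₀ t) a) (timeInterval l) t :=
  hasDerivWithinAt_fderiv_partial (k := fun q => thetaLoc c ρ ρ' u T x₀ q.2 q.1)
    (isOpen_extChartAt_target x₀) (uniqueDiffOn_timeInterval hl)
    (timeInterval_subset_closure hl) (hs.contDiffOn_loc x₀)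
    (fun a _ t ht => hs.equation t ht ((extChartAt (𝓡 n) x₀).symm a)) ha ht

/-- The time derivative of the Hessian of the solution. -/
theorem hasDerivWithinAt_hess (hl : 0 < l) (hs : IsFlowSolution n c ρ ρ' l u T)
    (ht : t ∈ timeInterval l) {a : Eu n} (ha : a ∈ (extChartAt (𝓡 n) x₀).target) :
    HasDerivWithinAt (fun s => fderiv ℝ (fderiv ℝ (loc x₀ (u s))) a)
      (fderiv ℝ (fderiv ℝ (thetaLoc c ρ ρ' u T x₀ t)) a) (timeInterval l) t :=
  hasDerivWithinAt_fderiv_partial (k := fun q => fderiv ℝ (thetaLoc c ρ ρ' u T x₀ q.2) q.1)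
    (isOpen_extChartAt_target x₀) (uniqueDiffOn_timeInterval hl)
    (timeInterval_subset_closure hl)
    (contDiffOn_fderiv_partial (isOpen_extChartAt_target x₀)
      (uniqueDiffOn_timeInterval hl) (hs.contDiffOn_loc x₀))
    (fun _ ha _ ht => hs.hasDerivWithinAt_fderiv hl ht ha) ha ht

theorem hasDerivWithinAt_jet (hl : 0 < l) (hs : IsFlowSolution n c ρ ρ' l u T)
    (ht : t ∈ timeInterval l) {a : Eu n} (ha : a ∈ (extChartAt (𝓡 n) x₀).target) :
    HasDerivWithinAt (fun s => jet (loc x₀ (u s)) a)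
      ((0 : Eu n), fderiv ℝ (thetaLoc c ρ ρ' u T x₀ t) a) (timeInterval l) t :=
  (hasDerivWithinAt_const t _ a).prodMk (hs.hasDerivWithinAt_fderiv hl ht ha)

theorem hasDerivWithinAt_comp_jet {Z : Type*} [NormedAddCommGroup Z] [NormedSpace ℝ Z]
    {f : Eu n × (Eu n →L[ℝ] ℝ) → Z} (hl : 0 < l) (hs : IsFlowSolution n c ρ ρ' l u T)
    (ht : t ∈ timeInterval l) {a : Eu n} (ha : a ∈ (extChartAt (𝓡 n) x₀).target)
    (hf : DifferentiableAt ℝ f (jet (loc x₀ (u t)) a)) :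
    HasDerivWithinAt (fun s => f (jet (loc x₀ (u s)) a))
      (fderiv ℝ f (jet (loc x₀ (u t)) a) (0, fderiv ℝ (thetaLoc c ρ ρ' u T x₀ t) a))
      (timeInterval l) t :=
  hf.hasFDerivAt.comp_hasDerivWithinAt t (hs.hasDerivWithinAt_jet hl ht ha)

theorem hasDerivWithinAt_wHess {A : Eu n × (Eu n →L[ℝ] ℝ) → Eu n →L[ℝ] Eu n →L[ℝ] ℝ} (hl : 0 < l)
    (hs : IsFlowSolution n c ρ ρ' l u T)
    (ht : t ∈ timeInterval l) {a : Eu n} (ha : a ∈ (extChartAt (𝓡 n) x₀).target)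
    (hA : DifferentiableAt ℝ A (jet (loc x₀ (u t)) a)) (V : Eu n) :
    HasDerivWithinAt (fun s => wHess A (loc x₀ (u s)) a V V)
      (fderiv ℝ (fderiv ℝ (thetaLoc c ρ ρ' u T x₀ t)) a V V -
        fderiv ℝ A (jet (loc x₀ (u t)) a) (0, fderiv ℝ (thetaLoc c ρ ρ' u T x₀ t) a) V V)
      (timeInterval l) t :=
  (evalDiag V).hasFDerivAt.comp_hasDerivWithinAt t
    ((hs.hasDerivWithinAt_hess hl ht ha).sub (hs.hasDerivWithinAt_comp_jet hl ht ha hA))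

end IsFlowSolution

end Solution

/-! ### Preservation of convexity. -/

section Connected

theorem mem_of_relatively_open {X : Type*} [TopologicalSpace X] {J S S' : Set X} (hJ : IsPreconnected J)
    (hS : ∀ s ∈ J, s ∈ S → ∀ᶠ r in 𝓝[J] s, r ∈ S)
    (hS' : ∀ s ∈ J, s ∈ S' → ∀ᶠ r in 𝓝[J] s, r ∈ S') (hcover : ∀ s ∈ J, s ∈ S ∨ s ∈ S')
    (hdisj : ∀ s, s ∈ S → s ∈ S' → False) {a b : X} (ha : a ∈ J) (haS : a ∈ S) (hb : b ∈ J) :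
    b ∈ S := by
  have hi : ∀ {R : Set X}, (∀ s ∈ J, s ∈ R → ∀ᶠ r in 𝓝[J] s, r ∈ R) → ∀ s ∈ J, s ∈ R →
      s ∈ interior (R ∪ Jᶜ) := by
    intro R hR s hs hsR
    rw [mem_interior_iff_mem_nhds]
    filter_upwards [eventually_nhdsWithin_iff.1 (hR s hs hsR)] with r hr
    by_cases h : r ∈ J
    · exact Or.inl (hr h)
    · exact Or.inr h
  by_contra hbS
  have hbS' := (hcover b hb).resolve_left hbS
  obtain ⟨s, hs, h1, h2⟩ := hJ _ _ isOpen_interior isOpen_interior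
    (fun s hs => (hcover s hs).imp (hi hS s hs) (hi hS' s hs))
    ⟨a, ha, hi hS a ha haS⟩ ⟨b, hb, hi hS' b hb hbS'⟩
  exact hdisj s ((interior_subset h1).resolve_right (fun h => h hs))
    ((interior_subset h2).resolve_right (fun h => h hs))

end Connected

section PosDef

variable {n : ℕ}

theorem posDef_of_sphere {W : Eu n →L[ℝ] Eu n →L[ℝ] ℝ} (h : ∀ z ∈ Metric.sphere (0 : Eu n) 1, 0 < W z z)
    {z : Eu n} (hz : z ≠ 0) : 0 < W z z := by
  have hn : 0 < ‖z‖ := norm_pos_iff.2 hz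
  have h1 := h (‖z‖⁻¹ • z) (by simp [norm_smul, hn.ne'])
  simp only [map_smul, _root_.smul_apply, smul_eq_mul] at h1
  exact pos_of_mul_pos_right (pos_of_mul_pos_right h1 (by positivity)) (by positivity)

/-- Positive definiteness is an open condition. -/
theorem isOpen_posDef : IsOpen {W : Eu n →L[ℝ] Eu n →L[ℝ] ℝ | ∀ z, z ≠ 0 → 0 < W z z} := by
  rw [isOpen_iff_mem_nhds]
  intro W hW
  have h := (isCompact_sphere (0 : Eu n) 1).eventually_forall_of_forall_eventually (x₀ := W)
    (P := fun W z => 0 < W z z) (fun z hz => by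
      have hc : ContinuousAt (fun q : (Eu n →L[ℝ] Eu n →L[ℝ] ℝ) × Eu n => q.1 q.2 q.2) (W, z) := by
        have : Continuous fun q : (Eu n →L[ℝ] Eu n →L[ℝ] ℝ) × Eu n => q.1 q.2 q.2 :=
          (continuous_fst.clm_apply continuous_snd).clm_apply continuous_snd
        exact this.continuousAt
      refine hc.eventually (lt_mem_nhds (hW z ?_))
      rintro rfl
      simp at hz)
  filter_upwards [h] with W' hW' z hz
  exact posDef_of_sphere hW' hz

/-- A semidefinite symmetric form with a null vector is degenerate. -/
theorem det_gram_eq_zero {W : Eu n →L[ℝ] Eu n →L[ℝ] ℝ} (hs : ∀ x y, W x y = W y x)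
    (h : ∀ x, 0 ≤ W x x) {z : Eu n} (hz : z ≠ 0) (hWz : W z z = 0) : (gram W).det = 0 := by
  have hzero : ∀ y, W z y = 0 := by
    intro y
    by_contra hne
    -- With W z z = 0 the quadratic term drops out, and a nonnegative affine function of r has zero
    -- slope; so z lies in the kernel of W.
    have key : ∀ r : ℝ, 0 ≤ W y y + 2 * r * W z y := by
      intro r
      have := h (y + r • z)
      simp only [map_add, map_smul, _root_.add_apply, _root_.smul_apply, smul_eq_mul, hWz] at this
      rw [hs y z] at this
      linarith
    have := key (-(W y y + 1) / (2 * W z y))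
    have e : 2 * (-(W y y + 1) / (2 * W z y)) * W z y = -(W y y + 1) := by
      field_simp
    rw [e] at this
    linarith
  refine Matrix.exists_vecMul_eq_zero_iff.1 ⟨z.ofLp, ?_, ?_⟩
  · intro h0; apply hz; ext i; exact congrFun h0 i
  · ext j
    have h1 := hzero (coordVec j)
    conv_lhs at h1 => rw [← sum_coordVec z, map_sum, _root_.sum_apply]
    simpa [Matrix.vecMul, dotProduct, gram] using h1

end PosDef

section Symmetry

variable {n : ℕ} {M N : Type*}
  [TopologicalSpace M] [ChartedSpace (EuclideanSpace ℝ (Fin n)) M]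
  [TopologicalSpace N] [ChartedSpace (EuclideanSpace ℝ (Fin n)) N]
  {c : M × N → WithTop ℝ} {x₀ x : M} {y₀ y : N}
  {e : OpenPartialHomeomorph (Eu n × Eu n) (Eu n × (Eu n →L[ℝ] ℝ))}

theorem coefA_symm (h : IsLegendreChart (costF c x₀ y₀) e) {p : Eu n × (Eu n →L[ℝ] ℝ)}
    (hp : p ∈ e.target) (V W : Eu n) : coefA c x₀ y₀ e p V W = coefA c x₀ y₀ e p W V := by
  have hF := (h.smooth _ (e.map_target hp)).of_le (m := 2) ENat.LEInfty.out
  have h1 := fderiv_fderiv_symm (contDiffAt_slice hF) V W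
  rw [fderiv_fderiv_slice hF] at h1
  exact neg_injective h1

theorem contDiffAt_coefA (h : IsLegendreChart (costF c x₀ y₀) e) {p : Eu n × (Eu n →L[ℝ] ℝ)}
    (hp : p ∈ e.target) : ContDiffAt ℝ ∞ (coefA c x₀ y₀ e) p :=
  h.contDiffAt_comp_symm hp (contDiffAt_negHessX (h.smooth _ (e.map_target hp)))

theorem wHess_coefA_symm (h : IsLegendreChart (costF c x₀ y₀) e) {f : Eu n → ℝ} {a : Eu n}
    (hf : ContDiffAt ℝ 2 f a) (hj : jet f a ∈ e.target) (V W : Eu n) :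
    wHess (coefA c x₀ y₀ e) f a V W = wHess (coefA c x₀ y₀ e) f a W V := by
  simp only [wHess, _root_.sub_apply]
  rw [fderiv_fderiv_symm hf, coefA_symm h hj]

end Symmetry

/-- The two slices through (a, t): the spatial one is a full neighbourhood because the chart target
is open, the temporal one stays relative to the interval and so is one-sided at t = 0. -/
theorem eventually_of_nhdsWithin {n : ℕ} {M : Type*} [TopologicalSpace M]
    [ChartedSpace (EuclideanSpace ℝ (Fin n)) M] {x₀ : M} {l : EReal} {t : ℝ}
    {P : Eu n × ℝ → Prop} {a : Eu n}
    (ha : a ∈ (extChartAt (𝓡 n) x₀).target) (ht : t ∈ timeInterval l)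
    (h : ∀ᶠ q in 𝓝[(extChartAt (𝓡 n) x₀).target ×ˢ timeInterval l] (a, t), P q) :
    (∀ᶠ a' in 𝓝 a, P (a', t)) ∧ ∀ᶠ s in 𝓝[timeInterval l] t, P (a, s) := by
  rw [nhdsWithin_prod_eq, (isOpen_extChartAt_target (I := 𝓡 n) x₀).nhdsWithin_eq ha] at h
  constructor
  · have : Tendsto (fun a' : Eu n => (a', t)) (𝓝 a) (𝓝 a ×ˢ 𝓝[timeInterval l] t) :=
      tendsto_id.prodMk (tendsto_const_pure.mono_right (pure_le_nhdsWithin ht))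
    exact this.eventually h
  · have : Tendsto (fun s : ℝ => (a, s)) (𝓝[timeInterval l] t) (𝓝 a ×ˢ 𝓝[timeInterval l] t) :=
      tendsto_const_nhds.prodMk tendsto_id
    exact this.eventually h

namespace IsFlowSolution

variable {n : ℕ} {M N : Type*}
  [EMetricSpace M] [ChartedSpace (EuclideanSpace ℝ (Fin n)) M]
  [RiemannianBundle (fun x : M => TangentSpace (𝓡 n) x)]
  [EMetricSpace N] [ChartedSpace (EuclideanSpace ℝ (Fin n)) N]
  [RiemannianBundle (fun y : N => TangentSpace (𝓡 n) y)]
  {c : M × N → WithTop ℝ} {x₀ x : M} {y₀ y : N} {ρ : M → ℝ} {ρ' : N → ℝ}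
  {e : OpenPartialHomeomorph (Eu n × Eu n) (Eu n × (Eu n →L[ℝ] ℝ))}
  {l : EReal} {u : ℝ → M → ℝ} {T : ℝ → M → N} {t : ℝ}
  [IsManifold (𝓡 n) ∞ M]

theorem eventually_jet_mem (hl : 0 < l) (hs : IsFlowSolution n c ρ ρ' l u T)
    (ht : t ∈ timeInterval l) {a : Eu n} (ha : a ∈ (extChartAt (𝓡 n) x₀).target)
    (hj : jet (loc x₀ (u t)) a ∈ e.target) :
    ∀ᶠ q : Eu n × ℝ in 𝓝[(extChartAt (𝓡 n) x₀).target ×ˢ timeInterval l] (a, t),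
      jet (loc x₀ (u q.2)) q.1 ∈ e.target :=
  (hs.continuousOn_jet hl x₀ (a, t) ⟨ha, ht⟩).eventually (e.open_target.mem_nhds hj)

theorem continuousWithinAt_wHess (hl : 0 < l) (hs : IsFlowSolution n c ρ ρ' l u T)
    (h : IsLegendreChart (costF c x₀ y₀) e)
    (ht : t ∈ timeInterval l) {a : Eu n} (ha : a ∈ (extChartAt (𝓡 n) x₀).target)
    (hj : jet (loc x₀ (u t)) a ∈ e.target) :
    ContinuousWithinAt (fun q : Eu n × ℝ => wHess (coefA c x₀ y₀ e) (loc x₀ (u q.2)) q.1)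
      ((extChartAt (𝓡 n) x₀).target ×ˢ timeInterval l) (a, t) :=
  (hs.continuousOn_hess hl x₀ (a, t) ⟨ha, ht⟩).sub
    (ContinuousAt.comp_continuousWithinAt (g := coefA c x₀ y₀ e)
      (contDiffAt_coefA h hj).continuousAt
      (hs.continuousOn_jet hl x₀ (a, t) ⟨ha, ht⟩))

variable [IsManifold (𝓡 n) ∞ N]

/-- There is a chart of the cost around each point of the graph. -/
theorem exists_chart (hdet : IsNondegenerate n c) (hs : IsFlowSolution n c ρ ρ' l u T)
    (ht : t ∈ timeInterval l) (x : M) :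
    ∃ e : OpenPartialHomeomorph (Eu n × Eu n) (Eu n × (Eu n →L[ℝ] ℝ)),
      IsLegendreChart (costF c x (T t x)) e ∧ e.source ⊆ regularCoords c x (T t x) ∧
        jet (loc x (u t)) (extChartAt (𝓡 n) x x) ∈ e.target := by
  obtain ⟨e, h1, h2, h3⟩ := exists_costChart hdet (hs.potential t ht x).1
  refine ⟨e, h1, h3, ?_⟩
  rw [← legendre_eq_jet h1 (mem_extChartAt_source x) (mem_extChartAt_source (T t x))
    (hs.potential t ht)
    ((hs.contDiffAt_loc ht (mem_extChartAt_target x)).differentiableAt (by simp))]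
  exact e.map_source h2

/-- The form `w` in a fixed chart. -/
theorem wForm_eq (hinj : IsTwisted n c) (hs : IsFlowSolution n c ρ ρ' l u T)
    (h : IsLegendreChart (costF c x₀ y₀) e) (hsub : e.source ⊆ regularCoords c x₀ y₀)
    (hx : x ∈ (extChartAt (𝓡 n) x₀).source) (ht : t ∈ timeInterval l)
    (hj : jet (loc x₀ (u t)) (extChartAt (𝓡 n) x₀ x) ∈ e.target) (V W : Eu n) :
    wForm c (u t) (T t) x V W =
      wHess (coefA c x₀ y₀ e) (loc x₀ (u t)) (extChartAt (𝓡 n) x₀ x) (tau x₀ x V) (tau x₀ x W) :=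
  wForm_eq_wHess h hsub hinj hx (hs.potential t ht)
    ((hs.contDiffAt_loc ht ((extChartAt (𝓡 n) x₀).map_source hx)).of_le ENat.LEInfty.out) hj V W

/-- Local strict `c`-convexity is preserved. -/
theorem convex (hinj : IsTwisted n c) (hdet : IsNondegenerate n c) (hl : 0 < l)
    (hs : IsFlowSolution n c ρ ρ' l u T) (ht : t ∈ timeInterval l) :
    IsLocallyStrictlyCConvex n c (u t) (T t) := by
  intro x V₀ hV₀
  set J := timeInterval l
  -- With `x` fixed, the times of positive definiteness and the times with a negative direction are
  -- both relatively open, and the interval is connected.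
  set S : Set ℝ := {s | ∀ V : Eu n, V ≠ 0 → 0 < wForm c (u s) (T s) x V V} with hS
  set S' : Set ℝ := {s | ∃ V : Eu n, wForm c (u s) (T s) x V V < 0} with hS'
  have hW : ∀ s ∈ J, ∃ W : ℝ → Eu n →L[ℝ] Eu n →L[ℝ] ℝ, ContinuousWithinAt W J s ∧
      (∀ᶠ r in 𝓝[J] s, ∀ V : Eu n, wForm c (u r) (T r) x V V = W r V V) ∧
      (∀ V V', W s V V' = W s V' V) ∧ (gram (W s)).det ≠ 0 := by
    intro s hsJ
    obtain ⟨e, h1, h2, h3⟩ := hs.exists_chart hdet hsJ x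
    have hat := mem_extChartAt_target (I := 𝓡 n) x
    refine ⟨fun r => wHess (coefA c x (T s x) e) (loc x (u r)) (extChartAt (𝓡 n) x x), ?_, ?_,
      wHess_coefA_symm h1 ((hs.contDiffAt_loc hsJ hat).of_le ENat.LEInfty.out) h3, ?_⟩
    · exact (hs.continuousWithinAt_wHess hl h1 hsJ hat h3).comp
        (by fun_prop : Continuous fun r : ℝ => (extChartAt (𝓡 n) x x, r)).continuousWithinAt
        (fun r hr => ⟨hat, hr⟩)
    · filter_upwards [(eventually_of_nhdsWithin hat hsJ
        (hs.eventually_jet_mem hl hsJ hat h3)).2, self_mem_nhdsWithin] with r hr hrJ V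
      have := hs.wForm_eq hinj h1 h2 (mem_extChartAt_source x) hrJ hr V V
      rwa [tau_self] at this
    · intro h0
      have hd := hs.det_pos s hsJ x
      rw [detW_eq h1 h2 hinj (mem_extChartAt_source x) (hs.potential s hsJ)
        ((hs.contDiffAt_loc hsJ hat).of_le ENat.LEInfty.out) h3, h0, mul_zero] at hd
      exact lt_irrefl _ hd
  have hSo : ∀ s ∈ J, s ∈ S → ∀ᶠ r in 𝓝[J] s, r ∈ S := by
    intro s hsJ hsS
    obtain ⟨W, h1, h2, -, -⟩ := hW s hsJ
    have h0 := h2.self_of_nhdsWithin hsJ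
    have := h1.eventually (isOpen_posDef.mem_nhds (fun V hV => by
      rw [← h0]; exact hsS V hV))
    filter_upwards [h2, this] with r h3 h4 V hV
    rw [h3]; exact h4 V hV
  have hSo' : ∀ s ∈ J, s ∈ S' → ∀ᶠ r in 𝓝[J] s, r ∈ S' := by
    rintro s hsJ ⟨V, hV⟩
    obtain ⟨W, h1, h2, -, -⟩ := hW s hsJ
    have h0 := h2.self_of_nhdsWithin hsJ
    rw [h0] at hV
    have hc : ContinuousWithinAt (fun r => W r V V) J s :=
      (evalDiag V).continuous.continuousAt.comp_continuousWithinAt h1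
    filter_upwards [h2, hc.eventually (gt_mem_nhds hV)] with r h3 h4
    exact ⟨V, by rw [h3]; exact h4⟩
  -- A time in neither set would have w semidefinite with a null vector, hence det w = 0.
  have hcover : ∀ s ∈ J, s ∈ S ∨ s ∈ S' := by
    intro s hsJ
    obtain ⟨W, h1, h2, h4, h5⟩ := hW s hsJ
    have h0 := h2.self_of_nhdsWithin hsJ
    by_contra! hcon
    obtain ⟨hc1, hc2⟩ := hcon
    simp only [hS, hS', mem_ofPred_eq, not_forall, not_exists, not_lt] at hc1 hc2
    obtain ⟨V, hV, hV'⟩ := hc1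
    refine h5 (det_gram_eq_zero h4 (fun X => by rw [← h0]; exact hc2 X) hV ?_)
    rw [← h0]; exact le_antisymm hV' (hc2 V)
  have hdisj : ∀ s, s ∈ S → s ∈ S' → False := by
    rintro s h1 ⟨V, hV⟩
    by_cases hV0 : V = 0
    · have hz : wForm c (u s) (T s) x (0 : Eu n) (0 : Eu n) = 0 := map_zero _
      rw [hV0] at hV
      exact lt_irrefl _ (hz ▸ hV)
    · exact lt_asymm hV (h1 V hV0)
  have h0J : (0 : ℝ) ∈ J := zero_mem_timeInterval hl
  exact mem_of_relatively_open (convex_timeInterval l).isPreconnected hSo hSo' hcover hdisj h0J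
    (fun V hV => hs.initial_convex x V hV) ht V₀ hV₀

end IsFlowSolution

/-! ### The maximum principle. -/

section MaximumPrinciple

/-- A weak parabolic maximum principle above the level `K`. -/
theorem maximum_principle {X : Type*} [TopologicalSpace X] [CompactSpace X] {l : EReal}
    {f : X → ℝ → ℝ} {K t₁ : ℝ} (ht₁ : t₁ ∈ timeInterval l)
    (husc : UpperSemicontinuousOn (fun q : X × ℝ => f q.1 q.2) (univ ×ˢ Icc 0 t₁))
    (h : ∀ t ∈ timeInterval l, 0 < t → ∀ x, (∀ y, f y t ≤ f x t) → K < f x t →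
      ∃ (g : ℝ → ℝ) (d : ℝ), d ≤ 0 ∧ (∀ s ∈ timeInterval l, g s ≤ f x s) ∧ g t = f x t ∧
        HasDerivWithinAt g d (timeInterval l) t)
    (h0 : ∀ x, f x 0 ≤ K) (x₁ : X) : f x₁ t₁ ≤ K := by
  by_contra! hlt
  have ht0 : 0 < t₁ := by
    rcases ht₁.1.eq_or_lt with h | h
    · rw [← h] at hlt; exact absurd hlt (h0 x₁).not_gt
    · exact h
  -- Subtracting ε t costs half of the excess over K at time t₁, so the maximum of the perturbed
  -- function still lies above K and hence at a positive time.
  set ε : ℝ := (f x₁ t₁ - K) / (2 * t₁) with hε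
  have hεpos : 0 < ε := div_pos (by linarith) (by linarith)
  have hεt : ε * t₁ = (f x₁ t₁ - K) / 2 := by rw [hε]; field_simp
  have husc' : UpperSemicontinuousOn (fun q : X × ℝ => f q.1 q.2 + -(ε * q.2)) (univ ×ˢ Icc 0 t₁) :=
    husc.add (by fun_prop : Continuous fun q : X × ℝ => -(ε * q.2)).continuousOn.upperSemicontinuousOn
  have hmem : (x₁, t₁) ∈ (univ : Set X) ×ˢ Icc 0 t₁ := ⟨mem_univ _, ht₁.1, le_rfl⟩
  obtain ⟨⟨x, t⟩, ⟨-, ht⟩, hmax⟩ := husc'.exists_isMaxOn ⟨_, hmem⟩ (isCompact_univ.prod isCompact_Icc)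
  change t ∈ Icc 0 t₁ at ht
  have hmax' : ∀ y s, s ∈ Icc 0 t₁ → f y s + -(ε * s) ≤ f x t + -(ε * t) :=
    fun y s hs => hmax (⟨mem_univ y, hs⟩ : (y, s) ∈ univ ×ˢ Icc 0 t₁)
  have h1 := hmax' x₁ t₁ hmem.2
  have htpos : 0 < t := by
    rcases ht.1.eq_or_lt with h | h
    · rw [← h] at h1; have := h0 x; linarith
    · exact h
  have htJ := Icc_subset_timeInterval ht₁ ht
  -- `f` need not be differentiable: the barrier lies below it and touches it, so g - εs inherits
  -- the maximum on [0, t] at the right endpoint, where its derivative d - ε would have to be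
  -- nonnegative.
  obtain ⟨g, d, hd, hg, hgt, hder⟩ := h t htJ htpos x
    (fun y => by have := hmax' y t ht; linarith)
    (by have := mul_pos hεpos htpos; linarith)
  have hder' : HasDerivWithinAt (fun s => g s - ε * s) (d - ε) (Icc 0 t) t :=
    ((hder.mono (Icc_subset_timeInterval htJ)).sub
      ((hasDerivWithinAt_id t (Icc 0 t)).const_mul ε)).congr_deriv (by simp)
  have hloc : IsLocalMaxOn (fun s => g s - ε * s) (Icc 0 t) t := by
    filter_upwards [self_mem_nhdsWithin] with s hs
    have h2 := hmax' x s ⟨hs.1, hs.2.trans ht.2⟩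
    have h3 := hg s (Icc_subset_timeInterval htJ hs)
    linarith
  have hcone : (0 : ℝ) - t ∈ posTangentConeAt (Icc 0 t) t := by
    refine sub_mem_posTangentConeAt_of_segment_subset ?_
    rw [segment_symm, segment_eq_Icc htpos.le]
  have := hloc.hasFDerivWithinAt_nonpos hder'.hasFDerivWithinAt hcone
  simp at this
  nlinarith

end MaximumPrinciple

section Chart

variable {n : ℕ} {M : Type*} [TopologicalSpace M] [ChartedSpace (EuclideanSpace ℝ (Fin n)) M]

theorem tendsto_chart {x₀ x : M} (hx : x ∈ (extChartAt (𝓡 n) x₀).source) (J : Set ℝ) (t : ℝ) :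
    Tendsto (fun q : M × ℝ => (extChartAt (𝓡 n) x₀ q.1, q.2)) (𝓝[univ ×ˢ J] (x, t))
      (𝓝[(extChartAt (𝓡 n) x₀).target ×ˢ J] (extChartAt (𝓡 n) x₀ x, t)) := by
  refine tendsto_nhdsWithin_iff.2 ⟨?_, ?_⟩
  · have h1 : ContinuousAt (fun q : M × ℝ => extChartAt (𝓡 n) x₀ q.1) (x, t) :=
      ContinuousAt.comp (f := Prod.fst) (continuousAt_extChartAt' (I := 𝓡 n) hx) continuousAt_fst
    exact (h1.prodMk continuousAt_snd).tendsto.mono_left nhdsWithin_le_nhds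
  · filter_upwards [self_mem_nhdsWithin, nhdsWithin_le_nhds (continuousAt_fst.preimage_mem_nhds
      ((isOpen_extChartAt_source (I := 𝓡 n) x₀).mem_nhds hx))] with q hq hq'
    exact ⟨(extChartAt (𝓡 n) x₀).map_source hq', hq.2⟩

end Chart

/-! ### The equation satisfied by θ at a critical point. -/

namespace IsFlowSolution

variable {n : ℕ} {M N : Type*}
  [EMetricSpace M] [ChartedSpace (EuclideanSpace ℝ (Fin n)) M]
  [RiemannianBundle (fun x : M => TangentSpace (𝓡 n) x)]
  [EMetricSpace N] [ChartedSpace (EuclideanSpace ℝ (Fin n)) N]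
  [RiemannianBundle (fun y : N => TangentSpace (𝓡 n) y)]
  {c : M × N → WithTop ℝ} {x₀ x : M} {y₀ y : N} {ρ : M → ℝ} {ρ' : N → ℝ}
  {e : OpenPartialHomeomorph (Eu n × Eu n) (Eu n × (Eu n →L[ℝ] ℝ))}
  {l : EReal} {u : ℝ → M → ℝ} {T : ℝ → M → N} {t : ℝ}
  [IsManifold (𝓡 n) ∞ M]

theorem continuousOn_theta (hl : 0 < l) (hs : IsFlowSolution n c ρ ρ' l u T) :
    ContinuousOn (fun q : M × ℝ => theta n c ρ ρ' (u q.2) (T q.2) q.1) (univ ×ˢ timeInterval l) := by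
  rintro ⟨x, t⟩ ⟨-, ht⟩
  have h1 := (hs.contDiffOn_thetaLoc hl x).continuousOn (extChartAt (𝓡 n) x x, t)
    ⟨mem_extChartAt_target x, ht⟩
  have h3 := Tendsto.comp h1 (tendsto_chart (mem_extChartAt_source x) (timeInterval l) t)
  refine (h3.congr' ?_).trans_eq ?_
  · filter_upwards [nhdsWithin_le_nhds (continuousAt_fst.preimage_mem_nhds
      (extChartAt_source_mem_nhds (I := 𝓡 n) x))] with q hq
    simp only [Function.comp, thetaLoc, loc]
    rw [(extChartAt (𝓡 n) x).left_inv hq]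
  · simp only [thetaLoc, loc, extChartAt_to_inv]

variable [IsManifold (𝓡 n) ∞ N]

theorem wHess_pos (hinj : IsTwisted n c) (hdet : IsNondegenerate n c) (hl : 0 < l)
    (hs : IsFlowSolution n c ρ ρ' l u T)
    (h : IsLegendreChart (costF c x₀ y₀) e) (hsub : e.source ⊆ regularCoords c x₀ y₀)
    (ht : t ∈ timeInterval l) {a : Eu n} (ha : a ∈ (extChartAt (𝓡 n) x₀).target)
    (hj : jet (loc x₀ (u t)) a ∈ e.target) {V : Eu n} (hV : V ≠ 0) :
    0 < wHess (coefA c x₀ y₀ e) (loc x₀ (u t)) a V V := by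
  have hx := (extChartAt (𝓡 n) x₀).map_target ha
  have h1 := hs.convex hinj hdet hl ht ((extChartAt (𝓡 n) x₀).symm a) _ (tauInv_ne_zero hx hV)
  have h2 := hs.wForm_eq hinj h hsub hx ht (by rwa [(extChartAt (𝓡 n) x₀).right_inv ha])
    (tauInv x₀ ((extChartAt (𝓡 n) x₀).symm a) V) (tauInv x₀ ((extChartAt (𝓡 n) x₀).symm a) V)
  rw [tau_tauInv hx, (extChartAt (𝓡 n) x₀).right_inv ha] at h2
  exact h2 ▸ h1

theorem thetaLoc_eq (hinj : IsTwisted n c) (hρ : ∀ x, 0 < ρ x) (hρ' : ∀ y, 0 < ρ' y)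
    (hs : IsFlowSolution n c ρ ρ' l u T)
    (h : IsLegendreChart (costF c x₀ y₀) e) (hsub : e.source ⊆ regularCoords c x₀ y₀)
    (ht : t ∈ timeInterval l) {a : Eu n} (ha : a ∈ (extChartAt (𝓡 n) x₀).target)
    (hj : jet (loc x₀ (u t)) a ∈ e.target) :
    thetaLoc c ρ ρ' u T x₀ t a =
      Real.log (gram (wHess (coefA c x₀ y₀ e) (loc x₀ (u t)) a)).det -
        costB c ρ ρ' x₀ y₀ (e.symm (jet (loc x₀ (u t)) a)) := by
  have hx := (extChartAt (𝓡 n) x₀).map_target ha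
  have hu := (hs.contDiffAt_loc ht ha).of_le (m := 2) ENat.LEInfty.out
  have := theta_eq (T := T t) h hsub hinj hρ hρ' hx (hs.potential t ht)
    (by rwa [(extChartAt (𝓡 n) x₀).right_inv ha]) (by rwa [(extChartAt (𝓡 n) x₀).right_inv ha])
    (hs.det_pos t ht _)
  rwa [(extChartAt (𝓡 n) x₀).right_inv ha] at this

variable [IsContMDiffRiemannianBundle (𝓡 n) ∞ (EuclideanSpace ℝ (Fin n))
      (fun x : M => TangentSpace (𝓡 n) x)]
  [IsContMDiffRiemannianBundle (𝓡 n) ∞ (EuclideanSpace ℝ (Fin n))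
      (fun y : N => TangentSpace (𝓡 n) y)]

/-- The linearized equation satisfied by `θ`, at a critical point. -/
theorem hasDerivWithinAt_theta (hinj : IsTwisted n c) (hdet : IsNondegenerate n c)
    (hρ : ContMDiff (𝓡 n) 𝓘(ℝ, ℝ) ∞ ρ) (hρpos : ∀ x, 0 < ρ x)
    (hρ' : ContMDiff (𝓡 n) 𝓘(ℝ, ℝ) ∞ ρ') (hρ'pos : ∀ y, 0 < ρ' y) (hl : 0 < l)
    (hs : IsFlowSolution n c ρ ρ' l u T) (ht : t ∈ timeInterval l) (h0 : 0 < t)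
    (hcrit : fderiv ℝ (thetaLoc c ρ ρ' u T x t) (extChartAt (𝓡 n) x x) = 0) :
    ∃ f : Fin n → Eu n, HasDerivWithinAt (fun s => theta n c ρ ρ' (u s) (T s) x)
      (∑ i, fderiv ℝ (fderiv ℝ (thetaLoc c ρ ρ' u T x t)) (extChartAt (𝓡 n) x x) (f i) (f i))
      (timeInterval l) t := by
  obtain ⟨e, h, hsub, hj⟩ := hs.exists_chart hdet ht x
  set y₀ := T t x
  have hat := mem_extChartAt_target (I := 𝓡 n) x
  set a := extChartAt (𝓡 n) x x
  have hu2 : ∀ s ∈ timeInterval l, ContDiffAt ℝ 2 (loc x (u s)) a := fun s hsJ =>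
    (hs.contDiffAt_loc hsJ hat).of_le ENat.LEInfty.out
  set W : ℝ → Eu n →L[ℝ] Eu n →L[ℝ] ℝ := fun s => wHess (coefA c x y₀ e) (loc x (u s)) a with hW
  set B : Eu n × (Eu n →L[ℝ] ℝ) → ℝ := fun p => costB c ρ ρ' x y₀ (e.symm p) with hB
  have hWs := wHess_coefA_symm h (hu2 t ht) hj
  obtain ⟨f, -, hf, -⟩ := exists_simultaneous_basis (V := Eu n) finrank_euclideanSpace_fin
    (W t).toLinearMap₁₂ (W t).toLinearMap₁₂ hWs
    (fun V hV => hs.wHess_pos hinj hdet hl h hsub ht hat hj hV) hWs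
  refine ⟨f, ?_⟩
  have hthe : (fun s => theta n c ρ ρ' (u s) (T s) x) = fun s => thetaLoc c ρ ρ' u T x s a := by
    ext s; simp only [thetaLoc, loc, a, extChartAt_to_inv]
  have hd1 : HasDerivWithinAt (fun s => thetaLoc c ρ ρ' u T x s a) _ (timeInterval l) t :=
    hasDerivWithinAt_time ((hs.contDiffOn_thetaLoc hl x).differentiableOn (by simp)) hat ht
  have hJ := timeInterval_mem_nhds ht h0
  have hA : DifferentiableAt ℝ (coefA c x y₀ e) (jet (loc x (u t)) a) :=
    (contDiffAt_coefA h hj).differentiableAt (by simp)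
  have hBd : DifferentiableAt ℝ B (jet (loc x (u t)) a) :=
    (h.contDiffAt_comp_symm hj (contDiffAt_costB h hsub hρ hρpos hρ' hρ'pos
      (e.map_target hj))).differentiableAt (by simp)
  have hd2 : HasDerivWithinAt (fun s => ∑ i, W s (f i) (f i)) (∑ i,
      (fderiv ℝ (fderiv ℝ (thetaLoc c ρ ρ' u T x t)) a (f i) (f i) -
        fderiv ℝ (coefA c x y₀ e) (jet (loc x (u t)) a)
          (0, fderiv ℝ (thetaLoc c ρ ρ' u T x t) a) (f i) (f i))) (timeInterval l) t :=
    HasDerivWithinAt.fun_sum fun i _ => hs.hasDerivWithinAt_wHess hl ht hat hA (f i)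
  have hd3 := hs.hasDerivWithinAt_comp_jet hl ht hat hBd
  have hzero : ((0 : Eu n), (0 : Eu n →L[ℝ] ℝ)) = 0 := rfl
  -- Since Dθ = 0, the time derivative of the jet is zero and the terms with first derivatives of
  -- `A` and `B` are absent.
  rw [hcrit, hzero, map_zero] at hd2 hd3
  simp only [_root_.zero_apply, sub_zero] at hd2
  have hdk := ((hd2.sub hd3).sub hd1).hasDerivAt hJ
  -- ln det is compared with its tangent at time t, which it touches from below; equality of the
  -- time derivatives replaces differentiating the determinant. A two-sided neighbourhood of t is
  -- needed, hence t > 0.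
  have hmin : IsLocalMin (((fun s => ∑ i, W s (f i) (f i)) - fun s => B (jet (loc x (u s)) a)) -
      fun s => thetaLoc c ρ ρ' u T x s a) t := by
    have hev := (eventually_of_nhdsWithin hat ht (hs.eventually_jet_mem hl ht hat hj)).2
    rw [nhdsWithin_eq_nhds.2 hJ] at hev
    filter_upwards [hev, hJ] with s hsj hsJ
    simp only [Pi.sub_apply]
    rw [hs.thetaLoc_eq hinj hρpos hρ'pos h hsub ht hat hj,
      hs.thetaLoc_eq hinj hρpos hρ'pos h hsub hsJ hat hsj]
    have h1 := log_det_gram_le (W₀ := W t) (W := W s) f hf (wHess_coefA_symm h (hu2 s hsJ) hsj)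
      (fun V hV => hs.wHess_pos hinj hdet hl h hsub hsJ hat hsj hV)
    have h2 : ∑ i, W t (f i) (f i) = n := by
      have : ∀ i, W t (f i) (f i) = 1 := fun i => by simpa using hf i i
      simp [this]
    rw [h2]
    simp only [hB]
    linarith
  have := hmin.hasDerivAt_eq_zero hdk
  rw [sub_zero, sub_eq_zero] at this
  rw [hthe, this]
  exact hd1

end IsFlowSolution

/-! ### Regularity of the transport map and its Jacobian. -/

namespace IsFlowSolution

variable {n : ℕ} {M N : Type*}
  [EMetricSpace M] [ChartedSpace (EuclideanSpace ℝ (Fin n)) M]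
  [RiemannianBundle (fun x : M => TangentSpace (𝓡 n) x)]
  [EMetricSpace N] [ChartedSpace (EuclideanSpace ℝ (Fin n)) N]
  [RiemannianBundle (fun y : N => TangentSpace (𝓡 n) y)]
  {c : M × N → WithTop ℝ} {x₀ x : M} {y₀ y : N} {ρ : M → ℝ} {ρ' : N → ℝ}
  {e : OpenPartialHomeomorph (Eu n × Eu n) (Eu n × (Eu n →L[ℝ] ℝ))}
  {l : EReal} {u : ℝ → M → ℝ} {T : ℝ → M → N} {t : ℝ}

theorem contMDiff (hs : IsFlowSolution n c ρ ρ' l u T) (ht : t ∈ timeInterval l) :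
    ContMDiff (𝓡 n) 𝓘(ℝ, ℝ) ∞ (u t) := by
  rw [← contMDiffOn_univ]
  have h1 : ContMDiffOn (𝓡 n) ((𝓡 n).prod 𝓘(ℝ, ℝ)) ∞ (fun x : M => (x, t)) univ :=
    (contMDiff_id.prodMk contMDiff_const).contMDiffOn
  exact hs.smooth.comp h1 fun x _ => ⟨mem_univ _, ht⟩

variable [IsManifold (𝓡 n) ∞ M] [IsManifold (𝓡 n) ∞ N]

/-- The map `T` in the charts at `x` and `T x`. -/
theorem eventually_chart_eq (hinj : IsTwisted n c) (hl : 0 < l)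
    (hs : IsFlowSolution n c ρ ρ' l u T) (ht : t ∈ timeInterval l)
    (h : IsLegendreChart (costF c x₀ y₀) e) (hsub : e.source ⊆ regularCoords c x₀ y₀)
    {a : Eu n} (ha : a ∈ (extChartAt (𝓡 n) x₀).target) (hj : jet (loc x₀ (u t)) a ∈ e.target) :
    ∀ᶠ a' in 𝓝 a, T t ((extChartAt (𝓡 n) x₀).symm a') ∈ (extChartAt (𝓡 n) y₀).source ∧
      e.symm (jet (loc x₀ (u t)) a') =
        (a', extChartAt (𝓡 n) y₀ (T t ((extChartAt (𝓡 n) x₀).symm a'))) := by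
  filter_upwards [(eventually_of_nhdsWithin ha ht (hs.eventually_jet_mem hl ht ha hj)).1,
    (isOpen_extChartAt_target (I := 𝓡 n) x₀).mem_nhds ha] with a' hj' ha'
  have hx := (extChartAt (𝓡 n) x₀).map_target ha'
  have hr := (extChartAt (𝓡 n) x₀).right_inv ha'
  have hu : DifferentiableAt ℝ (loc x₀ (u t)) a' :=
    (hs.contDiffAt_loc ht ha').differentiableAt (by simp)
  obtain ⟨h1, h2⟩ := mem_source_of_jet_mem (T := T t) h hsub hinj hx (hs.potential t ht)
    (by rwa [hr]) (by rwa [hr])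
  have h3 := legendre_eq_jet (T := T t) h hx h1 (hs.potential t ht) (by rwa [hr])
  rw [hr] at h3
  refine ⟨h1, ?_⟩
  rw [← h3, e.left_inv h2, pairCoord, hr]

/-- In charts `T t` is the second component of the inverse Legendre chart composed with the jet, so
both its continuity and its differentiability come from the smoothness of the potential. -/
theorem mdifferentiableAt (hinj : IsTwisted n c) (hl : 0 < l)
    (hs : IsFlowSolution n c ρ ρ' l u T) (ht : t ∈ timeInterval l)
    (h : IsLegendreChart (costF c x (T t x)) e) (hsub : e.source ⊆ regularCoords c x (T t x))
    (hj : jet (loc x (u t)) (extChartAt (𝓡 n) x x) ∈ e.target) :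
    MDifferentiableAt (𝓡 n) (𝓡 n) (T t) x ∧
      (mfderiv (𝓡 n) (𝓡 n) (T t) x : Eu n →L[ℝ] Eu n) =
        fderiv ℝ (fun a => (e.symm (jet (loc x (u t)) a)).2) (extChartAt (𝓡 n) x x) := by
  have hat := mem_extChartAt_target (I := 𝓡 n) x
  have hev := hs.eventually_chart_eq hinj hl ht h hsub hat hj
  set Y : Eu n → Eu n := fun a => (e.symm (jet (loc x (u t)) a)).2 with hY
  have hYd : DifferentiableAt ℝ Y (extChartAt (𝓡 n) x x) := by
    have h1 : DifferentiableAt ℝ e.symm (jet (loc x (u t)) (extChartAt (𝓡 n) x x)) :=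
      (h.contDiffAt_symm hj).differentiableAt (by simp)
    have h2 := hasFDerivAt_jet ((hs.contDiffAt_loc ht hat).of_le (m := 2) ENat.LEInfty.out)
    exact (h1.comp _ h2.differentiableAt).snd
  have hw : writtenInExtChartAt (𝓡 n) (𝓡 n) x (T t) =ᶠ[𝓝 (extChartAt (𝓡 n) x x)] Y := by
    filter_upwards [hev] with a ha
    simp only [hY, ha.2]
    rfl
  have hTc : ContinuousAt (T t) x := by
    have h1 : ContinuousAt (fun x' => (extChartAt (𝓡 n) (T t x)).symm (Y (extChartAt (𝓡 n) x x'))) x := by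
      have hYx : Y (extChartAt (𝓡 n) x x) = extChartAt (𝓡 n) (T t x) (T t x) := by
        have := hev.self_of_nhds.2
        rw [extChartAt_to_inv] at this
        simp only [hY, this]
      have h2 : ContinuousAt (fun x' => Y (extChartAt (𝓡 n) x x')) x :=
        ContinuousAt.comp (g := Y) hYd.continuousAt (continuousAt_extChartAt (I := 𝓡 n) x)
      refine ContinuousAt.comp (g := (extChartAt (𝓡 n) (T t x)).symm) ?_ h2
      rw [hYx]
      exact continuousAt_extChartAt_symm (I := 𝓡 n) (T t x)
    refine h1.congr ?_
    filter_upwards [(continuousAt_extChartAt (I := 𝓡 n) x).eventually hev,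
      extChartAt_source_mem_nhds (I := 𝓡 n) x] with x' hx' hxs
    rw [(extChartAt (𝓡 n) x).left_inv hxs] at hx'
    simp only [hY, hx'.2]
    exact (extChartAt (𝓡 n) (T t x)).left_inv hx'.1
  have hmd : MDifferentiableAt (𝓡 n) (𝓡 n) (T t) x := by
    rw [mdifferentiableAt_iff]
    refine ⟨hTc, (DifferentiableAt.differentiableWithinAt ?_)⟩
    exact hYd.congr_of_eventuallyEq hw
  refine ⟨hmd, ?_⟩
  refine hmd.mfderiv.trans ?_
  rw [ModelWithCorners.range_eq_univ, fderivWithin_univ, hw.fderiv_eq]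

/-- The Monge-Ampère equation satisfied by the map. -/
theorem abs_det_mfderiv (hinj : IsTwisted n c) (hdet : IsNondegenerate n c) (hl : 0 < l)
    (hs : IsFlowSolution n c ρ ρ' l u T) (ht : t ∈ timeInterval l) (x : M) :
    MDifferentiableAt (𝓡 n) (𝓡 n) (T t) x ∧
    |(mixedHess (n := n) c x (T t x)).det| * |(Matrix.of fun s i : Fin n =>
      (show EuclideanSpace ℝ (Fin n) from mfderiv (𝓡 n) (𝓡 n) (T t) x (tanVec x i)) s).det| =
      detW n c (u t) (T t) x := by
  obtain ⟨e, h, hsub, hj⟩ := hs.exists_chart hdet ht x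
  obtain ⟨hmd, hmf⟩ := hs.mdifferentiableAt hinj hl ht h hsub hj
  refine ⟨hmd, ?_⟩
  have hat := mem_extChartAt_target (I := 𝓡 n) x
  set a := extChartAt (𝓡 n) x x with ha
  set p := jet (loc x (u t)) a with hp
  set F := costF (n := n) c x (T t x) with hF
  have hev := hs.eventually_chart_eq hinj hl ht h hsub hat hj
  have hq : e.symm p = pairCoord x x (T t x) (T t x) := by
    have := hev.self_of_nhds.2
    rw [extChartAt_to_inv] at this
    exact this
  have hu2 : ContDiffAt ℝ 2 (loc x (u t)) a := (hs.contDiffAt_loc ht hat).of_le ENat.LEInfty.out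
  set Y : Eu n → Eu n := fun a => (e.symm (jet (loc x (u t)) a)).2 with hY
  have hd1 : HasFDerivAt (fun a => e.symm (jet (loc x (u t)) a))
      ((fderiv ℝ e.symm p).comp
        ((ContinuousLinearMap.id ℝ (Eu n)).prod (fderiv ℝ (fderiv ℝ (loc x (u t))) a))) a :=
    HasFDerivAt.comp (g := e.symm) a
      ((h.contDiffAt_symm hj).differentiableAt (by simp)).hasFDerivAt (hasFDerivAt_jet hu2)
  have hd2 : HasFDerivAt (fun a => e.symm (jet (loc x (u t)) a))
      ((ContinuousLinearMap.id ℝ (Eu n)).prod (fderiv ℝ Y a)) a := by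
    have h1 : HasFDerivAt (fun a => (a, Y a)) _ a :=
      (hasFDerivAt_id a).prodMk hd1.snd.differentiableAt.hasFDerivAt
    refine h1.congr_of_eventuallyEq ?_
    filter_upwards [hev] with a' ha'
    exact Prod.ext (by rw [ha'.2]) rfl
  have hFs := h.smooth _ (e.map_target hj)
  have hd3 : HasFDerivAt (fun a => dX F (e.symm (jet (loc x (u t)) a))) _ a :=
    HasFDerivAt.comp (g := dX F) a ((contDiffAt_dX hFs).differentiableAt (by simp)).hasFDerivAt hd2
  have hev2 : (fun a => dX F (e.symm (jet (loc x (u t)) a))) =ᶠ[𝓝 a]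
      fun a => -fderiv ℝ (loc x (u t)) a := by
    filter_upwards [(eventually_of_nhdsWithin hat ht (hs.eventually_jet_mem hl ht hat hj)).1]
      with a' ha'
    exact neg_eq_iff_eq_neg.1 (h.dX_symm ha')
  have hd4 : HasFDerivAt (fun a => -fderiv ℝ (loc x (u t)) a)
      (-fderiv ℝ (fderiv ℝ (loc x (u t))) a) a :=
    ((hu2.fderiv_right (m := 1) (by norm_num)).differentiableAt (by simp)).hasFDerivAt.neg
  -- This is the derivative of D_a F(a, Y(a)) = -Du(a); the unmixed part of the left side combines
  -- with D²u into w.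
  have hkey : ∀ ξ : Eu n, mixedForm F (e.symm p) (fderiv ℝ Y a ξ) =
      -wHess (coefA c x (T t x) e) (loc x (u t)) a ξ := by
    intro ξ
    have h1 := congrArg (fun L => L ξ) (hd3.unique (hd4.congr_of_eventuallyEq hev2))
    have h2 : fderiv ℝ (dX F) (e.symm p) (ξ, fderiv ℝ Y a ξ) =
        -fderiv ℝ (fderiv ℝ (loc x (u t))) a ξ := h1
    rw [fderiv_dX_apply] at h2
    have h3 : wHess (coefA c x (T t x) e) (loc x (u t)) a ξ =
        fderiv ℝ (fderiv ℝ (loc x (u t))) a ξ - negHessX F (e.symm p) ξ := rfl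
    rw [h3, neg_sub, sub_eq_add_neg, ← h2]
    abel
  set m : Matrix (Fin n) (Fin n) ℝ := Matrix.of fun s i => fderiv ℝ Y a (coordVec i) s with hm
  have hmat : mixedMat F (e.symm p) * m =
      -(gram (wHess (coefA c x (T t x) e) (loc x (u t)) a)).transpose := by
    ext k i
    change (mixedMat F (e.symm p)).mulVec (fderiv ℝ Y a (coordVec i)).ofLp k =
      -wHess (coefA c x (T t x) e) (loc x (u t)) a (coordVec i) (coordVec k)
    rw [← mixedForm_coordVec]
    exact congrArg (fun L : Eu n →L[ℝ] ℝ => L (coordVec k)) (hkey (coordVec i))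
  have hW : detW n c (u t) (T t) x =
      (gram (wHess (coefA c x (T t x) e) (loc x (u t)) a)).det := by
    rw [detW]
    congr 1
    ext i j
    have := hs.wForm_eq hinj h hsub (mem_extChartAt_source x) ht hj (coordVec i) (coordVec j)
    rw [tau_self, tau_self] at this
    exact this
  have hpos := hs.det_pos t ht x
  have hm2 : (Matrix.of fun s i : Fin n =>
      (show EuclideanSpace ℝ (Fin n) from mfderiv (𝓡 n) (𝓡 n) (T t) x (tanVec x i)) s) = m := by
    ext s i
    exact congrArg (fun L : Eu n →L[ℝ] Eu n => L (coordVec i) s) hmf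
  rw [hm2, mixedHess_eq_mixedMat (hs.potential t ht x).1, ← hq, ← abs_mul, ← Matrix.det_mul, hmat,
    Matrix.det_neg, Matrix.det_transpose, abs_mul, abs_pow, abs_neg, abs_one, one_pow, one_mul, ← hW,
    abs_of_pos hpos]

theorem absDet_eq (hinj : IsTwisted n c) (hdet : IsNondegenerate n c)
    (hρ : ∀ x, 0 < ρ x) (hρ' : ∀ y, 0 < ρ' y) (hl : 0 < l)
    (hs : IsFlowSolution n c ρ ρ' l u T) (ht : t ∈ timeInterval l) (x : M) :
    absDet n (T t) x = Real.exp (theta n c ρ ρ' (u t) (T t) x) * (ρ x / ρ' (T t x)) := by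
  have h1 := (hs.abs_det_mfderiv hinj hdet hl ht x).2
  have hm : 0 < |(mixedHess (n := n) c x (T t x)).det| :=
    abs_pos.2 (hdet x _ (hs.potential t ht x).1)
  have hd := hs.det_pos t ht x
  have v1 := volDensity_pos (n := n) x
  have v2 := volDensity_pos (n := n) (T t x)
  have r1 := hρ x
  have r2 := hρ' (T t x)
  rw [theta, Real.exp_sub, Real.exp_add, Real.exp_sub, Real.exp_log hd, Real.exp_log (by positivity),
    Real.exp_log (by positivity), Real.exp_log hm, absDet]
  rw [← h1]
  field_simp

end IsFlowSolution

/-! ### The bound on θ and the compactness of the graphs. -/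

theorem exists_bounds_of_pos {X : Type*} [TopologicalSpace X] [CompactSpace X] {f : X → ℝ}
    (hf : Continuous f) (hpos : ∀ x, 0 < f x) : ∃ m k : ℝ, 0 < m ∧ 0 < k ∧ ∀ x, m ≤ f x ∧ f x ≤ k := by
  rcases isEmpty_or_nonempty X with h | h
  · exact ⟨1, 1, one_pos, one_pos, fun x => h.elim x⟩
  · obtain ⟨a, -, ha⟩ := isCompact_univ.exists_isMinOn univ_nonempty hf.continuousOn
    obtain ⟨b, -, hb⟩ := isCompact_univ.exists_isMaxOn univ_nonempty hf.continuousOn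
    exact ⟨f a, f b, hpos a, hpos b, fun x => ⟨ha (mem_univ x), hb (mem_univ x)⟩⟩

namespace IsFlowSolution

variable {n : ℕ} {M N : Type*}
  [EMetricSpace M] [CompactSpace M] [ChartedSpace (EuclideanSpace ℝ (Fin n)) M]
  [RiemannianBundle (fun x : M => TangentSpace (𝓡 n) x)]
  [EMetricSpace N] [ChartedSpace (EuclideanSpace ℝ (Fin n)) N]
  [RiemannianBundle (fun y : N => TangentSpace (𝓡 n) y)]
  {c : M × N → WithTop ℝ} {x : M} {ρ : M → ℝ} {ρ' : N → ℝ}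
  {l : EReal} {u : ℝ → M → ℝ} {T : ℝ → M → N} {t : ℝ}
  [IsManifold (𝓡 n) ∞ M] [IsManifold (𝓡 n) ∞ N]
  [IsContMDiffRiemannianBundle (𝓡 n) ∞ (EuclideanSpace ℝ (Fin n))
      (fun x : M => TangentSpace (𝓡 n) x)]
  [IsContMDiffRiemannianBundle (𝓡 n) ∞ (EuclideanSpace ℝ (Fin n))
      (fun y : N => TangentSpace (𝓡 n) y)]

/-- The time derivative `θ` stays bounded by its initial values. -/
theorem abs_theta_le (hinj : IsTwisted n c) (hdet : IsNondegenerate n c)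
    (hρ : ContMDiff (𝓡 n) 𝓘(ℝ, ℝ) ∞ ρ) (hρpos : ∀ x, 0 < ρ x)
    (hρ' : ContMDiff (𝓡 n) 𝓘(ℝ, ℝ) ∞ ρ') (hρ'pos : ∀ y, 0 < ρ' y) (hl : 0 < l)
    (hs : IsFlowSolution n c ρ ρ' l u T) {Θ : ℝ}
    (hΘ : ∀ x, |theta n c ρ ρ' (u 0) (T 0) x| ≤ Θ) (ht : t ∈ timeInterval l) (x : M) :
    |theta n c ρ ρ' (u t) (T t) x| ≤ Θ := by
  have hcont : ContinuousOn (fun q : M × ℝ => theta n c ρ ρ' (u q.2) (T q.2) q.1)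
      (univ ×ˢ Icc 0 t) :=
    (hs.continuousOn_theta hl).mono (prod_mono subset_rfl (Icc_subset_timeInterval ht))
  have hself : ∀ (s : ℝ) (x' : M), thetaLoc c ρ ρ' u T x' s (extChartAt (𝓡 n) x' x') =
      theta n c ρ ρ' (u s) (T s) x' := fun s x' => by
    simp only [thetaLoc, loc, extChartAt_to_inv]
  have hsmooth : ∀ s ∈ timeInterval l, ∀ x' : M,
      ContDiffAt ℝ 2 (thetaLoc c ρ ρ' u T x' s) (extChartAt (𝓡 n) x' x') := fun s hsJ x' =>
    (hs.contDiffAt_thetaLoc hl hsJ (mem_extChartAt_target x')).of_le ENat.LEInfty.out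
  have hc0 : ∀ (r : ℝ) (a v : Eu n), fderiv ℝ (fderiv ℝ (fun _ : Eu n => r)) a v v = 0 := by
    intro r a v
    have : fderiv ℝ (fun _ : Eu n => r) = fun _ => 0 := by ext1 a; exact fderiv_const_apply r
    rw [this]; simp
  rw [abs_le]
  constructor
  · have := maximum_principle (X := M) (f := fun x t => -theta n c ρ ρ' (u t) (T t) x) (K := Θ) ht
      hcont.neg.upperSemicontinuousOn (fun s hsJ hs0 x' hmax _ => ?_)
      (fun x => (neg_le_abs _).trans (hΘ x)) x
    · linarith
    · have hle : ∀ a, thetaLoc c ρ ρ' u T x' s (extChartAt (𝓡 n) x' x') ≤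
          thetaLoc c ρ ρ' u T x' s a := fun a => by
        rw [hself]; exact neg_le_neg_iff.1 (hmax _)
      have hcrit := fderiv_eq_of_eventually_le (differentiableAt_const _)
        ((hsmooth s hsJ x').differentiableAt (by simp)) (Eventually.of_forall hle) rfl
      rw [fderiv_const_apply] at hcrit
      obtain ⟨f, hf⟩ := hs.hasDerivWithinAt_theta hinj hdet hρ hρpos hρ' hρ'pos hl hsJ hs0
        hcrit.symm
      refine ⟨_, _, ?_, fun s _ => le_rfl, rfl, hf.neg⟩
      rw [neg_nonpos]
      refine Finset.sum_nonneg fun i _ => ?_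
      have := fderiv_fderiv_le_of_eventually_le contDiffAt_const (hsmooth s hsJ x')
        (Eventually.of_forall hle) rfl (f i)
      rwa [hc0] at this
  · have := maximum_principle (X := M) (f := fun x t => theta n c ρ ρ' (u t) (T t) x) (K := Θ) ht
      hcont.upperSemicontinuousOn (fun s hsJ hs0 x' hmax _ => ?_)
      (fun x => le_of_abs_le (hΘ x)) x
    · exact this
    · have hle : ∀ a, thetaLoc c ρ ρ' u T x' s a ≤
          thetaLoc c ρ ρ' u T x' s (extChartAt (𝓡 n) x' x') := fun a => by
        rw [hself]; exact hmax _
      have hcrit := fderiv_eq_of_eventually_le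
        ((hsmooth s hsJ x').differentiableAt (by simp)) (differentiableAt_const _)
        (Eventually.of_forall hle) rfl
      rw [fderiv_const_apply] at hcrit
      obtain ⟨f, hf⟩ := hs.hasDerivWithinAt_theta hinj hdet hρ hρpos hρ' hρ'pos hl hsJ hs0
        hcrit
      refine ⟨_, _, ?_, fun s _ => le_rfl, rfl, hf⟩
      refine Finset.sum_nonpos fun i _ => ?_
      have := fderiv_fderiv_le_of_eventually_le (hsmooth s hsJ x') contDiffAt_const
        (Eventually.of_forall hle) rfl (f i)
      rwa [hc0] at this

end IsFlowSolution

section StayAway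

variable {n : ℕ} {M N : Type*}
  [EMetricSpace M] [CompactSpace M] [ChartedSpace (EuclideanSpace ℝ (Fin n)) M]
  [RiemannianBundle (fun x : M => TangentSpace (𝓡 n) x)]
  [EMetricSpace N] [CompactSpace N] [ChartedSpace (EuclideanSpace ℝ (Fin n)) N]
  [RiemannianBundle (fun y : N => TangentSpace (𝓡 n) y)]
  {c : M × N → WithTop ℝ} {ρ : M → ℝ} {ρ' : N → ℝ}
  [IsManifold (𝓡 n) ∞ M] [IsManifold (𝓡 n) ∞ N]
  [IsContMDiffRiemannianBundle (𝓡 n) ∞ (EuclideanSpace ℝ (Fin n))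
      (fun x : M => TangentSpace (𝓡 n) x)]
  [IsContMDiffRiemannianBundle (𝓡 n) ∞ (EuclideanSpace ℝ (Fin n))
      (fun y : N => TangentSpace (𝓡 n) y)]

theorem isCompact_far (S : Set (M × N)) (r : ENNReal) :
    IsCompact {p : M × N | ∀ q ∈ S, r ≤ edist p.1 q.1 ^ 2 + edist p.2 q.2 ^ 2} := by
  refine IsClosed.isCompact ?_
  simp only [ofPred_forall]
  refine isClosed_biInter fun q _ => isClosed_le continuous_const ?_
  have h1 : Continuous fun p : M × N => edist p.1 q.1 := continuous_fst.edist continuous_const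
  have h2 : Continuous fun p : M × N => edist p.2 q.2 := continuous_snd.edist continuous_const
  exact ((ENNReal.continuous_pow 2).comp h1).add ((ENNReal.continuous_pow 2).comp h2)

/-- The graphs of all solutions with bounded initial `θ` lie in a compact set off `sing(c)`. -/
theorem exists_isCompact_graph (hinj : IsTwisted n c) (hdet : IsNondegenerate n c)
    (hρ : ContMDiff (𝓡 n) 𝓘(ℝ, ℝ) ∞ ρ) (hρpos : ∀ x, 0 < ρ x)
    (hρ' : ContMDiff (𝓡 n) 𝓘(ℝ, ℝ) ∞ ρ') (hρ'pos : ∀ y, 0 < ρ' y) (hstay : StayAway n c) (Θ : ℝ) :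
    ∃ K : Set (M × N), IsCompact K ∧ (∀ p ∈ K, p ∉ singSet n c) ∧
      ∀ (l : EReal) (u : ℝ → M → ℝ) (T : ℝ → M → N), 0 < l → IsFlowSolution n c ρ ρ' l u T →
        (∀ x, |theta n c ρ ρ' (u 0) (T 0) x| ≤ Θ) → ∀ t ∈ timeInterval l, ∀ x, (x, T t x) ∈ K := by
  obtain ⟨m, k, hm, hk, hb⟩ := exists_bounds_of_pos hρ.continuous hρpos
  obtain ⟨m', k', hm', hk', hb'⟩ := exists_bounds_of_pos hρ'.continuous hρ'pos
  -- These are the extreme values of e^θ ρ / ρ' for |θ| ≤ Θ, so ε depends on the data and on Θ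
  -- alone.
  obtain ⟨ε, hε, h⟩ := hstay (Real.exp (-Θ) * (m / k')) (Real.exp Θ * (k / m')) (by positivity)
    (by positivity)
  refine ⟨_, isCompact_far (singSet n c) (ENNReal.ofReal ε ^ 2), fun p hp hps => ?_, ?_⟩
  · have h1 := hp p hps
    simp only [edist_self, ne_eq, OfNat.ofNat_ne_zero, not_false_eq_true, zero_pow, add_zero,
      nonpos_iff_eq_zero, pow_eq_zero_iff, ENNReal.ofReal_eq_zero] at h1
    exact absurd hε h1.not_gt
  · intro l u T hl hs hΘ t ht x
    refine h (u t) (T t) ((hs.contMDiff ht).of_le ENat.LEInfty.out)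
      (fun x => (hs.abs_det_mfderiv hinj hdet hl ht x).1) (hs.potential t ht)
      (hs.convex hinj hdet hl ht) (fun x => ?_) x
    have hθ := abs_le.1 (hs.abs_theta_le hinj hdet hρ hρpos hρ' hρ'pos hl hΘ ht x)
    have e1 := hρ'pos (T t x)
    rw [hs.absDet_eq hinj hdet hρpos hρ'pos hl ht x]
    constructor
    · exact mul_le_mul (Real.exp_le_exp.2 hθ.1)
        (div_le_div₀ (hρpos x).le (hb x).1 e1 (hb' _).2) (by positivity) (Real.exp_pos _).le
    · exact mul_le_mul (Real.exp_le_exp.2 hθ.2)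
        (div_le_div₀ hk.le (hb x).2 hm' (hb' _).1) (div_nonneg (hρpos x).le e1.le) (Real.exp_pos _).le

end StayAway

/-! ### Local bounds on the coefficients and the evolution bound. -/

theorem eventually_norm_le {X Z : Type*} [TopologicalSpace X] [NormedAddCommGroup Z] {f : X → Z}
    {q : X} (hf : ContinuousAt f q) : ∀ᶠ k : ℝ in atTop, ∀ᶠ q' in 𝓝 q, ‖f q'‖ ≤ k := by
  filter_upwards [eventually_gt_atTop ‖f q‖] with k hk
  exact (hf.norm.eventually (gt_mem_nhds hk)).mono fun _ h => le_of_lt h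

/-- Positive definiteness is open, so G - ε I remains positive definite for some ε > 0, first at `q`
and then nearby; any k ≥ 1 / ε works. -/
theorem eventually_sq_norm_le {n : ℕ} {X : Type*} [TopologicalSpace X]
    {G : X → Eu n →L[ℝ] Eu n →L[ℝ] ℝ} {q : X} (hG : ContinuousAt G q)
    (hpos : ∀ z, z ≠ 0 → 0 < G q z z) :
    ∀ᶠ k : ℝ in atTop, ∀ᶠ q' in 𝓝 q, ∀ z, ‖z‖ ^ 2 ≤ k * G q' z z := by
  set I : Eu n →L[ℝ] Eu n →L[ℝ] ℝ := innerSL ℝ with hI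
  have hIz : ∀ z, I z z = ‖z‖ ^ 2 := fun z => real_inner_self_eq_norm_sq z
  have h1 : ∀ᶠ r : ℝ in 𝓝 0, ∀ z, z ≠ 0 → 0 < (G q - r • I) z z := by
    have hc : ContinuousAt (fun r : ℝ => G q - r • I) 0 :=
      continuousAt_const.sub (continuousAt_id.smul continuousAt_const)
    refine hc.eventually (isOpen_posDef.mem_nhds fun z hz => ?_)
    change 0 < G q z z - 0 * I z z
    rw [zero_mul, sub_zero]
    exact hpos z hz
  obtain ⟨ε, hε, hεpos⟩ := h1.exists_gt
  have h2 : ∀ᶠ q' in 𝓝 q, ∀ z, z ≠ 0 → 0 < (G q' - ε • I) z z := by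
    have hc : ContinuousAt (fun q' => G q' - ε • I) q := hG.sub continuousAt_const
    exact hc.eventually (isOpen_posDef.mem_nhds hεpos)
  filter_upwards [eventually_ge_atTop ε⁻¹] with k hk
  filter_upwards [h2] with q' hq' z
  by_cases hz : z = 0
  · simp [hz]
  · have h3 := hq' z hz
    simp only [_root_.sub_apply, _root_.smul_apply, smul_eq_mul, hIz] at h3
    have h4 : ‖z‖ ^ 2 ≤ ε⁻¹ * G q' z z := by
      rw [inv_mul_eq_div, le_div_iff₀ hε]; linarith
    have h5 : 0 ≤ G q' z z := by nlinarith [sq_nonneg ‖z‖]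
    exact h4.trans (mul_le_mul_of_nonneg_right hk h5)

section Covector

variable {n : ℕ} {M N : Type*}
  [EMetricSpace M] [ChartedSpace (EuclideanSpace ℝ (Fin n)) M]
  [RiemannianBundle (fun x : M => TangentSpace (𝓡 n) x)]
  [EMetricSpace N] [ChartedSpace (EuclideanSpace ℝ (Fin n)) N]
  {c : M × N → WithTop ℝ} {x₀ x : M} {y₀ y : N}
  {e : OpenPartialHomeomorph (Eu n × Eu n) (Eu n × (Eu n →L[ℝ] ℝ))}
  [IsManifold (𝓡 n) ∞ M] [IsManifold (𝓡 n) ∞ N]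

/-- The Ma-Trudinger-Wang condition in local coordinates. -/
theorem mtw_local {δ : ℝ} (hMTW : MTWCondition (n := n) c δ) (h : IsLegendreChart (costF c x₀ y₀) e)
    (hsub : e.source ⊆ regularCoords c x₀ y₀) (hnd : IsNondegenerate n c)
    (hx : x ∈ (extChartAt (𝓡 n) x₀).source) (hy : y ∈ (extChartAt (𝓡 n) y₀).source)
    (hxy : pairCoord x₀ x y₀ y ∈ e.source) {v : TangentSpace (𝓡 n) x} (hv : ‖v‖ = 1) {z : Eu n}
    (hz : metricLoc x₀ (extChartAt (𝓡 n) x₀ x) (tau x₀ x v) z = 0) :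
    δ * metricLoc x₀ (extChartAt (𝓡 n) x₀ x) z z ≤
      fderiv ℝ (fderiv ℝ (coefA c x₀ y₀ e)) (e (pairCoord x₀ x y₀ y))
        (0, metricLoc x₀ (extChartAt (𝓡 n) x₀ x) (tau x₀ x v))
        (0, metricLoc x₀ (extChartAt (𝓡 n) x₀ x) (tau x₀ x v)) z z := by
  set η := metricLoc x₀ (extChartAt (𝓡 n) x₀ x) (tau x₀ x v) with hη
  have h1 := mtw_eq_fderiv_fderiv h hsub hnd hx hy hxy η (tauInv x₀ x z)
  rw [tau_tauInv hx] at h1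
  set V : TangentSpace (𝓡 n) x := tauInv x₀ x z with hV
  set η' : TangentSpace (𝓡 n) x →L[ℝ] ℝ := η.comp (tau x₀ x) with hη'
  -- On the tangent space at `x` the covector is the metric dual of the unit vector `v`, so the
  -- factor ‖η‖² in the condition is 1.
  have hη1 : η' = innerSL ℝ v := by
    ext W
    have e1 : η' W = metricLoc x₀ (extChartAt (𝓡 n) x₀ x) (tau x₀ x v) (tau x₀ x W) := rfl
    exact e1.trans (innerForm_eq hx (v : Eu n) W).symm
  have h2 : ‖η'‖ = 1 := by rw [hη1, innerSL_apply_norm, hv]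
  have h3 : η' V = 0 := by
    have e1 : η' V = η (tau x₀ x (tauInv x₀ x z)) := rfl
    rw [e1, tau_tauInv hx, hz]
  have h4 := hMTW x y (notMem_singSet_of_mem hsub hx hy hxy) V η' h3
  have h5 : metricLoc x₀ (extChartAt (𝓡 n) x₀ x) z z = ‖V‖ ^ 2 := by
    rw [metricLoc_apply x₀ hx]; exact innerForm_self x V
  rw [h2, one_pow, mul_one] at h4
  rw [h5]
  exact h4.trans_eq h1

end Covector

theorem eventually_norm_fderiv_le {Y X Z : Type*} [TopologicalSpace Y] [NormedAddCommGroup X]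
    [NormedSpace ℝ X] [NormedAddCommGroup Z] [NormedSpace ℝ Z] {f : X → Z} {g : Y → X} {q : Y}
    (hf : ContDiffAt ℝ ∞ f (g q)) (hg : ContinuousAt g q) :
    ∀ᶠ k : ℝ in atTop, ∀ᶠ q' in 𝓝 q, ‖fderiv ℝ f (g q')‖ ≤ k :=
  eventually_norm_le (ContinuousAt.comp (g := fderiv ℝ f)
    (hf.fderiv_right (m := ∞) (by simp)).continuousAt hg)

theorem eventually_norm_fderiv_fderiv_le {Y X Z : Type*} [TopologicalSpace Y]
    [NormedAddCommGroup X] [NormedSpace ℝ X] [NormedAddCommGroup Z] [NormedSpace ℝ Z] {f : X → Z}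
    {g : Y → X} {q : Y} (hf : ContDiffAt ℝ ∞ f (g q)) (hg : ContinuousAt g q) :
    ∀ᶠ k : ℝ in atTop, ∀ᶠ q' in 𝓝 q, ‖f (g q')‖ ≤ k ∧ ‖fderiv ℝ f (g q')‖ ≤ k ∧
      ‖fderiv ℝ (fderiv ℝ f) (g q')‖ ≤ k := by
  filter_upwards [eventually_norm_le (ContinuousAt.comp (g := f) hf.continuousAt hg),
    eventually_norm_fderiv_le hf hg,
    eventually_norm_fderiv_le (f := fderiv ℝ f) (hf.fderiv_right (m := ∞) (by simp)) hg]
    with k k1 k2 k3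
  filter_upwards [k1, k2, k3] with q' b1 b2 b3 using ⟨b1, b2, b3⟩

namespace IsFlowSolution

variable {n : ℕ} {M N : Type*}
  [EMetricSpace M] [ChartedSpace (EuclideanSpace ℝ (Fin n)) M]
  [RiemannianBundle (fun x : M => TangentSpace (𝓡 n) x)]
  [EMetricSpace N] [ChartedSpace (EuclideanSpace ℝ (Fin n)) N]
  [RiemannianBundle (fun y : N => TangentSpace (𝓡 n) y)]
  {c : M × N → WithTop ℝ} {x₀ x : M} {y₀ y : N} {ρ : M → ℝ} {ρ' : N → ℝ}
  {e : OpenPartialHomeomorph (Eu n × Eu n) (Eu n × (Eu n →L[ℝ] ℝ))}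
  {l : EReal} {u : ℝ → M → ℝ} {T : ℝ → M → N} {t : ℝ}
  [IsManifold (𝓡 n) ∞ M] [IsManifold (𝓡 n) ∞ N]

/-- Homogeneity is read off from the bilinear form in a chart; the iterated derivative in `hessAt`
is not bilinear by definition. -/
theorem wForm_smul (hinj : IsTwisted n c) (hdet : IsNondegenerate n c)
    (hs : IsFlowSolution n c ρ ρ' l u T) (ht : t ∈ timeInterval l) (x : M) (r : ℝ) (V : Eu n) :
    wForm c (u t) (T t) x (r • V) (r • V) = r ^ 2 * wForm c (u t) (T t) x V V := by
  obtain ⟨e, h, hsub, hj⟩ := hs.exists_chart hdet ht x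
  have h1 := fun V => hs.wForm_eq hinj h hsub (mem_extChartAt_source x) ht hj V V
  rw [h1, h1]
  simp only [map_smul, _root_.smul_apply, smul_eq_mul]
  ring

theorem wForm_le_of_unit (hinj : IsTwisted n c) (hdet : IsNondegenerate n c)
    (hs : IsFlowSolution n c ρ ρ' l u T) (ht : t ∈ timeInterval l) {Λ : ℝ}
    (hΛ : ∀ z : TangentSpace (𝓡 n) x, ‖z‖ = 1 → wForm c (u t) (T t) x z z ≤ Λ) (V : Eu n) :
    wForm c (u t) (T t) x V V ≤ Λ * innerForm x V V := by
  obtain ⟨V', hV'⟩ : ∃ V' : TangentSpace (𝓡 n) x, V' = V := ⟨V, rfl⟩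
  by_cases hV : V' = 0
  · have h1 := hs.wForm_smul hinj hdet ht x 0 V
    have h2 : V = 0 := hV'.symm.trans hV
    rw [zero_smul] at h1
    rw [h2, h1, map_zero]
    simp
  · have hn : 0 < ‖V'‖ := (norm_pos_iff (E := TangentSpace (𝓡 n) x)).2 hV
    have h1 := hΛ (‖V'‖⁻¹ • V') (by rw [norm_smul, norm_inv, norm_norm, inv_mul_cancel₀ hn.ne'])
    have h2 : wForm c (u t) (T t) x (‖V'‖⁻¹ • V') (‖V'‖⁻¹ • V') =
      (‖V'‖⁻¹) ^ 2 * wForm c (u t) (T t) x V V := by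
      rw [← hV']
      exact hs.wForm_smul hinj hdet ht x _ V'
    rw [h2, inv_pow, inv_mul_le_iff₀ (by positivity)] at h1
    have h3 : innerForm x V V = ‖V'‖ ^ 2 := by
      rw [← hV']
      exact innerForm_self x V'
    rw [h3, mul_comm]
    exact h1

theorem wHess_le_of_unit (hinj : IsTwisted n c) (hdet : IsNondegenerate n c)
    (hs : IsFlowSolution n c ρ ρ' l u T) (ht : t ∈ timeInterval l) {Λ : ℝ}
    (h : IsLegendreChart (costF c x₀ y₀) e) (hsub : e.source ⊆ regularCoords c x₀ y₀)
    (hx : x ∈ (extChartAt (𝓡 n) x₀).source)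
    (hj : jet (loc x₀ (u t)) (extChartAt (𝓡 n) x₀ x) ∈ e.target)
    (hΛ : ∀ z : TangentSpace (𝓡 n) x, ‖z‖ = 1 → wForm c (u t) (T t) x z z ≤ Λ) (V : Eu n) :
    wHess (coefA c x₀ y₀ e) (loc x₀ (u t)) (extChartAt (𝓡 n) x₀ x) V V ≤
      Λ * metricLoc x₀ (extChartAt (𝓡 n) x₀ x) V V := by
  have h1 := hs.wForm_le_of_unit hinj hdet ht hΛ (tauInv x₀ x V)
  rw [hs.wForm_eq hinj h hsub hx ht hj, tau_tauInv hx] at h1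
  rwa [metricLoc_apply x₀ hx]

/-- The chart expression of w is valid for times near t, as long as the jet stays in the open
target; that is enough for a derivative, including the one-sided derivative at t = 0. -/
theorem hasDerivWithinAt_wForm (hinj : IsTwisted n c) (hl : 0 < l)
    (hs : IsFlowSolution n c ρ ρ' l u T) (ht : t ∈ timeInterval l)
    (h : IsLegendreChart (costF c x₀ y₀) e) (hsub : e.source ⊆ regularCoords c x₀ y₀)
    (hx : x ∈ (extChartAt (𝓡 n) x₀).source)
    (hj : jet (loc x₀ (u t)) (extChartAt (𝓡 n) x₀ x) ∈ e.target) (v : Eu n) :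
    HasDerivWithinAt (fun s => wForm c (u s) (T s) x v v)
      (fderiv ℝ (fderiv ℝ (thetaLoc c ρ ρ' u T x₀ t)) (extChartAt (𝓡 n) x₀ x)
          (tau x₀ x v) (tau x₀ x v) -
        fderiv ℝ (coefA c x₀ y₀ e) (jet (loc x₀ (u t)) (extChartAt (𝓡 n) x₀ x))
          (0, fderiv ℝ (thetaLoc c ρ ρ' u T x₀ t) (extChartAt (𝓡 n) x₀ x))
          (tau x₀ x v) (tau x₀ x v)) (timeInterval l) t := by
  have hat := (extChartAt (𝓡 n) x₀).map_source hx
  refine (hs.hasDerivWithinAt_wHess hl ht hat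
    ((contDiffAt_coefA h hj).differentiableAt (by simp)) (tau x₀ x v)).congr_of_eventuallyEq ?_
    (hs.wForm_eq hinj h hsub hx ht hj v v)
  filter_upwards [(eventually_of_nhdsWithin hat ht (hs.eventually_jet_mem hl ht hat hj)).2,
    self_mem_nhdsWithin] with s hsj hsJ
  exact hs.wForm_eq hinj h hsub hx hsJ hsj v v

end IsFlowSolution

section Uniform

variable {n : ℕ} {M N : Type*}
  [EMetricSpace M] [ChartedSpace (EuclideanSpace ℝ (Fin n)) M]
  [RiemannianBundle (fun x : M => TangentSpace (𝓡 n) x)]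
  [EMetricSpace N] [ChartedSpace (EuclideanSpace ℝ (Fin n)) N]
  [RiemannianBundle (fun y : N => TangentSpace (𝓡 n) y)]
  {c : M × N → WithTop ℝ} {x₀ : M} {y₀ : N} {ρ : M → ℝ} {ρ' : N → ℝ} {δ : ℝ}
  {e : OpenPartialHomeomorph (Eu n × Eu n) (Eu n × (Eu n →L[ℝ] ℝ))}
  [IsManifold (𝓡 n) ∞ M] [IsManifold (𝓡 n) ∞ N]
  [IsContMDiffRiemannianBundle (𝓡 n) ∞ (EuclideanSpace ℝ (Fin n))
      (fun x : M => TangentSpace (𝓡 n) x)]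
  [IsContMDiffRiemannianBundle (𝓡 n) ∞ (EuclideanSpace ℝ (Fin n))
      (fun y : N => TangentSpace (𝓡 n) y)]

/-- Bounds on the coefficients of the flow at the point with coordinates `q`. -/
structure CoefBounds (c : M × N → WithTop ℝ) (ρ : M → ℝ) (ρ' : N → ℝ) (x₀ : M) (y₀ : N)
    (e : OpenPartialHomeomorph (Eu n × Eu n) (Eu n × (Eu n →L[ℝ] ℝ))) (Θ k : ℝ)
    (q : Eu n × Eu n) : Prop where
  mem : q ∈ e.source
  A : ‖coefA c x₀ y₀ e (e q)‖ ≤ k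
  DA : ‖fderiv ℝ (coefA c x₀ y₀ e) (e q)‖ ≤ k
  D2A : ‖fderiv ℝ (fderiv ℝ (coefA c x₀ y₀ e)) (e q)‖ ≤ k
  B : Real.exp (Θ + costB c ρ ρ' x₀ y₀ q) ≤ k
  DB : ‖fderiv ℝ (fun p => costB c ρ ρ' x₀ y₀ (e.symm p)) (e q)‖ ≤ k
  D2B : ‖fderiv ℝ (fderiv ℝ (fun p => costB c ρ ρ' x₀ y₀ (e.symm p))) (e q)‖ ≤ k
  G : ‖metricLoc x₀ q.1‖ ≤ k
  DG : ‖fderiv ℝ (metricLoc x₀) q.1‖ ≤ k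
  D2G : ‖fderiv ℝ (fderiv ℝ (metricLoc x₀)) q.1‖ ≤ k
  low : ∀ z, ‖z‖ ^ 2 ≤ k * metricLoc x₀ q.1 z z
  det : 1 ≤ k * (gram (metricLoc x₀ q.1)).det

theorem exists_coefBounds (h : IsLegendreChart (costF c x₀ y₀) e)
    (hsub : e.source ⊆ regularCoords c x₀ y₀)
    (hρ : ContMDiff (𝓡 n) 𝓘(ℝ, ℝ) ∞ ρ) (hρpos : ∀ x, 0 < ρ x)
    (hρ' : ContMDiff (𝓡 n) 𝓘(ℝ, ℝ) ∞ ρ') (hρ'pos : ∀ y, 0 < ρ' y) {q : Eu n × Eu n}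
    (hq : q ∈ e.source) (Θ : ℝ) :
    ∃ k, 1 ≤ k ∧ ∀ᶠ q' in 𝓝 q, CoefBounds c ρ ρ' x₀ y₀ e Θ k q' := by
  have he : ContinuousAt e q := e.continuousAt hq
  have ht := e.map_source hq
  have hA := contDiffAt_coefA h ht
  have hBq := contDiffAt_costB h hsub hρ hρpos hρ' hρ'pos hq
  have hB : ContDiffAt ℝ ∞ (fun p => costB c ρ ρ' x₀ y₀ (e.symm p)) (e q) :=
    h.contDiffAt_comp_symm ht (by rwa [e.left_inv hq])
  have ha := (hsub hq).1.1
  have hx := (extChartAt (𝓡 n) x₀).map_target ha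
  have hr := (extChartAt (𝓡 n) x₀).right_inv ha
  have hG : ContDiffAt ℝ ∞ (metricLoc x₀) q.1 := by
    have := contDiffAt_metricLoc hx
    rwa [hr] at this
  have hGpos : ∀ z, z ≠ 0 → 0 < metricLoc x₀ q.1 z z := fun z hz => by
    have := metricLoc_pos hx hz
    rwa [hr] at this
  have hdet : 0 < (gram (metricLoc x₀ q.1)).det := det_gram_pos (metricLoc_symm x₀ _) hGpos
  have hdetc : ContinuousAt (fun a => (gram (metricLoc x₀ a)).det) q.1 := by
    refine (contDiffAt_det (k := ∞) (f := fun a => gram (metricLoc x₀ a)) fun i j => ?_).continuousAt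
    exact (hG.clm_apply contDiffAt_const).clm_apply contDiffAt_const
  have hf1 : ContinuousAt (fun q : Eu n × Eu n => q.1) q := continuousAt_fst
  have c1 := eventually_norm_fderiv_fderiv_le hA he
  have c4 := eventually_norm_le (f := fun q => Real.exp (Θ + costB c ρ ρ' x₀ y₀ q)) (q := q)
    (Real.continuous_exp.continuousAt.comp (continuousAt_const.add hBq.continuousAt))
  have c2 := eventually_norm_fderiv_fderiv_le hB he
  have c3 := eventually_norm_fderiv_fderiv_le hG hf1
  have c10 := eventually_sq_norm_le (ContinuousAt.comp (g := metricLoc x₀) hG.continuousAt hf1) hGpos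
  have c11 := eventually_norm_le (f := fun q : Eu n × Eu n => ((gram (metricLoc x₀ q.1)).det)⁻¹)
    (q := q) ((ContinuousAt.comp (g := fun a => (gram (metricLoc x₀ a)).det) hdetc hf1).inv₀ hdet.ne')
  have hdpos : ∀ᶠ q' : Eu n × Eu n in 𝓝 q, 0 < (gram (metricLoc x₀ q'.1)).det :=
    (ContinuousAt.comp (g := fun a => (gram (metricLoc x₀ a)).det) hdetc hf1).eventually
      (lt_mem_nhds hdet)
  obtain ⟨k, k1, k2, k3, k4, k10, k11, hk⟩ := (c1.and <| c2.and <| c3.and <| c4.and <|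
    c10.and <| c11.and <| eventually_ge_atTop (1 : ℝ)).exists
  refine ⟨k, hk, ?_⟩
  filter_upwards [k1, k2, k3, k4, k10, k11, hdpos, e.open_source.mem_nhds hq] with q'
    b1 b2 b3 b4 b10 b11 b12 b13
  refine ⟨b13, b1.1, b1.2.1, b1.2.2, (le_abs_self _).trans b4, b2.2.1, b2.2.2, b3.1, b3.2.1,
    b3.2.2, b10, ?_⟩
  have := (le_abs_self _).trans b11
  rwa [inv_le_iff_one_le_mul₀ b12] at this

/-- The conclusion of the maximum principle for `w`, for graphs in a set `S` and a constant `C`. -/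
def EvolutionBound (c : M × N → WithTop ℝ) (ρ : M → ℝ) (ρ' : N → ℝ) (Θ : ℝ) (S : Set (M × N))
    (C : ℝ) : Prop :=
  ∀ (l : EReal) (u : ℝ → M → ℝ) (T : ℝ → M → N), 0 < l → IsFlowSolution n c ρ ρ' l u T →
    ∀ t ∈ timeInterval l, ∀ x, (x, T t x) ∈ S → |theta n c ρ ρ' (u t) (T t) x| ≤ Θ →
    ∀ v : TangentSpace (𝓡 n) x, ‖v‖ = 1 →
      IsGreatest (unitValues n c (u t) (T t)) (wForm c (u t) (T t) x v v) →
      C ≤ wForm c (u t) (T t) x v v →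
      ∃ d : ℝ, d ≤ 0 ∧ HasDerivWithinAt (fun s => wForm c (u s) (T s) x v v) d (timeInterval l) t

/-- One Legendre chart and one constant k serve all graph points near the given pair, so the
threshold comes from n, k and δ and not from the solution. -/
theorem exists_evolutionBound_nhds (hinj : IsTwisted n c) (hdet : IsNondegenerate n c)
    (hρ : ContMDiff (𝓡 n) 𝓘(ℝ, ℝ) ∞ ρ) (hρpos : ∀ x, 0 < ρ x)
    (hρ' : ContMDiff (𝓡 n) 𝓘(ℝ, ℝ) ∞ ρ') (hρ'pos : ∀ y, 0 < ρ' y) (hδ : 0 < δ)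
    (hMTW : MTWCondition (n := n) c δ) (Θ : ℝ) (h₀ : (x₀, y₀) ∉ singSet n c) :
    ∃ S ∈ 𝓝 (x₀, y₀), ∃ C, EvolutionBound (n := n) c ρ ρ' Θ S C := by
  obtain ⟨e, h, hmem, hsub⟩ := exists_costChart hdet h₀
  obtain ⟨k, hk, hkq⟩ := exists_coefBounds h hsub hρ hρpos hρ' hρ'pos hmem Θ
  obtain ⟨C, hC⟩ := exists_evolution_nonpos n k δ hk hδ
  have hcont : ContinuousAt (fun z : M × N => pairCoord x₀ z.1 y₀ z.2) (x₀, y₀) :=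
    (ContinuousAt.comp (f := Prod.fst) (continuousAt_extChartAt (I := 𝓡 n) x₀)
      continuousAt_fst).prodMk
    (ContinuousAt.comp (f := Prod.snd) (continuousAt_extChartAt (I := 𝓡 n) y₀) continuousAt_snd)
  refine ⟨{z | (z.1 ∈ (extChartAt (𝓡 n) x₀).source ∧ z.2 ∈ (extChartAt (𝓡 n) y₀).source) ∧
    CoefBounds c ρ ρ' x₀ y₀ e Θ k (pairCoord x₀ z.1 y₀ z.2)}, ?_, C, ?_⟩
  · filter_upwards [hcont.eventually hkq, prod_mem_nhds (extChartAt_source_mem_nhds (I := 𝓡 n) x₀)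
      (extChartAt_source_mem_nhds (I := 𝓡 n) y₀)] with z h1 h2
    exact ⟨h2, h1⟩
  · rintro l u T hl hs t ht x ⟨⟨hx, hy⟩, hb⟩ hΘ v hv hgreat hCΛ
    have hat := (extChartAt (𝓡 n) x₀).map_source hx
    have hu := hs.contDiffAt_loc ht hat
    have hjet := legendre_eq_jet h hx hy (hs.potential t ht) (hu.differentiableAt (by simp))
    have hj : jet (loc x₀ (u t)) (extChartAt (𝓡 n) x₀ x) ∈ e.target :=
      hjet ▸ e.map_source hb.mem
    refine ⟨_, ?_, hs.hasDerivWithinAt_wForm hinj hl ht h hsub hx hj v⟩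
    have hev := (eventually_of_nhdsWithin hat ht
      (hs.eventually_jet_mem hl ht hat hj)).1
    have htgt := (isOpen_extChartAt_target (I := 𝓡 n) x₀).mem_nhds hat
    obtain ⟨bm, bA, bDA, bD2A, bB, bDB, bD2B, bG, bDG, bD2G, blow, bdet⟩ := hb
    rw [hjet] at bA bDA bD2A bDB bD2B
    have hWv := hs.wForm_eq hinj h hsub hx ht hj v v
    have hpair : e.symm (jet (loc x₀ (u t)) (extChartAt (𝓡 n) x₀ x)) =
        pairCoord x₀ x y₀ (T t x) := by rw [← hjet, e.left_inv bm]
    have hWpos : ∀ V : Eu n, V ≠ 0 → 0 < wHess (coefA c x₀ y₀ e) (loc x₀ (u t))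
        (extChartAt (𝓡 n) x₀ x) V V := fun V hV => hs.wHess_pos hinj hdet hl h hsub ht hat hj hV
    refine hC (loc x₀ (u t)) (thetaLoc c ρ ρ' u T x₀ t) (coefA c x₀ y₀ e)
      (fun p => costB c ρ ρ' x₀ y₀ (e.symm p)) (metricLoc x₀) (extChartAt (𝓡 n) x₀ x)
      (tau x₀ x v) (wForm c (u t) (T t) x v v) (hu.of_le ENat.LEInfty.out)
      ((contDiffAt_coefA h hj).of_le ENat.LEInfty.out)
      ((h.contDiffAt_comp_symm hj (contDiffAt_costB h hsub hρ hρpos hρ' hρ'pos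
        (e.map_target hj))).of_le ENat.LEInfty.out)
      ((contDiffAt_metricLoc hx).of_le ENat.LEInfty.out)
      ((hs.contDiffAt_thetaLoc hl ht hat).of_le ENat.LEInfty.out) ?_ ?_ ?_ ?_ hWv.symm
      (metricLoc_symm x₀ _) blow ?_ bdet bA bDA bD2A bDB bD2B bG bDG bD2G ?_ hCΛ
    · filter_upwards [hev, htgt] with a' ha' hat'
      exact ⟨wHess_coefA_symm h ((hs.contDiffAt_loc ht hat').of_le ENat.LEInfty.out) ha',
        fun V hV => hs.wHess_pos hinj hdet hl h hsub ht hat' ha' hV⟩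
    · filter_upwards [hev, htgt] with a' ha' hat'
      exact hs.thetaLoc_eq hinj hρpos hρ'pos h hsub ht hat' ha'
    -- Λ is the maximum over all points and all unit directions, so w ≤ Λ g holds as forms
    -- throughout the neighbourhood.
    · filter_upwards [hev, htgt] with a' ha' hat' z
      have hr := (extChartAt (𝓡 n) x₀).right_inv hat'
      have := hs.wHess_le_of_unit hinj hdet ht h hsub ((extChartAt (𝓡 n) x₀).map_target hat')
        (by rwa [hr]) (fun z' hz' => hgreat.2 ⟨_, z', hz', rfl⟩) z
      rwa [hr] at this
    · have h1 := innerForm_eq hx (v : Eu n) (v : Eu n)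
      have h2 := innerForm_self x v
      rw [hv, one_pow] at h2
      exact h1.symm.trans h2
    -- det w = exp(θ + B) ≤ exp(Θ + B): the bound on θ controls the determinant of w.
    · have h1 := hs.thetaLoc_eq hinj hρpos hρ'pos h hsub ht hat hj
      have h2 : thetaLoc c ρ ρ' u T x₀ t (extChartAt (𝓡 n) x₀ x) =
          theta n c ρ ρ' (u t) (T t) x := by
        simp only [thetaLoc, loc, (extChartAt (𝓡 n) x₀).left_inv hx]
      have hdpos := det_gram_pos (wHess_coefA_symm h (hu.of_le ENat.LEInfty.out) hj) hWpos
      rw [← Real.exp_log hdpos]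
      refine le_trans (Real.exp_le_exp.2 ?_) bB
      rw [h2, hpair] at h1
      have := le_of_abs_le hΘ
      linarith
    · intro z hz
      have := mtw_local hMTW h hsub hdet hx hy bm hv hz
      rwa [hjet] at this

/-- The constant can be chosen uniformly on compact sets off `sing(c)`. -/
theorem exists_evolutionBound (hinj : IsTwisted n c) (hdet : IsNondegenerate n c)
    (hρ : ContMDiff (𝓡 n) 𝓘(ℝ, ℝ) ∞ ρ) (hρpos : ∀ x, 0 < ρ x)
    (hρ' : ContMDiff (𝓡 n) 𝓘(ℝ, ℝ) ∞ ρ') (hρ'pos : ∀ y, 0 < ρ' y) (hδ : 0 < δ)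
    (hMTW : MTWCondition (n := n) c δ) (Θ : ℝ) {K : Set (M × N)} (hK : IsCompact K)
    (hKs : ∀ p ∈ K, p ∉ singSet n c) : ∃ C, EvolutionBound (n := n) c ρ ρ' Θ K C := by
  refine hK.induction_on (p := fun S => ∃ C, EvolutionBound (n := n) c ρ ρ' Θ S C) ?_ ?_ ?_ ?_
  · exact ⟨0, fun l u T _ _ t _ x hx => absurd hx (notMem_empty _)⟩
  · rintro S S' hSS' ⟨C, hC⟩
    exact ⟨C, fun l u T hl hs t ht x hx => hC l u T hl hs t ht x (hSS' hx)⟩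
  · rintro S S' ⟨C, hC⟩ ⟨C', hC'⟩
    refine ⟨max C C', fun l u T hl hs t ht x hx hΘ v hv hg hle => ?_⟩
    rcases hx with hx | hx
    · exact hC l u T hl hs t ht x hx hΘ v hv hg ((le_max_left _ _).trans hle)
    · exact hC' l u T hl hs t ht x hx hΘ v hv hg ((le_max_right _ _).trans hle)
  · rintro ⟨x₀, y₀⟩ hp
    obtain ⟨S, hS, hC⟩ := exists_evolutionBound_nhds hinj hdet hρ hρpos hρ' hρ'pos hδ hMTW Θ
      (hKs _ hp)
    exact ⟨S, nhdsWithin_le_nhds hS, hC⟩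

end Uniform

/-! ### The largest eigenvalue and the final bound. -/

theorem exists_unit_isMax {n : ℕ} {G W : Eu n →L[ℝ] Eu n →L[ℝ] ℝ} (hG : ∀ z, z ≠ 0 → 0 < G z z)
    {z₀ : Eu n} (hz₀ : z₀ ≠ 0) : ∃ v, G v v = 1 ∧ ∀ z, G z z = 1 → W z z ≤ W v v := by
  have hcont : ∀ B : Eu n →L[ℝ] Eu n →L[ℝ] ℝ, Continuous fun z => B z z := fun B =>
    B.continuous.clm_apply continuous_id
  obtain ⟨k, hk, hk0⟩ := ((eventually_sq_norm_le (X := Unit) (G := fun _ => G) (q := ())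
    continuousAt_const hG).and (eventually_ge_atTop 0)).exists
  have hk := hk.self_of_nhds
  have hcomp : IsCompact {z | G z z = 1} := by
    refine (isCompact_closedBall (0 : Eu n) (Real.sqrt k)).of_isClosed_subset
      (isClosed_eq (hcont G) continuous_const) fun z (hz : G z z = 1) => ?_
    have := hk z
    rw [hz, mul_one] at this
    rw [mem_closedBall_zero_iff]
    exact Real.le_sqrt_of_sq_le this
  have hne : {z | G z z = 1}.Nonempty := by
    have hp := hG z₀ hz₀
    refine ⟨(Real.sqrt (G z₀ z₀))⁻¹ • z₀, ?_⟩
    have h1 : (Real.sqrt (G z₀ z₀)) ^ 2 = G z₀ z₀ := Real.sq_sqrt hp.le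
    have h2 : Real.sqrt (G z₀ z₀) ≠ 0 := (Real.sqrt_pos.2 hp).ne'
    simp only [mem_ofPred_eq, map_smul, _root_.smul_apply, smul_eq_mul]
    rw [← mul_assoc, ← mul_inv, ← sq, h1, inv_mul_cancel₀ hp.ne']
  obtain ⟨v, hv, hmax⟩ := hcomp.exists_isMaxOn hne (hcont W).continuousOn
  exact ⟨v, hv, fun z hz => hmax hz⟩

/-- The largest eigenvalue of `w` with respect to the metric. -/
def maxEigenvalue {n : ℕ} {M N : Type*}
    [EMetricSpace M] [ChartedSpace (EuclideanSpace ℝ (Fin n)) M]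
    [RiemannianBundle (fun x : M => TangentSpace (𝓡 n) x)]
    [TopologicalSpace N] [ChartedSpace (EuclideanSpace ℝ (Fin n)) N]
    (c : M × N → WithTop ℝ) (u : M → ℝ) (T : M → N) (x : M) : ℝ :=
  sSup {r | ∃ z : TangentSpace (𝓡 n) x, ‖z‖ = 1 ∧ wForm c u T x z z = r}

namespace IsFlowSolution

variable {n : ℕ} {M N : Type*}
  [EMetricSpace M] [ChartedSpace (EuclideanSpace ℝ (Fin n)) M]
  [RiemannianBundle (fun x : M => TangentSpace (𝓡 n) x)]
  [EMetricSpace N] [ChartedSpace (EuclideanSpace ℝ (Fin n)) N]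
  [RiemannianBundle (fun y : N => TangentSpace (𝓡 n) y)]
  {c : M × N → WithTop ℝ} {ρ : M → ℝ} {ρ' : N → ℝ}
  {l : EReal} {u : ℝ → M → ℝ} {T : ℝ → M → N} {t : ℝ}
  [IsManifold (𝓡 n) ∞ M] [IsManifold (𝓡 n) ∞ N]

/-- Compactness of the unit sphere of the metric makes the supremum a maximum. The nonzero vector
`z₀` excludes dimension zero, where the sphere is empty. -/
theorem exists_unit_eq_maxEigenvalue (hinj : IsTwisted n c) (hdet : IsNondegenerate n c)
    (hs : IsFlowSolution n c ρ ρ' l u T) (ht : t ∈ timeInterval l) {z₀ : Eu n} (hz₀ : z₀ ≠ 0)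
    (x : M) : ∃ v : TangentSpace (𝓡 n) x, ‖v‖ = 1 ∧
      wForm c (u t) (T t) x v v = maxEigenvalue (n := n) c (u t) (T t) x ∧
      ∀ z : TangentSpace (𝓡 n) x, ‖z‖ = 1 →
        wForm c (u t) (T t) x z z ≤ maxEigenvalue (n := n) c (u t) (T t) x := by
  obtain ⟨e, h, hsub, hj⟩ := hs.exists_chart hdet ht x
  have hx := mem_extChartAt_source (I := 𝓡 n) x
  obtain ⟨v, hv, hmax⟩ := exists_unit_isMax (G := innerForm (n := n) x)
    (W := wHess (coefA c x (T t x) e) (loc x (u t)) (extChartAt (𝓡 n) x x))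
    (fun z hz => innerForm_pos x hz) hz₀
  have hw : ∀ z : Eu n, wForm c (u t) (T t) x z z =
      wHess (coefA c x (T t x) e) (loc x (u t)) (extChartAt (𝓡 n) x x) z z := fun z => by
    rw [hs.wForm_eq hinj h hsub hx ht hj z z, tau_self]
  have hunit : ∀ z : TangentSpace (𝓡 n) x, ‖z‖ = 1 ↔ innerForm x (z : Eu n) (z : Eu n) = 1 :=
    fun z => by
      have h1 : innerForm x (z : Eu n) (z : Eu n) = ‖z‖ ^ 2 := innerForm_self x z
      rw [h1, pow_eq_one_iff_of_nonneg (norm_nonneg z) two_ne_zero]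
  have hg : IsGreatest {r | ∃ z : TangentSpace (𝓡 n) x, ‖z‖ = 1 ∧ wForm c (u t) (T t) x z z = r}
      (wForm c (u t) (T t) x v v) := by
    refine ⟨⟨v, (hunit v).2 hv, rfl⟩, ?_⟩
    rintro r ⟨z, hz, rfl⟩
    exact (hw z).le.trans ((hmax z ((hunit z).1 hz)).trans (hw v).ge)
  have heq : maxEigenvalue (n := n) c (u t) (T t) x = wForm c (u t) (T t) x v v := hg.csSup_eq
  exact ⟨v, (hunit v).2 hv, heq.symm, fun z hz => heq ▸ hg.2 ⟨z, hz, rfl⟩⟩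

variable [IsContMDiffRiemannianBundle (𝓡 n) ∞ (EuclideanSpace ℝ (Fin n))
      (fun x : M => TangentSpace (𝓡 n) x)]

/-- The largest eigenvalue is below r exactly when r g - w is positive definite, which is an open
condition on continuous coefficients. -/
theorem upperSemicontinuousOn_maxEigenvalue (hinj : IsTwisted n c) (hdet : IsNondegenerate n c)
    (hl : 0 < l) (hs : IsFlowSolution n c ρ ρ' l u T) {z₀ : Eu n} (hz₀ : z₀ ≠ 0) :
    UpperSemicontinuousOn (fun q : M × ℝ => maxEigenvalue (n := n) c (u q.2) (T q.2) q.1)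
      (univ ×ˢ timeInterval l) := by
  rintro ⟨x, t⟩ ⟨-, ht⟩ r hr
  obtain ⟨e, h, hsub, hj⟩ := hs.exists_chart hdet ht x
  have hx := mem_extChartAt_source (I := 𝓡 n) x
  have hat := mem_extChartAt_target (I := 𝓡 n) x
  obtain ⟨-, -, -, hle⟩ := hs.exists_unit_eq_maxEigenvalue hinj hdet ht hz₀ x
  have hc : ContinuousWithinAt (fun q : Eu n × ℝ => r • metricLoc x q.1 -
      wHess (coefA c x (T t x) e) (loc x (u q.2)) q.1)
      ((extChartAt (𝓡 n) x).target ×ˢ timeInterval l) (extChartAt (𝓡 n) x x, t) :=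
    ((ContinuousAt.comp (g := metricLoc x) (f := fun q : Eu n × ℝ => q.1)
      (x := (extChartAt (𝓡 n) x x, t)) (contDiffAt_metricLoc hx).continuousAt
      continuousAt_fst).continuousWithinAt.const_smul r).sub
      (hs.continuousWithinAt_wHess hl h ht hat hj)
  have hpos := hc.eventually (isOpen_posDef.mem_nhds fun V hV => by
    have h1 := hs.wHess_le_of_unit hinj hdet ht h hsub hx hj hle V
    have h2 := metricLoc_pos hx hV
    change 0 < r * metricLoc x (extChartAt (𝓡 n) x x) V V - _
    exact sub_pos.2 (h1.trans_lt (mul_lt_mul_of_pos_right hr h2)))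
  filter_upwards [(tendsto_chart hx (timeInterval l) t).eventually
      (hpos.and (hs.eventually_jet_mem hl ht hat hj)), self_mem_nhdsWithin,
    nhdsWithin_le_nhds (continuousAt_fst.preimage_mem_nhds
      (extChartAt_source_mem_nhds (I := 𝓡 n) x))] with q hq hqJ hqx
  obtain ⟨v, hv, hveq, -⟩ := hs.exists_unit_eq_maxEigenvalue hinj hdet hqJ.2 hz₀ q.1
  have hv0 : v ≠ 0 := (norm_pos_iff (E := TangentSpace (𝓡 n) q.1)).1 (hv.symm ▸ one_pos)
  have h3 : tau x q.1 v ≠ 0 := tau_ne_zero hqx hv0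
  have h4 : 0 < r * metricLoc x (extChartAt (𝓡 n) x q.1) (tau x q.1 v) (tau x q.1 v) -
    wHess (coefA c x (T t x) e) (loc x (u q.2)) (extChartAt (𝓡 n) x q.1) (tau x q.1 v)
      (tau x q.1 v) := hq.1 _ h3
  have h5 := innerForm_eq hqx (v : Eu n) (v : Eu n)
  have h6 := hs.wForm_eq hinj h hsub hqx hqJ.2 hq.2 v v
  have h7 := innerForm_self q.1 v
  rw [hv, one_pow] at h7
  have h8 := h5.symm.trans h7
  rw [h8, mul_one] at h4
  exact hveq.symm.trans_lt (h6.trans_lt (sub_pos.1 h4))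

variable [CompactSpace M]

theorem bddAbove_unitValues (hinj : IsTwisted n c) (hdet : IsNondegenerate n c) (hl : 0 < l)
    (hs : IsFlowSolution n c ρ ρ' l u T) (ht : t ∈ timeInterval l) :
    BddAbove (unitValues n c (u t) (T t)) := by
  rcases subsingleton_or_nontrivial (Eu n) with _ | _
  · refine ⟨0, ?_⟩
    rintro r ⟨x, z, hz, -⟩
    exact absurd (Subsingleton.elim (α := Eu n) z 0)
      ((norm_pos_iff (E := TangentSpace (𝓡 n) x)).1 (hz.symm ▸ one_pos))
  · obtain ⟨z₀, hz₀⟩ := exists_ne (0 : Eu n)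
    obtain ⟨b, hb⟩ := ((hs.upperSemicontinuousOn_maxEigenvalue hinj hdet hl hz₀).mono
      (prod_mono_right (singleton_subset_iff.2 ht))).bddAbove_of_isCompact
        (isCompact_univ.prod (isCompact_singleton (x := t)))
    refine ⟨b, ?_⟩
    rintro r ⟨x, z, hz, rfl⟩
    obtain ⟨-, -, -, hle⟩ := hs.exists_unit_eq_maxEigenvalue hinj hdet ht hz₀ x
    exact (hle z hz).trans (hb ⟨(x, t), ⟨mem_univ x, rfl⟩, rfl⟩)

/-- The bound on `w` that follows from `EvolutionBound`. -/
theorem wForm_le_max (hinj : IsTwisted n c) (hdet : IsNondegenerate n c) (hl : 0 < l)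
    (hs : IsFlowSolution n c ρ ρ' l u T) {Θ C : ℝ} {S : Set (M × N)}
    (hC : EvolutionBound (n := n) c ρ ρ' Θ S C)
    (hS : ∀ t ∈ timeInterval l, ∀ x, (x, T t x) ∈ S)
    (hΘ : ∀ t ∈ timeInterval l, ∀ x, |theta n c ρ ρ' (u t) (T t) x| ≤ Θ)
    (ht : t ∈ timeInterval l) (x : M) (z : TangentSpace (𝓡 n) x) (hz : ‖z‖ = 1) :
    wForm c (u t) (T t) x z z ≤ max C (sSup (unitValues n c (u 0) (T 0))) := by
  obtain ⟨z₀, hz₀⟩ : ∃ z₀ : Eu n, z₀ ≠ 0 :=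
    ⟨z, (norm_pos_iff (E := TangentSpace (𝓡 n) x)).1 (hz.symm ▸ one_pos)⟩
  obtain ⟨-, -, -, hle⟩ := hs.exists_unit_eq_maxEigenvalue hinj hdet ht hz₀ x
  refine (hle z hz).trans (maximum_principle (l := l)
    (f := fun x t => maxEigenvalue (n := n) c (u t) (T t) x) ht
    ((hs.upperSemicontinuousOn_maxEigenvalue hinj hdet hl hz₀).mono
      (prod_mono_right (Icc_subset_timeInterval ht))) ?_ ?_ x)
  · intro s hsJ _ y hmax hlt
    obtain ⟨v, hv, hveq, hvle⟩ := hs.exists_unit_eq_maxEigenvalue hinj hdet hsJ hz₀ y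
    obtain ⟨d, hd, hder⟩ := hC l u T hl hs s hsJ y (hS s hsJ y) (hΘ s hsJ y) v hv
      ⟨⟨y, v, hv, rfl⟩, by
        rintro r ⟨y', z', hz', rfl⟩
        obtain ⟨-, -, -, hle'⟩ := hs.exists_unit_eq_maxEigenvalue hinj hdet hsJ hz₀ y'
        exact (hle' z' hz').trans ((hmax y').trans hveq.ge)⟩
      (hveq ▸ (le_max_left _ _).trans hlt.le)
    -- Freezing the maximising vector gives a differentiable function below the largest eigenvalue,
    -- equal to it at time s.
    refine ⟨fun r => wForm c (u r) (T r) y v v, d, hd, fun r hr => ?_, hveq, hder⟩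
    obtain ⟨-, -, -, hle'⟩ := hs.exists_unit_eq_maxEigenvalue hinj hdet hr hz₀ y
    exact hle' v hv
  · intro y
    have h0 := zero_mem_timeInterval hl
    obtain ⟨v, hv, hveq, -⟩ := hs.exists_unit_eq_maxEigenvalue hinj hdet h0 hz₀ y
    exact hveq.ge.trans ((le_csSup (hs.bddAbove_unitValues hinj hdet hl h0)
      ⟨y, v, hv, rfl⟩).trans (le_max_right _ _))

end IsFlowSolution

end TransportFlow

end

theorem theorem3p5 {n : ℕ} {M N : Type*}
    [EMetricSpace M] [CompactSpace M] [ChartedSpace (EuclideanSpace ℝ (Fin n)) M]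
    [IsManifold (𝓡 n) ∞ M] [RiemannianBundle (fun x : M => TangentSpace (𝓡 n) x)]
    [IsContMDiffRiemannianBundle (𝓡 n) ∞ (EuclideanSpace ℝ (Fin n))
      (fun x : M => TangentSpace (𝓡 n) x)]
    [IsRiemannianManifold (𝓡 n) M]
    [EMetricSpace N] [CompactSpace N] [ChartedSpace (EuclideanSpace ℝ (Fin n)) N]
    [IsManifold (𝓡 n) ∞ N] [RiemannianBundle (fun y : N => TangentSpace (𝓡 n) y)]
    [IsContMDiffRiemannianBundle (𝓡 n) ∞ (EuclideanSpace ℝ (Fin n))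
      (fun y : N => TangentSpace (𝓡 n) y)]
    [IsRiemannianManifold (𝓡 n) N]
    (c : M × N → WithTop ℝ)
    (hinj : TransportFlow.IsTwisted n c) (hdet : TransportFlow.IsNondegenerate n c)
    (ρ : M → ℝ) (hρ : ContMDiff (𝓡 n) 𝓘(ℝ, ℝ) ∞ ρ) (hρpos : ∀ x, 0 < ρ x)
    (ρ' : N → ℝ) (hρ' : ContMDiff (𝓡 n) 𝓘(ℝ, ℝ) ∞ ρ') (hρ'pos : ∀ y, 0 < ρ' y)
    (δ : ℝ) (hδ : 0 < δ) (hMTW : TransportFlow.MTWCondition (n := n) c δ)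
    (hstay : TransportFlow.StayAway n c) (Θ : ℝ) :
    ∃ C : ℝ, ∀ (l : EReal) (u : ℝ → M → ℝ) (T : ℝ → M → N), 0 < l →
      TransportFlow.IsFlowSolution n c ρ ρ' l u T →
      (∀ x, |TransportFlow.theta n c ρ ρ' (u 0) (T 0) x| ≤ Θ) →
      (∀ t ∈ TransportFlow.timeInterval l, ∀ (x : M) (v : TangentSpace (𝓡 n) x), ‖v‖ = 1 →
        IsGreatest (TransportFlow.unitValues n c (u t) (T t))
          (TransportFlow.wForm c (u t) (T t) x v v) →
        C ≤ TransportFlow.wForm c (u t) (T t) x v v →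
        ∃ d : ℝ, d ≤ 0 ∧
          HasDerivWithinAt (fun s => TransportFlow.wForm c (u s) (T s) x v v) d
            (TransportFlow.timeInterval l) t) ∧
      BddAbove (TransportFlow.unitValues n c (u 0) (T 0)) ∧
      (∀ t ∈ TransportFlow.timeInterval l, ∀ (x : M) (z : TangentSpace (𝓡 n) x), ‖z‖ = 1 →
        TransportFlow.wForm c (u t) (T t) x z z ≤
          max C (sSup (TransportFlow.unitValues n c (u 0) (T 0)))) := by
  -- The compact set, and hence the constant, is fixed before any solution is considered; this gives
  -- independence of t, l and u.
  obtain ⟨K, hK, hKs, hgraph⟩ := TransportFlow.exists_isCompact_graph hinj hdet hρ hρpos hρ' hρ'pos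
    hstay Θ
  obtain ⟨C, hC⟩ := TransportFlow.exists_evolutionBound hinj hdet hρ hρpos hρ' hρ'pos hδ hMTW Θ hK
    hKs
  refine ⟨C, fun l u T hl hs hΘ => ?_⟩
  have hθ := fun t ht x =>
    TransportFlow.IsFlowSolution.abs_theta_le hinj hdet hρ hρpos hρ' hρ'pos hl hs hΘ (t := t) ht x
  have hg := hgraph l u T hl hs hΘ
  exact ⟨fun t ht x v hv => hC l u T hl hs t ht x (hg t ht x) (hθ t ht x) v hv,
    hs.bddAbove_unitValues hinj hdet hl (TransportFlow.zero_mem_timeInterval hl),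
    fun t ht x z hz => hs.wForm_le_max hinj hdet hl hC hg hθ ht x z hz⟩
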